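/- Let $K$ be a dyadic local field (a nonarchimedean local field of characteristic $0$ with residue characteristic $2$), with ring of integers $\mathcal O$, maximal ideal $\mathfrak p$, $q=\#(\mathcal O/\mathfrak p)$ and $2\mathcal O=\mathfrak p^{m}$. Let $L/K$ be a ramified quadratic extension with ring of integers $\mathcal O_L$, nontrivial automorphism $\sigma$ and relative discriminant $\Delta_{L/K}=\mathfrak p^{\delta}$. Let $V$ be the space of pairs $x=(x_1,x_2)$ of $2\times2$ Hermitian matrices $x_i=\begin{pmatrix}x_{i0}&x_{i1}\\ \sigma(x_{i1})&x_{i2}\end{pmatrix}$, $x_{i0},x_{i2}\in K$, $x_{i1}\in L$, with the additive Haar measure $\mathrm{vol}$ normalized by $\mathrm{vol}(V_{\mathcal O})=1$, where $V_{\mathcal O}$ is the set of $x$ with all entries integral. The group $\mathcal K=\mathrm{GL}_2(\mathcal O_L)\times\mathrm{GL}_2(\mathcal O)$ acts on $V$ by $M_{gx}(v)=g_1\,M_x(vg_2)\,{}^t\sigma(g_1)$, where $M_x(v)=v_1x_1+v_2x_2$ for a row vector $v=(v_1,v_2)$. For $x\in V$ let $K(x)$ be the splitting field over $K$ of $F_x(z,1)$,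 where $F_x(v)=-\det M_x(v)$. For a quadratic Eisenstein polynomial $p(z)=z^2+a_1z+a_2$ over $\mathcal O$ put $$w_p=\left(\begin{pmatrix}0&1\\1&a_1\end{pmatrix},\begin{pmatrix}1&a_1\\a_1&a_1^2-a_2\end{pmatrix}\right),$$ so that $F_{w_p}(z,1)=p(z)$, and let $\ell(p)=\mathrm{ord}_K(a_1)$ if this is at most $m$, and $\ell(p)=m+1$ otherwise. Fix an Eisenstein polynomial $\widetilde p$ whose roots $\eta_1,\eta_2$ generate $L$, and put $\widetilde\ell=\ell(\widetilde p)$ and $$w_\eta=\left(\begin{pmatrix}0&1\\1&0\end{pmatrix},\begin{pmatrix}1&-\eta_2\\-\eta_1&0\end{pmatrix}\right).$$ For a ramified quadratic extension $F/K$ generated by the roots of an Eisenstein polynomial $p(z)=z^2+a_1z+a_2$, the level of $F$ and $L$ (defined when $F\not\cong L$) is the largest integer $i$ for which there is $\eta\in\mathcal O_L$ with $\mathrm{Tr}_{L/K}(\eta)\equiv a_1$ and $\mathrm N_{L/K}(\eta)\equiv a_2$ modulo $\mathfrak p^{i}$. Let $\mathfrak X_{\ell_1}$ be the set of isomorphism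 classes of quadratic extensions of $K$ generated by the roots of an Eisenstein polynomial $p$ with $\ell(p)=\ell_1$; let $\mathfrak X_{\widetilde\ell}(i)$ be the set of those classes in $\mathfrak X_{\widetilde\ell}$ which have level $i$ with respect to $L$. An extension $F/K$ is of type (rm rm ur) if it is a ramified quadratic extension with $F\not\cong L$ and $F\cdot L/L$ unramified. For a finite family $(p_j)_j$ of Eisenstein polynomials, say that it represents a set $\mathfrak X$ of isomorphism classes of extensions of $K$ if $\{K(w_{p_j})\}_j$ is a complete set of representatives for $\mathfrak X$, each class occurring exactly once. Then: 1. If $1\le\ell_1\le m$, $\ell_1\neq\widetilde\ell$, and $(p_j)_j$ represents $\mathfrak X_{\ell_1}$, then $\sum_j\mathrm{vol}(\mathcal K w_{p_j})=q^{-\ell_1}(1-q^{-1})^2(1-q^{-2})^2$. 2. If $\widetilde\ell\le m$, $\ell_1=m+1$, and $(p_j)_j$ represents $\mathfrak X_{\ell_1}$, then $\sum_j\mathrm{vol}(\mathcal K w_{p_j})=q^{-\ell_1}(1-q^{-1})(1-q^{-2})^2$. 3. If $\widetilde\ell\le m$ and $(p_j)_j$ represents $\mathfrak X_{\widetilde\ell}(\widetilde\ell)$,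 then $\sum_j\mathrm{vol}(\mathcal K w_{p_j})=q^{-\widetilde\ell}(1-q^{-1})(1-2q^{-1})(1-q^{-2})^2$. 4. If $\widetilde\ell\le i<\delta$, and either $\widetilde\ell<i$ or $\widetilde\ell=m+1$, and $(p_j)_j$ represents $\mathfrak X_{\widetilde\ell}(i)$, then $\sum_j\mathrm{vol}(\mathcal K w_{p_j})=q^{-i}(1-q^{-1})^2(1-q^{-2})^2$. 5. If $p$ is an Eisenstein polynomial such that $K(w_p)$ is of type (rm rm ur), then $\mathrm{vol}(\mathcal K w_{p})+\mathrm{vol}(\mathcal K w_\eta)=q^{-\delta}(1-q^{-1})(1-q^{-2})^2$. -/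

import Mathlib

open ValuativeRel Polynomial MeasureTheory

namespace DyadicPair

universe u w

noncomputable section

/-! ### The base field

`K` is a nonarchimedean local field, with ring of integers `𝒪[K]`, maximal ideal `𝓂[K]` and
residue field `𝓀[K]`; `L` will be a ramified quadratic extension of `K`. -/

section Base

variable (K : Type u) [Field K] [ValuativeRel K] [TopologicalSpace K]
  [IsNonarchimedeanLocalField K]

/-- The cardinality `q` of the residue field. -/
def resCard : ℕ := Nat.card 𝓀[K]

/-- The integer `m` with `2 𝒪 = 𝔭 ^ m`. -/
def twoOrd : ℕ := ENat.toNat (IsDiscreteValuationRing.addVal 𝒪[K] 2)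

/-- The coefficients of a quadratic Eisenstein polynomial `z ^ 2 + a₁ z + a₂` over `𝒪`. -/
structure Eisenstein where
  a₁ : 𝒪[K]
  a₂ : 𝒪[K]
  a₁_mem : a₁ ∈ 𝓂[K]
  a₂_mem : a₂ ∈ 𝓂[K]
  a₂_not_mem : a₂ ∉ 𝓂[K] ^ 2

variable {K}

/-- The Eisenstein polynomial itself, as a polynomial over `K`. -/
def Eisenstein.poly (p : Eisenstein K) : K[X] := X ^ 2 + C (p.a₁ : K) * X + C (p.a₂ : K)

/-- `ℓ(p)`: the order of `a₁` if this is at most `m`, and `m + 1` otherwise. -/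
def Eisenstein.ell (p : Eisenstein K) : ℕ :=
  ENat.toNat (min (IsDiscreteValuationRing.addVal 𝒪[K] p.a₁) ((twoOrd K + 1 : ℕ) : ℕ∞))

/-- The extension `F / K` is generated by the roots of the Eisenstein polynomial `p`. -/
def Eisenstein.Generates (p : Eisenstein K) (F : Type*) [Field F] [Algebra K F] : Prop :=
  p.poly.IsSplittingField K F

end Base

/-! ### The extension `L / K` -/

section Pair

variable (K : Type u) [Field K] [ValuativeRel K] [TopologicalSpace K]
  [IsNonarchimedeanLocalField K]
variable (L : Type w) [Field L] [ValuativeRel L] [TopologicalSpace L]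
  [IsNonarchimedeanLocalField L] [Algebra K L]

/-- The relative discriminant of `L / K`: the ideal of `𝒪[K]` generated by the discriminants of
all `[L : K]`-tuples of integers of `L`. -/
def relDiscr : Ideal 𝒪[K] :=
  Ideal.span {d : 𝒪[K] | ∃ b : Fin (Module.finrank K L) → 𝒪[L],
    (d : K) = Algebra.discr K (fun i => (b i : L))}

variable {K} in
/-- The set of integers `η` of `L` with `Tr η ≡ a₁ (𝔭 ^ i₁)` and `N η ≡ a₂ (𝔭 ^ i₂)`, where
`p = z ^ 2 + a₁ z + a₂`. -/
def levelSet (p : Eisenstein K) (i₁ i₂ : ℕ) : Set 𝒪[L] :=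
  {η | (∃ c ∈ 𝓂[K] ^ i₁, Algebra.trace K L (η : L) = (p.a₁ : K) + (c : K)) ∧
    (∃ c ∈ 𝓂[K] ^ i₂, Algebra.norm K (η : L) = (p.a₂ : K) + (c : K))}

/-- The level of `F` and `L` is `i`: for an Eisenstein polynomial `p` generating `F`, the integer
`i` is the largest one for which the congruences `Tr η ≡ a₁`, `N η ≡ a₂` modulo `𝔭 ^ i` are
solvable with `η` an integer of `L`. -/
def HasLevel (F : Type*) [Field F] [Algebra K F] (i : ℕ) : Prop :=
  ∃ p : Eisenstein K, p.Generates F ∧ IsGreatest {n : ℕ | (levelSet L p n n).Nonempty} i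

/-! ### The space of pairs of binary Hermitian forms -/

/-- `V = W ⊗ Aff²`: a pair `(x 0, x 1)` of binary Hermitian matrices.  The matrix
`((x₀, x₁), (σ x₁, x₂))` with `x₀, x₂ ∈ K` and `x₁ ∈ L` is recorded by its coordinates
`(x₀, x₁, x₂)`. -/
abbrev HermPair : Type (max u w) := Fin 2 → K × L × K

/-- The set `V_𝒪` of integral points of `V`. -/
def integralPoints : Set (HermPair K L) :=
  Set.univ.pi fun _ => (𝒪[K] : Set K) ×ˢ (𝒪[L] : Set L) ×ˢ (𝒪[K] : Set K)

theorem isOpen_integers (E : Type*) [Field E] [ValuativeRel E] [TopologicalSpace E]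
    [IsNonarchimedeanLocalField E] : IsOpen (𝒪[E] : Set E) := by
  refine AddSubgroup.isOpen_of_mem_nhds 𝒪[E].toAddSubgroup (g := 0) ?_
  refine (IsValuativeTopology.hasBasis_nhds_zero' E).mem_iff.mpr ⟨1, one_ne_zero, fun x hx => ?_⟩
  exact le_of_lt (show valuation E x < 1 from hx)

theorem isCompact_integers (E : Type*) [Field E] [ValuativeRel E] [TopologicalSpace E]
    [IsNonarchimedeanLocalField E] : IsCompact (𝒪[E] : Set E) :=
  IsNonarchimedeanLocalField.isCompact_closedBall E 1

/-- `V_𝒪` as a compact set with non-empty interior. -/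
def integralCompacts : TopologicalSpace.PositiveCompacts (HermPair K L) where
  carrier := integralPoints K L
  isCompact' := isCompact_univ_pi fun _ =>
    (isCompact_integers K).prod ((isCompact_integers L).prod (isCompact_integers K))
  interior_nonempty' := by
    have h : IsOpen (integralPoints K L) := isOpen_set_pi Set.finite_univ fun _ _ =>
      (isOpen_integers K).prod ((isOpen_integers L).prod (isOpen_integers K))
    rw [h.interior_eq]
    exact ⟨0, fun _ _ => ⟨zero_mem _, zero_mem _, zero_mem _⟩⟩

/-- The volume of a subset of `V`, for the additive Haar measure with `vol(V_𝒪) = 1`. -/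
def vol (A : Set (HermPair K L)) : ENNReal :=
  letI : MeasurableSpace (HermPair K L) := borel _
  haveI : BorelSpace (HermPair K L) := ⟨rfl⟩
  Measure.addHaarMeasure (integralCompacts K L) A

variable {K L}

/-- The Hermitian matrix with coordinates `y`. -/
def hermMatrix (σ : L ≃ₐ[K] L) (y : K × L × K) : Matrix (Fin 2) (Fin 2) L :=
  !![algebraMap K L y.1, y.2.1; σ y.2.1, algebraMap K L y.2.2]

/-- The relation `y = (g₁, g₂) x`, for `(g₁, g₂)` in the standard maximal compact subgroup
`GL₂(𝒪[L]) × GL₂(𝒪[K])`.  With `M_x(v) = v₁ x₁ + v₂ x₂` for a row vector `v`, the action is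
`M_{gx}(v) = g₁ M_x(v g₂) ᵗ(σ g₁)`. -/
def ActsTo (σ : L ≃ₐ[K] L) (g₁ : GL (Fin 2) 𝒪[L]) (g₂ : GL (Fin 2) 𝒪[K])
    (x y : HermPair K L) : Prop :=
  ∀ r : Fin 2, hermMatrix σ (y r) =
    g₁.1.map (fun a => (a : L)) *
      (∑ s : Fin 2, algebraMap K L (g₂.1 r s : K) • hermMatrix σ (x s)) *
      (g₁.1.map (fun a => σ (a : L))).transpose

/-- The orbit of `x` under the standard maximal compact subgroup
`GL₂(𝒪[L]) × GL₂(𝒪[K])`. -/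
def orbit (σ : L ≃ₐ[K] L) (x : HermPair K L) : Set (HermPair K L) :=
  {y | ∃ (g₁ : GL (Fin 2) 𝒪[L]) (g₂ : GL (Fin 2) 𝒪[K]), ActsTo σ g₁ g₂ x y}

/-- The polynomial `F_x(z, 1) = a₀(x) z ^ 2 + a₁(x) z + a₂(x)`, where
`F_x(v) = - det (v₁ x₁ + v₂ x₂)`. -/
def formPoly (σ : L ≃ₐ[K] L) (x : HermPair K L) : K[X] :=
  C (Algebra.norm K (x 0).2.1 - (x 0).1 * (x 0).2.2) * X ^ 2 +
    C (Algebra.trace K L ((x 0).2.1 * σ (x 1).2.1) - (x 0).1 * (x 1).2.2 - (x 0).2.2 * (x 1).1) *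
      X +
    C (Algebra.norm K (x 1).2.1 - (x 1).1 * (x 1).2.2)

/-- The field `K(x)` attached to `x`: the splitting field of `F_x`. -/
abbrev fieldOf (σ : L ≃ₐ[K] L) (x : HermPair K L) : Type u := (formPoly σ x).SplittingField

variable (L)

/-- The standard representative
`w_p = (((0, 1), (1, a₁)), ((1, a₁), (a₁, a₁ ^ 2 - a₂)))`. -/
def stdRep (p : Eisenstein K) : HermPair K L :=
  ![(0, 1, (p.a₁ : K)), (1, algebraMap K L p.a₁, (p.a₁ : K) ^ 2 - (p.a₂ : K))]

variable {L} (K)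

/-- The point `w_η = (((0, 1), (1, 0)), ((1, -η₂), (-η₁, 0)))`, recorded by the entry `η₂`. -/
def wEta (η₂ : L) : HermPair K L := ![(0, 1, 0), (1, -η₂, 0)]

/-! ### Groups of quadratic extensions -/

/-- `𝔛_{ℓ₁}`: quadratic extensions generated by the roots of an Eisenstein polynomial `p` with
`ℓ(p) = ℓ₁`. -/
def InX (ℓ₁ : ℕ) (F : Type u) [Field F] [Algebra K F] : Prop :=
  ∃ p : Eisenstein K, p.Generates F ∧ p.ell = ℓ₁

variable (L)

/-- `𝔛_ℓ(i)`: quadratic extensions generated by the roots of an Eisenstein polynomial `p` with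
`ℓ(p) = ℓ`, having level `i` with respect to `L`. -/
def InXLevel (ℓ i : ℕ) (F : Type u) [Field F] [Algebra K F] : Prop :=
  InX K ℓ F ∧ HasLevel K L F i

/-- Type (rm rm ur): `F / K` is a ramified quadratic extension (generated by the roots of an
Eisenstein polynomial), `F` is not `L`, and the compositum of `F` and `L` is unramified
over `L`. -/
def IsRmRmUr (F : Type u) [Field F] [Algebra K F] : Prop :=
  IsEmpty (F ≃ₐ[K] L) ∧ ∃ p : Eisenstein K, p.Generates F ∧
    Algebra.FormallyUnramified 𝒪[L]
      (integralClosure 𝒪[L] (p.poly.map (algebraMap K L)).SplittingField)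

variable {K L}

/-- The fields `K(w_{p j})` form a complete set of representatives for the isomorphism classes of
the extensions of `K` with the property `P`. -/
def IsRepSystem (σ : L ≃ₐ[K] L) (P : ∀ (F : Type u) [Field F] [Algebra K F], Prop) {N : ℕ}
    (p : Fin N → Eisenstein K) : Prop :=
  (∀ j, P (fieldOf σ (stdRep L (p j)))) ∧
    ∀ (F : Type u) [Field F] [Algebra K F], P F →
      ∃! j, Nonempty (fieldOf σ (stdRep L (p j)) ≃ₐ[K] F)

end Pair

end

end DyadicPair

open DyadicPair

/-!
The orbit of `w_p` depends only on the quadratic extension generated by the roots of `p`, that is, on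
the square class of the discriminant of `p` (`orbit_stdRep_eq`), and the orbit of `w_η` is that of
`w_e` (`orbit_wEta`). So each of the five sums is the volume of the union of the orbits of all `w_p`
for which `p` generates an extension in a given family.

**Reduction to a neighbourhood of one residue class.** Let `baseSet` be the set of integral pairs
congruent to `(((0, 1), (1, 0)), ((1, 0), (0, 0)))` modulo the maximal ideals. It contains every
`w_p`. The orbit of a point of `baseSet` is the disjoint union of translates, by measure-preserving
maps, of its part in `baseSet`. They are indexed by an orbit over the residue field, which has
`(q + 1) (q² - 1) (q² - q)` elements (`vol_orbit`). A point `x` of `baseSet` lies in the orbit of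
`w_p` if and only if `F_x` is an Eisenstein form whose discriminant has the square class of that of
`p` (`mem_orbit_stdRep_iff`, by way of `exists_stdRep_mem_orbit`). Therefore, if a relation `G`
between the coefficients `a₁`, `a₂` singles out the Eisenstein polynomials of a family, the sum of
the volumes of its orbits is `(q + 1) (q² - 1) (q² - q)` times the volume of the set `region σ G` of
those `x` in `baseSet` for which `F_x` is an Eisenstein form with coefficients satisfying `G`
(`sum_vol_orbit`).

**Volumes of regions.** A relation is of type `CosetRel c i` if, for each `a₂` in the maximal ideal,
it restricts `a₁` to one class modulo `𝔭 ^ i`, and this class varies with `a₂` in a non-expanding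
way. In `baseSet` the entry `x₀₂` of the first form can be translated by the maximal ideal. This
changes `a₁` by a unit multiple of the translation and `a₂` by a strictly smaller amount, so by
Newton's method one class of translations modulo `𝔭 ^ i` satisfies the relation
(`vol_region_of_cosetRel`). The volume of the region is thus `q⁻⁶ (1 - q⁻¹) q^(1 - i)`: the factors
come from `baseSet`, from `a₂` being a uniformizer and from the relation. The corresponding orbits
have total volume `q⁻ⁱ (1 - q⁻¹) (1 - q⁻²)²` (`sum_vol_orbit_cosetRel`).

**The families.** Two relations are of this type: `A_n`, that `a₁` lies in `𝔭 ^ n` (`cosetRel_le`),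
and `Lev_i`, that the level is at least `i`, for `i ≤ δ` (`cosetRel_level`). For the latter, every
element of the maximal ideal is a norm from `L` modulo `𝔭 ^ i` (`exists_norm_sub_le`), and two
elements with congruent norms have congruent traces. With `ℓ = ℓ(e)`, the families are

* `A_{ℓ₁}` without `A_{ℓ₁ + 1}`, for `ℓ₁ ≤ m`,
* `A_{m + 1}`, for `ℓ₁ = m + 1`,
* `A_ℓ` without the disjoint relations `A_{ℓ + 1}` and `Lev_{ℓ + 1}`, for level `ℓ ≤ m`,
* `Lev_i` without `Lev_{i + 1}`, for level `i < δ` above `ℓ`, or equal to it if `ℓ = m + 1`,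
* `Lev_δ`, for the type (rm rm ur) together with `L` itself.

In the last case, if the level of `F` is less than `δ`, then `F · L / L` is generated by the root of
an Eisenstein polynomial, hence ramified (`levelRel_of_formallyUnramified`). Conversely, if the level
is at least `δ`, then the discriminants of `F` and `L` differ by a factor `1 - 4 b` with `b` integral.
The classes of such elements modulo squares form a group of order two, by Artin–Schreier theory over
the residue field and Hensel's lemma, so `F` is determined if it is not `L`
(`sqClassEq_of_levelRel`).
-/

/-! ### Uniformizers and valuations of a local field -/

section LocalField

set_option linter.unusedSectionVars false

variable {E : Type*} [Field E] [ValuativeRel E] [TopologicalSpace E]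
  [IsNonarchimedeanLocalField E]

/-- `c` is a uniformizer: its valuation is the largest one below `1`. -/
structure IsUnif (c : E) : Prop where
  ne_zero : c ≠ 0
  lt_one : valuation E c < 1
  le_of_lt_one : ∀ x : E, valuation E x < 1 → valuation E x ≤ valuation E c

theorem mem_maximal_iff (x : 𝒪[E]) : x ∈ 𝓂[E] ↔ valuation E (x : E) < 1 := by
  rw [IsLocalRing.mem_maximalIdeal, mem_nonunits_iff,
    (Valuation.integer.integers (valuation E)).isUnit_iff_valuation_eq_one]
  exact ⟨fun h => lt_of_le_of_ne x.2 h, fun h => ne_of_lt h⟩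

theorem IsUnif.val_pos {c : E} (hc : IsUnif c) : 0 < valuation E c := by
  simpa [zero_lt_iff] using hc.ne_zero

theorem IsUnif.val_pow_pos {c : E} (hc : IsUnif c) (n : ℕ) : 0 < valuation E c ^ n :=
  pow_pos hc.val_pos n

theorem IsUnif.mem_maximal_pow {c : E} (hc : IsUnif c) (n : ℕ) (x : 𝒪[E]) :
    x ∈ 𝓂[E] ^ n ↔ valuation E (x : E) ≤ valuation E c ^ n := by
  have hm : 𝓂[E] = Ideal.span {(⟨c, hc.lt_one.le⟩ : 𝒪[E])} := by
    ext y
    rw [mem_maximal_iff, Ideal.mem_span_singleton,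
      ← (Valuation.integer.integers (valuation E)).le_iff_dvd]
    exact ⟨hc.le_of_lt_one _, fun h => lt_of_le_of_lt h hc.lt_one⟩
  rw [hm, Ideal.span_singleton_pow, Ideal.mem_span_singleton,
    ← (Valuation.integer.integers (valuation E)).le_iff_dvd, map_pow, map_pow]
  rfl

theorem isUnif_of_mem {c : 𝒪[E]} (h1 : c ∈ 𝓂[E]) (h2 : c ∉ 𝓂[E] ^ 2) : IsUnif (c : E) := by
  obtain ⟨ϖ, hϖ⟩ := IsDiscreteValuationRing.exists_irreducible 𝒪[E]
  have hm := hϖ.maximalIdeal_eq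
  rw [hm, Ideal.mem_span_singleton] at h1
  rw [hm, Ideal.span_singleton_pow, Ideal.mem_span_singleton] at h2
  obtain ⟨u, rfl⟩ := h1
  have hu : IsUnit u := by
    by_contra hu
    have : u ∈ 𝓂[E] := hu
    rw [hm, Ideal.mem_span_singleton] at this
    exact h2 (by rw [pow_two]; exact mul_dvd_mul_left _ this)
  have hvu : valuation E (u : E) = 1 :=
    (Valuation.integer.integers (valuation E)).isUnit_iff_valuation_eq_one.mp hu
  have hv : valuation E ((ϖ * u : 𝒪[E]) : E) = valuation E (ϖ : E) := by simp [hvu]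
  refine ⟨?_, ?_, ?_⟩
  · have := mul_ne_zero hϖ.ne_zero hu.ne_zero
    exact fun h => this (Subtype.ext h)
  · rw [hv]
    exact (mem_maximal_iff ϖ).1 hϖ.not_isUnit
  · intro x hx
    have : (⟨x, hx.le⟩ : 𝒪[E]) ∈ 𝓂[E] := (mem_maximal_iff _).2 hx
    rw [hm, Ideal.mem_span_singleton,
      ← (Valuation.integer.integers (valuation E)).le_iff_dvd] at this
    rw [hv]
    exact this

theorem IsUnif.val_pow_lt_iff {c : E} (hc : IsUnif c) {m n : ℕ} :
    valuation E c ^ m < valuation E c ^ n ↔ n < m :=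
  pow_lt_pow_iff_right_of_lt_one₀ hc.val_pos hc.lt_one

theorem IsUnif.val_pow_le_iff {c : E} (hc : IsUnif c) {m n : ℕ} :
    valuation E c ^ m ≤ valuation E c ^ n ↔ n ≤ m :=
  pow_le_pow_iff_right_of_lt_one₀ hc.val_pos hc.lt_one

theorem IsUnif.exists_eq_pow {c : E} (hc : IsUnif c) {x : E} (hx : x ≠ 0)
    (h1 : valuation E x ≤ 1) : ∃ n : ℕ, valuation E x = valuation E c ^ n := by
  have hirr : Irreducible (⟨c, hc.lt_one.le⟩ : 𝒪[E]) := by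
    rw [IsDiscreteValuationRing.irreducible_iff_uniformizer]
    ext y
    have := hc.mem_maximal_pow 1 y
    rw [pow_one] at this
    rw [this, Ideal.mem_span_singleton,
      ← (Valuation.integer.integers (valuation E)).le_iff_dvd, pow_one]
    rfl
  obtain ⟨n, hn⟩ := IsDiscreteValuationRing.associated_pow_irreducible
    (x := (⟨x, h1⟩ : 𝒪[E])) (fun h => hx (congrArg Subtype.val h)) hirr
  refine ⟨n, ?_⟩
  obtain ⟨u, hu⟩ := hn
  have hvu : valuation E ((u : 𝒪[E]) : E) = 1 :=
    (Valuation.integer.integers (valuation E)).isUnit_iff_valuation_eq_one.mp u.isUnit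
  have := congrArg (fun z : 𝒪[E] => valuation E (z : E)) hu
  simpa [hvu] using this

/-- Valuations being discrete, `v x ^ 2 ≤ v c ^ (2 j - 1)` already gives `v x ≤ v c ^ j`. -/
theorem IsUnif.le_pow_of_sq_mul_le {c : E} (hc : IsUnif c) {x : E} {j : ℕ}
    (h : valuation E x ^ 2 * valuation E c ≤ valuation E c ^ (2 * j)) :
    valuation E x ≤ valuation E c ^ j := by
  by_contra hx
  push Not at hx
  have hx0 : 0 < valuation E x := lt_of_le_of_lt zero_le hx
  have h1 : valuation E (c ^ j / x) < 1 := by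
    rw [map_div₀, map_pow]
    exact (div_lt_one₀ hx0).2 hx
  have h2 := hc.le_of_lt_one _ h1
  rw [map_div₀, map_pow, div_le_iff₀ hx0] at h2
  have h3 : valuation E c ^ (2 * j) ≤ (valuation E c * valuation E x) ^ 2 := by
    rw [mul_comm 2 j, pow_mul]
    exact pow_le_pow_left₀ zero_le h2 2
  have h4 : (valuation E c * valuation E x) ^ 2 < valuation E x ^ 2 * valuation E c := by
    have : (valuation E c * valuation E x) ^ 2
        = (valuation E x ^ 2 * valuation E c) * valuation E c := by simp only [pow_two]; ac_rfl
    rw [this]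
    exact mul_lt_of_lt_one_right (mul_pos (pow_pos hx0 2) hc.val_pos) hc.lt_one
  exact absurd (h3.trans_lt h4) (not_lt.2 h)

/-- The valuation of the norm form of an Eisenstein polynomial: the terms `s ^ 2` and `C t ^ 2`
have valuations of different parity, so no cancellation takes place. -/
theorem IsUnif.valuation_form {A C : E} (hC : IsUnif C) (hA : valuation E A ≤ valuation E C)
    (s t : E) :
    valuation E (s ^ 2 + A * s * t + C * t ^ 2) =
      max (valuation E s ^ 2) (valuation E C * valuation E t ^ 2) := by
  rcases le_or_gt (valuation E t) (valuation E s) with h | h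
  · rcases eq_or_ne s 0 with rfl | hs
    · have ht : t = 0 := by simpa using h
      simp [ht]
    have hs0 : 0 < valuation E s := by simpa [zero_lt_iff] using hs
    have h1 : valuation E (C * t ^ 2) < valuation E (s ^ 2) := by
      rw [map_mul, map_pow, map_pow]
      calc valuation E C * valuation E t ^ 2 ≤ valuation E C * valuation E s ^ 2 := by gcongr
        _ < valuation E s ^ 2 := mul_lt_of_lt_one_left (pow_pos hs0 2) hC.lt_one
    have h2 : valuation E (A * s * t) < valuation E (s ^ 2) := by
      rw [map_mul, map_mul, map_pow]
      calc valuation E A * valuation E s * valuation E t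
          ≤ valuation E C * valuation E s * valuation E s := by gcongr
        _ = valuation E C * valuation E s ^ 2 := by simp only [pow_two]; ac_rfl
        _ < valuation E s ^ 2 := mul_lt_of_lt_one_left (pow_pos hs0 2) hC.lt_one
    rw [Valuation.map_add_eq_of_lt_left, Valuation.map_add_eq_of_lt_left _ h2, map_pow,
      max_eq_left]
    · simpa using h1.le
    · rwa [Valuation.map_add_eq_of_lt_left _ h2]
  · have ht0 : 0 < valuation E t := lt_of_le_of_lt zero_le h
    have hts : valuation E s ≤ valuation E C * valuation E t := by
      have h1 : valuation E (s / t) < 1 := by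
        rw [map_div₀]; exact (div_lt_one₀ ht0).2 h
      have h2 := hC.le_of_lt_one _ h1
      rwa [map_div₀, div_le_iff₀ ht0] at h2
    have hpos : 0 < valuation E C * valuation E t ^ 2 := mul_pos hC.val_pos (pow_pos ht0 2)
    have key : valuation E C * (valuation E C * valuation E t ^ 2)
        < valuation E C * valuation E t ^ 2 := mul_lt_of_lt_one_left hpos hC.lt_one
    have h1 : valuation E (s ^ 2) < valuation E (C * t ^ 2) := by
      rw [map_mul, map_pow, map_pow]
      calc valuation E s ^ 2 ≤ (valuation E C * valuation E t) ^ 2 := by gcongr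
        _ = valuation E C * (valuation E C * valuation E t ^ 2) := by simp only [pow_two]; ac_rfl
        _ < _ := key
    have h2 : valuation E (A * s * t) < valuation E (C * t ^ 2) := by
      rw [map_mul, map_mul, map_mul, map_pow]
      calc valuation E A * valuation E s * valuation E t
          ≤ valuation E C * (valuation E C * valuation E t) * valuation E t := by gcongr
        _ = valuation E C * (valuation E C * valuation E t ^ 2) := by simp only [pow_two]; ac_rfl
        _ < _ := key
    rw [Valuation.map_add_eq_of_lt_right, map_mul, map_pow, max_eq_right]
    · simpa using h1.le
    · exact Valuation.map_add_lt _ h1 h2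

theorem IsUnif.form_ne_zero {A C : E} (hC : IsUnif C) (hA : valuation E A ≤ valuation E C)
    (z : E) : z ^ 2 + A * z + C ≠ 0 := by
  intro h
  have := hC.valuation_form hA z 1
  simp only [mul_one, one_pow, h, map_zero, map_one] at this
  have h2 : valuation E C ≤ 0 := this ▸ le_max_right _ _
  exact absurd h2 (not_le.2 hC.val_pos)

theorem val_add_le {x y : E} {g : ValueGroupWithZero E} (hx : valuation E x ≤ g)
    (hy : valuation E y ≤ g) : valuation E (x + y) ≤ g := Valuation.map_add_le _ hx hy

theorem val_sub_le {x y : E} {g : ValueGroupWithZero E} (hx : valuation E x ≤ g)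
    (hy : valuation E y ≤ g) : valuation E (x - y) ≤ g :=
  (Valuation.map_sub _ _ _).trans (max_le hx hy)

theorem val_mul_le {x y : E} {g h : ValueGroupWithZero E} (hx : valuation E x ≤ g)
    (hy : valuation E y ≤ h) : valuation E (x * y) ≤ g * h := by
  rw [map_mul]; gcongr

/-- Hensel's lemma for `y ^ 2 + y + c`. -/
theorem exists_artinSchreier_root {c : 𝒪[E]} [CharP 𝓀[E] 2]
    (h : ∃ y : 𝒪[E], y ^ 2 + y + c ∈ 𝓂[E]) : ∃ y : 𝒪[E], y ^ 2 + y + c = 0 := by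
  let := IsTopologicalAddGroup.rightUniformSpace E
  have := isUniformAddGroup_of_addCommGroup (G := E)
  obtain ⟨y, hy⟩ := h
  have hmonic : (X ^ 2 + X + C c : 𝒪[E][X]).Monic := by monicity!
  obtain ⟨a, ha, -⟩ := HenselianRing.is_henselian (I := 𝓂[E]) (X ^ 2 + X + C c : 𝒪[E][X])
    hmonic y (by simpa using hy) (by
      have h2 : (Ideal.Quotient.mk 𝓂[E]) (2 : 𝒪[E]) = 0 := by
        have : (2 : 𝓀[E]) = 0 := CharTwo.two_eq_zero
        exact (map_ofNat _ 2).trans this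
      have : (Ideal.Quotient.mk 𝓂[E]) (eval y (derivative (X ^ 2 + X + C c : 𝒪[E][X]))) = 1 := by
        have h3 : (1 + 1 : 𝒪[E] ⧸ 𝓂[E]) = 0 := by
          rw [one_add_one_eq_two, ← h2, map_ofNat]
        simp [h3]
      rw [this]
      exact isUnit_one)
  exact ⟨a, by simpa [IsRoot] using ha⟩

theorem val_two_lt_one [CharP 𝓀[E] 2] : valuation E (2 : E) < 1 := by
  have h : IsLocalRing.residue 𝒪[E] 2 = 0 := by
    rw [map_ofNat]
    exact CharTwo.two_eq_zero
  rw [IsLocalRing.residue_eq_zero_iff, mem_maximal_iff] at h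
  exact h

end LocalField

/-! ### The ramified quadratic extension in coordinates -/

section Extension

set_option linter.unusedSectionVars false

variable {K : Type*} [Field K] [ValuativeRel K] [TopologicalSpace K] [IsNonarchimedeanLocalField K]
variable {L : Type*} [Field L] [ValuativeRel L] [TopologicalSpace L]
  [IsNonarchimedeanLocalField L] [Algebra K L]

theorem DyadicPair.Eisenstein.isUnif (p : Eisenstein K) : IsUnif (p.a₂ : K) :=
  isUnif_of_mem p.a₂_mem p.a₂_not_mem

theorem DyadicPair.Eisenstein.val_a₁ (p : Eisenstein K) {c : K} (hc : IsUnif c) :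
    valuation K (p.a₁ : K) ≤ valuation K c :=
  hc.le_of_lt_one _ ((mem_maximal_iff _).1 p.a₁_mem)

theorem IsUnif.val_eq {c d : K} (hc : IsUnif c) (hd : IsUnif d) : valuation K c = valuation K d :=
  le_antisymm (hd.le_of_lt_one _ hc.lt_one) (hc.le_of_lt_one _ hd.lt_one)

theorem IsUnif.of_val_eq {c d : K} (hc : IsUnif c) (h : valuation K d = valuation K c) :
    IsUnif d where
  ne_zero := by
    rintro rfl
    rw [map_zero] at h
    exact hc.val_pos.ne h
  lt_one := h ▸ hc.lt_one
  le_of_lt_one := h ▸ hc.le_of_lt_one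

/-- The extension `L / K` is `K ⊕ K η`, for a root `η` of the Eisenstein polynomial `e`, and `σ` is
the conjugation of `L / K`. -/
structure RamData (σ : L ≃ₐ[K] L) (e : Eisenstein K) (η : L) : Prop where
  root : η ^ 2 + algebraMap K L e.a₁ * η + algebraMap K L e.a₂ = 0
  conj : σ η = -algebraMap K L e.a₁ - η
  span : ∀ w : L, ∃ s t : K, w = algebraMap K L s + algebraMap K L t * η
  norm : ∀ w : L, algebraMap K L (Algebra.norm K w) = w * σ w
  trace : ∀ w : L, algebraMap K L (Algebra.trace K L w) = w + σ w

theorem ramData_of_roots [CharZero K] (hquad : Module.finrank K L = 2)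
    {σ : L ≃ₐ[K] L} (hσ : σ ≠ AlgEquiv.refl) (e : Eisenstein K) {η₁ η₂ : L}
    (he : e.poly.map (algebraMap K L) = (X - C η₁) * (X - C η₂)) :
    RamData σ e η₁ ∧ η₁ + η₂ = -algebraMap K L e.a₁ ∧ η₁ * η₂ = algebraMap K L e.a₂ := by
  have : FiniteDimensional K L := Module.finite_of_finrank_pos (by omega)
  have : Algebra.IsQuadraticExtension K L := ⟨hquad⟩
  have : IsGalois K L := ⟨⟩
  have he' : ∀ z : L, z ^ 2 + algebraMap K L e.a₁ * z + algebraMap K L e.a₂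
      = (z - η₁) * (z - η₂) := by
    intro z
    have := congrArg (eval z) he
    simpa [Eisenstein.poly] using this
  have hprod : η₁ * η₂ = algebraMap K L e.a₂ := by
    have := he' 0
    simpa using this.symm
  have hsum : η₁ + η₂ = -algebraMap K L e.a₁ := by
    have := he' 1
    linear_combination hprod + this
  have hroot : η₁ ^ 2 + algebraMap K L e.a₁ * η₁ + algebraMap K L e.a₂ = 0 := by
    rw [he']; ring
  have hnot : ∀ z : K, algebraMap K L z ≠ η₁ := by
    rintro z rfl
    apply e.isUnif.form_ne_zero (e.val_a₁ e.isUnif) z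
    apply (algebraMap K L).injective
    simpa using hroot
  have hspan : ∀ w : L, ∃ s t : K, w = algebraMap K L s + algebraMap K L t * η₁ := by
    have hli : LinearIndependent K ![(1 : L), η₁] := by
      rw [LinearIndependent.pair_iff]
      intro s t hst
      rw [Algebra.smul_def, Algebra.smul_def, mul_one] at hst
      have ht : t = 0 := by
        by_contra ht
        apply hnot (-s / t)
        rw [map_div₀, map_neg, div_eq_iff (by simpa using ht)]
        linear_combination -hst
      subst ht
      simpa using hst
    have htop := hli.span_eq_top_of_card_eq_finrank (by simp [hquad])
    intro w
    have hw : w ∈ Submodule.span K (Set.range ![(1 : L), η₁]) := htop ▸ Submodule.mem_top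
    rw [Matrix.range_cons, Matrix.range_cons, Matrix.range_empty, Set.union_empty,
      Set.singleton_union, Submodule.mem_span_pair] at hw
    obtain ⟨s, t, h⟩ := hw
    exact ⟨s, t, by rw [← h, Algebra.smul_def, Algebra.smul_def, mul_one]⟩
  have hconj : σ η₁ = η₂ := by
    have h1 : (σ η₁ - η₁) * (σ η₁ - η₂) = 0 := by
      rw [← he', ← map_zero σ, ← hroot]
      simp
    rcases mul_eq_zero.1 h1 with h | h
    · exfalso
      apply hσ
      ext w
      obtain ⟨s, t, rfl⟩ := hspan w
      simp [sub_eq_zero.1 h]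
    · exact sub_eq_zero.1 h
  have hcard : Fintype.card (L ≃ₐ[K] L) = 2 := by
    rw [← hquad, ← IsGalois.card_aut_eq_finrank, Nat.card_eq_fintype_card]
  classical
  have huniv : (Finset.univ : Finset (L ≃ₐ[K] L)) = {AlgEquiv.refl, σ} := by
    symm
    apply Finset.eq_univ_of_card
    rw [hcard, Finset.card_pair hσ.symm]
  refine ⟨⟨hroot, ?_, hspan, ?_, ?_⟩, hsum, hprod⟩
  · rw [hconj]; linear_combination hsum
  · intro w
    rw [Algebra.norm_eq_prod_automorphisms, huniv, Finset.prod_pair hσ.symm]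
    rfl
  · intro w
    rw [trace_eq_sum_automorphisms, huniv, Finset.sum_pair hσ.symm]
    rfl

section ValExt

variable [ValuativeExtension K L]

theorem vL_le_iff (x y : K) : valuation L (algebraMap K L x) ≤ valuation L (algebraMap K L y) ↔
    valuation K x ≤ valuation K y := by
  rw [← Valuation.Compatible.vle_iff_le (v := valuation L),
    ← Valuation.Compatible.vle_iff_le (v := valuation K), ValuativeExtension.vle_iff_vle]

theorem vL_lt_iff (x y : K) : valuation L (algebraMap K L x) < valuation L (algebraMap K L y) ↔
    valuation K x < valuation K y := by
  rw [← not_le, vL_le_iff, not_le]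

theorem vL_eq_iff (x y : K) : valuation L (algebraMap K L x) = valuation L (algebraMap K L y) ↔
    valuation K x = valuation K y := by
  simp only [le_antisymm_iff, vL_le_iff]

theorem vL_le_one_iff (x : K) : valuation L (algebraMap K L x) ≤ 1 ↔ valuation K x ≤ 1 := by
  simpa using vL_le_iff (L := L) x 1

theorem vL_lt_one_iff (x : K) : valuation L (algebraMap K L x) < 1 ↔ valuation K x < 1 := by
  simpa using vL_lt_iff (L := L) x 1

theorem vL_le_pow_iff (x c : K) (n : ℕ) :
    valuation L (algebraMap K L x) ≤ valuation L (algebraMap K L c) ^ n ↔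
    valuation K x ≤ valuation K c ^ n := by
  rw [← map_pow, ← map_pow, ← map_pow, vL_le_iff]

end ValExt

namespace RamData

variable {σ : L ≃ₐ[K] L} {e : Eisenstein K} {η : L}

theorem norm_mk (h : RamData σ e η) (s t : K) :
    Algebra.norm K (algebraMap K L s + algebraMap K L t * η)
      = s ^ 2 + (-e.a₁) * s * t + e.a₂ * t ^ 2 := by
  apply (algebraMap K L).injective
  rw [h.norm]
  simp only [map_add, map_mul, map_pow, map_neg, AlgEquiv.commutes, h.conj]
  linear_combination (-(algebraMap K L t) ^ 2) * h.root

theorem trace_mk (h : RamData σ e η) (s t : K) :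
    Algebra.trace K L (algebraMap K L s + algebraMap K L t * η) = 2 * s - e.a₁ * t := by
  apply (algebraMap K L).injective
  rw [h.trace]
  simp only [map_add, map_mul, map_sub, map_ofNat, AlgEquiv.commutes, h.conj]
  ring

theorem conj_conj (h : RamData σ e η) (w : L) : σ (σ w) = w := by
  obtain ⟨s, t, rfl⟩ := h.span w
  simp [h.conj]

theorem norm_conj (h : RamData σ e η) (w : L) : Algebra.norm K (σ w) = Algebra.norm K w := by
  apply (algebraMap K L).injective
  rw [h.norm, h.norm, h.conj_conj, mul_comm]

theorem trace_conj (h : RamData σ e η) (w : L) :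
    Algebra.trace K L (σ w) = Algebra.trace K L w := by
  apply (algebraMap K L).injective
  rw [h.trace, h.trace, h.conj_conj, add_comm]

theorem norm_algebraMap (h : RamData σ e η) (s : K) :
    Algebra.norm K (algebraMap K L s) = s ^ 2 := by
  simpa using h.norm_mk s 0

theorem norm_neg (h : RamData σ e η) (w : L) : Algebra.norm K (-w) = Algebra.norm K w := by
  apply (algebraMap K L).injective
  rw [h.norm, h.norm, map_neg, neg_mul_neg]

theorem norm_add (h : RamData σ e η) (w z : L) : Algebra.norm K (w + z) =
    Algebra.norm K w + Algebra.trace K L (w * σ z) + Algebra.norm K z := by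
  apply (algebraMap K L).injective
  simp only [map_add, h.norm, h.trace, map_mul, h.conj_conj]
  ring

theorem valK_norm_mk (h : RamData σ e η) (s t : K) :
    valuation K (Algebra.norm K (algebraMap K L s + algebraMap K L t * η)) =
      max (valuation K s ^ 2) (valuation K (e.a₂ : K) * valuation K t ^ 2) := by
  rw [h.norm_mk, e.isUnif.valuation_form]
  rw [Valuation.map_neg]
  exact e.val_a₁ e.isUnif

variable [ValuativeExtension K L]

theorem val_eta_sq (h : RamData σ e η) :
    valuation L η ^ 2 = valuation L (algebraMap K L e.a₂) := by
  have hc1 : valuation L (algebraMap K L e.a₂) < 1 := (vL_lt_one_iff _).2 e.isUnif.lt_one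
  have hc0 : 0 < valuation L (algebraMap K L e.a₂) := by
    simpa [zero_lt_iff] using e.isUnif.ne_zero
  have ha : valuation L (algebraMap K L e.a₁) ≤ valuation L (algebraMap K L e.a₂) :=
    (vL_le_iff _ _).2 (e.val_a₁ e.isUnif)
  have hsq : η ^ 2 = -(algebraMap K L e.a₁ * η + algebraMap K L e.a₂) := by
    linear_combination h.root
  have hv : valuation L η ^ 2 = valuation L (algebraMap K L e.a₁ * η + algebraMap K L e.a₂) := by
    rw [← map_pow, hsq, Valuation.map_neg]
  have hlt : valuation L η < 1 := by
    by_contra hge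
    push Not at hge
    have h1 : valuation L (algebraMap K L e.a₁ * η + algebraMap K L e.a₂) < valuation L η := by
      apply Valuation.map_add_lt
      · rw [map_mul]
        exact mul_lt_of_lt_one_left (zero_lt_one.trans_le hge) (ha.trans_lt hc1)
      · exact hc1.trans_le hge
    rw [← hv] at h1
    have h2 : valuation L η * 1 ≤ valuation L η * valuation L η := by gcongr
    rw [mul_one, ← pow_two] at h2
    exact absurd h1 (not_lt.2 h2)
  rw [hv]
  apply Valuation.map_add_eq_of_lt_right
  rw [map_mul]
  calc valuation L (algebraMap K L e.a₁) * valuation L η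
      ≤ valuation L (algebraMap K L e.a₂) * valuation L η := by gcongr
    _ < _ := mul_lt_of_lt_one_right hc0 hlt

/-- The valuation of `L` is determined by that of `K` through the norm. -/
theorem val_sq (h : RamData σ e η) (w : L) :
    valuation L w ^ 2 = valuation L (algebraMap K L (Algebra.norm K w)) := by
  obtain ⟨s, t, rfl⟩ := h.span w
  have hN := h.valK_norm_mk s t
  have hη2 := h.val_eta_sq
  have htη : valuation L (algebraMap K L t * η) ^ 2
      = valuation L (algebraMap K L (e.a₂ * t ^ 2)) := by
    rw [map_mul, mul_pow, hη2, map_mul, map_mul, map_pow, map_pow, mul_comm]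
  have hs : valuation L (algebraMap K L s) ^ 2 = valuation L (algebraMap K L (s ^ 2)) := by
    rw [map_pow, map_pow]
  have hct : valuation K (e.a₂ : K) * valuation K t ^ 2 = valuation K (e.a₂ * t ^ 2 : K) := by simp
  have hss : valuation K s ^ 2 = valuation K (s ^ 2 : K) := by simp
  rcases lt_trichotomy (valuation K (s ^ 2 : K)) (valuation K (e.a₂ * t ^ 2 : K)) with
    hlt | heq | hlt
  · rw [hct, hss, max_eq_right hlt.le] at hN
    rw [Valuation.map_add_eq_of_lt_right, htη, vL_eq_iff, hN]
    rw [← pow_lt_pow_iff_left₀ zero_le zero_le two_ne_zero, hs, htη, vL_lt_iff]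
    exact hlt
  · by_cases ht : t = 0
    · subst ht
      have : s = 0 := by simpa using heq
      subst this
      simp [h.norm]
    exfalso
    have h1 : valuation K (s / t) ^ 2 = valuation K (e.a₂ : K) := by
      rw [← map_pow, div_pow, map_div₀, heq, map_mul, mul_div_assoc, div_self (by simpa using ht),
        mul_one]
    have hlt : valuation K (s / t) < 1 := by
      rw [← pow_lt_pow_iff_left₀ zero_le zero_le two_ne_zero, h1, one_pow]
      exact e.isUnif.lt_one
    have hle := e.isUnif.le_of_lt_one _ hlt
    have : valuation K (s / t) ^ 2 ≤ valuation K (e.a₂ : K) ^ 2 := pow_le_pow_left₀ zero_le hle 2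
    rw [h1] at this
    have h3 := (e.isUnif.val_pow_le_iff (m := 1) (n := 2)).1 (by simpa using this)
    omega
  · rw [hct, hss, max_eq_left hlt.le] at hN
    rw [Valuation.map_add_eq_of_lt_left, hs, vL_eq_iff, hN]
    rw [← pow_lt_pow_iff_left₀ zero_le zero_le two_ne_zero, hs, htη, vL_lt_iff]
    exact hlt

theorem val_conj (h : RamData σ e η) (w : L) : valuation L (σ w) = valuation L w := by
  rw [← pow_left_inj₀ zero_le zero_le two_ne_zero, h.val_sq, h.val_sq, h.norm_conj]

theorem le_one_iff_norm (h : RamData σ e η) (w : L) :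
    valuation L w ≤ 1 ↔ valuation K (Algebra.norm K w) ≤ 1 := by
  rw [← pow_le_pow_iff_left₀ zero_le zero_le two_ne_zero, h.val_sq, one_pow, vL_le_one_iff]

theorem lt_one_iff_norm (h : RamData σ e η) (w : L) :
    valuation L w < 1 ↔ valuation K (Algebra.norm K w) < 1 := by
  rw [← pow_lt_pow_iff_left₀ zero_le zero_le two_ne_zero, h.val_sq, one_pow, vL_lt_one_iff]

theorem le_one_iff_mk (h : RamData σ e η) (s t : K) :
    valuation L (algebraMap K L s + algebraMap K L t * η) ≤ 1 ↔
      valuation K s ≤ 1 ∧ valuation K t ≤ 1 := by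
  rw [h.le_one_iff_norm, h.valK_norm_mk, max_le_iff, pow_le_one_iff_of_nonneg zero_le two_ne_zero]
  refine and_congr_right fun _ => ⟨fun ht => ?_, fun ht => ?_⟩
  · have := e.isUnif.le_pow_of_sq_mul_le (x := t) (j := 0) (by rwa [mul_comm, mul_zero, pow_zero])
    simpa using this
  · exact mul_le_one' e.isUnif.lt_one.le (pow_le_one' ht 2)

theorem lt_one_iff_mk (h : RamData σ e η) (s t : K) :
    valuation L (algebraMap K L s + algebraMap K L t * η) < 1 ↔
      valuation K s < 1 ∧ valuation K t ≤ 1 := by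
  rw [h.lt_one_iff_norm, h.valK_norm_mk, max_lt_iff, pow_lt_one_iff_of_nonneg zero_le two_ne_zero]
  refine and_congr_right fun _ => ⟨fun ht => ?_, fun ht => ?_⟩
  · have := e.isUnif.le_pow_of_sq_mul_le (x := t) (j := 0)
      (by rw [mul_comm, mul_zero, pow_zero]; exact ht.le)
    simpa using this
  · exact mul_lt_one_of_lt_of_le e.isUnif.lt_one (pow_le_one' ht 2)

theorem isUnif_eta (h : RamData σ e η) : IsUnif η := by
  have hsq := h.val_eta_sq
  have hlt : valuation L η < 1 := by
    have := (h.lt_one_iff_mk 0 1).2 ⟨by simp, by simp⟩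
    simpa using this
  refine ⟨?_, hlt, ?_⟩
  · rintro rfl
    have := e.isUnif.ne_zero
    rw [map_zero, zero_pow two_ne_zero] at hsq
    exact this (by simpa using hsq.symm)
  · intro w hw
    rw [← pow_le_pow_iff_left₀ zero_le zero_le two_ne_zero, h.val_sq, hsq, vL_le_iff]
    exact e.isUnif.le_of_lt_one _ ((h.lt_one_iff_norm w).1 hw)

/-- The bound for the trace in terms of the discriminant: this is the fact that the different of
`L / K` is `𝔓 ^ δ`. -/
theorem trace_le (h : RamData σ e η) {δ : ℕ}
    (hδ : valuation K ((e.a₁ : K) ^ 2 - 4 * e.a₂) = valuation K (e.a₂ : K) ^ δ) {j : ℕ} (hj : j ≤ δ)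
    {w : L} (hw : valuation K (Algebra.norm K w) ≤ valuation K (e.a₂ : K) ^ j) :
    valuation K (Algebra.trace K L w) ≤ valuation K (e.a₂ : K) ^ j := by
  obtain ⟨s, t, rfl⟩ := h.span w
  rw [h.valK_norm_mk, max_le_iff] at hw
  have hneg : IsUnif (-(e.a₂ : K)) := e.isUnif.of_val_eq (Valuation.map_neg _ _)
  have hD := hneg.valuation_form (A := 0) (by simp) (e.a₁ : K) 2
  have hDe : (e.a₁ : K) ^ 2 + 0 * e.a₁ * 2 + -(e.a₂ : K) * 2 ^ 2 = (e.a₁ : K) ^ 2 - 4 * e.a₂ := by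
    ring
  rw [hDe, hδ, Valuation.map_neg] at hD
  have h1 : valuation K (e.a₁ : K) ^ 2 ≤ valuation K (e.a₂ : K) ^ δ := hD ▸ le_max_left _ _
  have h2 : valuation K (e.a₂ : K) * valuation K (2 : K) ^ 2 ≤ valuation K (e.a₂ : K) ^ δ :=
    hD ▸ le_max_right _ _
  have hδj : valuation K (e.a₂ : K) ^ δ ≤ valuation K (e.a₂ : K) ^ j := e.isUnif.val_pow_le_iff.2 hj
  rw [h.trace_mk]
  apply val_sub_le
  · apply e.isUnif.le_pow_of_sq_mul_le
    calc valuation K (2 * s) ^ 2 * valuation K (e.a₂ : K)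
        = (valuation K (e.a₂ : K) * valuation K (2 : K) ^ 2) * valuation K s ^ 2 := by
          simp only [map_mul, pow_two]; ac_rfl
      _ ≤ valuation K (e.a₂ : K) ^ j * valuation K (e.a₂ : K) ^ j := by
          exact mul_le_mul' (h2.trans hδj) hw.1
      _ = _ := by rw [← pow_add, two_mul]
  · apply e.isUnif.le_pow_of_sq_mul_le
    calc valuation K (e.a₁ * t : K) ^ 2 * valuation K (e.a₂ : K)
        = valuation K (e.a₁ : K) ^ 2 * (valuation K (e.a₂ : K) * valuation K t ^ 2) := by
          simp only [map_mul, pow_two]; ac_rfl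
      _ ≤ valuation K (e.a₂ : K) ^ j * valuation K (e.a₂ : K) ^ j := by
          exact mul_le_mul' (h1.trans hδj) hw.2
      _ = _ := by rw [← pow_add, two_mul]

end RamData

end Extension

/-! ### The action on pairs of Hermitian forms -/

section Action

set_option linter.unusedSectionVars false

section IntMat

variable {E : Type*} [Field E] [ValuativeRel E] [TopologicalSpace E]
  [IsNonarchimedeanLocalField E]

/-- A matrix over `E` which lies in the image of `GL₂(𝒪[E])`. -/
structure IntMat (g : Matrix (Fin 2) (Fin 2) E) : Prop where
  int : ∀ i j, valuation E (g i j) ≤ 1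
  det : valuation E g.det = 1

theorem intMat_coe (g : GL (Fin 2) 𝒪[E]) : IntMat (g.1.map (fun a => (a : E))) where
  int i j := (g.1 i j).2
  det := by
    have h : (g.1.map (fun a => (a : E))).det = ((g.1.det : 𝒪[E]) : E) := by
      simp [Matrix.det_fin_two]
    rw [h]
    exact (Valuation.integer.integers (valuation E)).isUnit_iff_valuation_eq_one.mp
      ((Matrix.isUnit_iff_isUnit_det _).1 g.isUnit)

theorem IntMat.exists_coe {g : Matrix (Fin 2) (Fin 2) E} (hg : IntMat g) :
    ∃ u : GL (Fin 2) 𝒪[E], u.1.map (fun a => (a : E)) = g := by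
  let m : Matrix (Fin 2) (Fin 2) 𝒪[E] := fun i j => ⟨g i j, hg.int i j⟩
  have hm : ((m.det : 𝒪[E]) : E) = g.det := by
    rw [Matrix.det_fin_two, Matrix.det_fin_two]
    rfl
  have hu : IsUnit m.det := by
    rw [(Valuation.integer.integers (valuation E)).isUnit_iff_valuation_eq_one]
    exact (congrArg _ hm).trans hg.det
  exact ⟨Matrix.GeneralLinearGroup.mk'' m hu, rfl⟩

theorem IntMat.mul {g h : Matrix (Fin 2) (Fin 2) E} (hg : IntMat g) (hh : IntMat h) :
    IntMat (g * h) where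
  int i j := by
    rw [Matrix.mul_apply, Fin.sum_univ_two]
    exact val_add_le ((val_mul_le (hg.int _ _) (hh.int _ _)).trans_eq (one_mul 1))
      ((val_mul_le (hg.int _ _) (hh.int _ _)).trans_eq (one_mul 1))
  det := by rw [Matrix.det_mul, map_mul, hg.det, hh.det, one_mul]

theorem IntMat.det_ne_zero {g : Matrix (Fin 2) (Fin 2) E} (hg : IntMat g) : g.det ≠ 0 := by
  intro h
  have := hg.det
  rw [h, map_zero] at this
  exact zero_ne_one this

theorem IntMat.inv {g : Matrix (Fin 2) (Fin 2) E} (hg : IntMat g) : IntMat g⁻¹ where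
  int i j := by
    rw [Matrix.inv_def, Ring.inverse_eq_inv', Matrix.smul_apply, smul_eq_mul, map_mul, map_inv₀,
      hg.det, inv_one, one_mul, Matrix.adjugate_fin_two]
    fin_cases i <;> fin_cases j <;> simp [hg.int, Valuation.map_neg]
  det := by rw [Matrix.det_nonsing_inv, Ring.inverse_eq_inv', map_inv₀, hg.det, inv_one]

theorem IntMat.mul_inv {g : Matrix (Fin 2) (Fin 2) E} (hg : IntMat g) : g * g⁻¹ = 1 :=
  Matrix.mul_nonsing_inv _ hg.det_ne_zero.isUnit

theorem IntMat.inv_mul {g : Matrix (Fin 2) (Fin 2) E} (hg : IntMat g) : g⁻¹ * g = 1 :=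
  Matrix.nonsing_inv_mul _ hg.det_ne_zero.isUnit

theorem intMat_one : IntMat (1 : Matrix (Fin 2) (Fin 2) E) where
  int i j := by
    rw [Matrix.one_apply]
    split_ifs <;> simp
  det := by simp

theorem intMat_of {a b c d : E} (ha : valuation E a ≤ 1) (hb : valuation E b ≤ 1)
    (hc : valuation E c ≤ 1) (hd : valuation E d ≤ 1) (h : valuation E (a * d - b * c) = 1) :
    IntMat !![a, b; c, d] where
  int i j := by fin_cases i <;> fin_cases j <;> simpa
  det := by rwa [Matrix.det_fin_two_of]

end IntMat

variable {K : Type*} [Field K] [ValuativeRel K] [TopologicalSpace K] [IsNonarchimedeanLocalField K]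
variable {L : Type*} [Field L] [ValuativeRel L] [TopologicalSpace L]
  [IsNonarchimedeanLocalField L] [Algebra K L]

/-- The Hermitian matrix `g y ᵗ(σ g)`, in coordinates. -/
noncomputable def hermAct (σ : L ≃ₐ[K] L) (g : Matrix (Fin 2) (Fin 2) L) (y : K × L × K) :
    K × L × K :=
  (Algebra.norm K (g 0 0) * y.1 + Algebra.trace K L (g 0 0 * σ (g 0 1) * y.2.1)
      + Algebra.norm K (g 0 1) * y.2.2,
    algebraMap K L y.1 * (g 0 0 * σ (g 1 0)) + g 0 0 * σ (g 1 1) * y.2.1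
      + g 0 1 * σ (g 1 0) * σ y.2.1 + algebraMap K L y.2.2 * (g 0 1 * σ (g 1 1)),
    Algebra.norm K (g 1 0) * y.1 + Algebra.trace K L (g 1 0 * σ (g 1 1) * y.2.1)
      + Algebra.norm K (g 1 1) * y.2.2)

/-- The action of a pair of matrices on `V`, in coordinates. -/
noncomputable def pairAct (σ : L ≃ₐ[K] L) (g : Matrix (Fin 2) (Fin 2) L)
    (k : Matrix (Fin 2) (Fin 2) K) (x : HermPair K L) : HermPair K L :=
  fun r => hermAct σ g (k r 0 • x 0 + k r 1 • x 1)

/-- The quadratic form `y ↦ - det y` on binary Hermitian matrices. -/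
noncomputable def negDet (y : K × L × K) : K := Algebra.norm K y.2.1 - y.1 * y.2.2

/-- The middle coefficient of `F_x`. -/
noncomputable def midCoeff (σ : L ≃ₐ[K] L) (x : HermPair K L) : K :=
  Algebra.trace K L ((x 0).2.1 * σ (x 1).2.1) - (x 0).1 * (x 1).2.2 - (x 0).2.2 * (x 1).1

/-- The discriminant of the binary form `F_x`. -/
noncomputable def formDisc (σ : L ≃ₐ[K] L) (x : HermPair K L) : K :=
  midCoeff σ x ^ 2 - 4 * (negDet (x 0) * negDet (x 1))

theorem hermMatrix_injective (σ : L ≃ₐ[K] L) :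
    Function.Injective (hermMatrix σ : K × L × K → Matrix (Fin 2) (Fin 2) L) := by
  rintro ⟨a, b, c⟩ ⟨a', b', c'⟩ h
  have h1 := congrFun (congrFun h 0) 0
  have h2 := congrFun (congrFun h 0) 1
  have h3 := congrFun (congrFun h 1) 1
  simp only [hermMatrix, Matrix.of_apply, Matrix.cons_val_zero, Matrix.cons_val_one,
    Matrix.cons_val', Matrix.cons_val_fin_one] at h1 h2 h3
  rw [(algebraMap K L).injective h1, h2, (algebraMap K L).injective h3]

theorem hermMatrix_add (σ : L ≃ₐ[K] L) (y z : K × L × K) :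
    hermMatrix σ (y + z) = hermMatrix σ y + hermMatrix σ z := by
  ext i j
  fin_cases i <;> fin_cases j <;> simp [hermMatrix]

theorem hermMatrix_smul (σ : L ≃ₐ[K] L) (c : K) (y : K × L × K) :
    hermMatrix σ (c • y) = algebraMap K L c • hermMatrix σ y := by
  ext i j
  fin_cases i <;> fin_cases j <;> simp [hermMatrix, Algebra.smul_def]

namespace RamData

variable {σ : L ≃ₐ[K] L} {e : Eisenstein K} {η : L}

theorem hermMatrix_hermAct (h : RamData σ e η) (g : Matrix (Fin 2) (Fin 2) L) (y : K × L × K) :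
    hermMatrix σ (hermAct σ g y) = g * hermMatrix σ y * (g.map σ).transpose := by
  ext i j
  fin_cases i <;> fin_cases j <;>
  simp [hermMatrix, hermAct, Matrix.mul_apply, Fin.sum_univ_two, h.norm, h.trace, h.conj_conj] <;>
  ring

theorem algebraMap_negDet (h : RamData σ e η) (y : K × L × K) :
    algebraMap K L (negDet y) = -(hermMatrix σ y).det := by
  simp [negDet, hermMatrix, Matrix.det_fin_two, h.norm]

theorem hermMatrix_pairAct (h : RamData σ e η) (g : Matrix (Fin 2) (Fin 2) L)
    (k : Matrix (Fin 2) (Fin 2) K) (x : HermPair K L) (r : Fin 2) :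
    hermMatrix σ (pairAct σ g k x r)
      = g * (∑ s : Fin 2, algebraMap K L (k r s) • hermMatrix σ (x s))
      * (g.map σ).transpose := by
  rw [pairAct, h.hermMatrix_hermAct, hermMatrix_add, hermMatrix_smul, hermMatrix_smul,
    Fin.sum_univ_two]

theorem pairAct_pairAct (h : RamData σ e η) (g g' : Matrix (Fin 2) (Fin 2) L)
    (k k' : Matrix (Fin 2) (Fin 2) K) (x : HermPair K L) :
    pairAct σ g k (pairAct σ g' k' x) = pairAct σ (g * g') (k * k') x := by
  funext r
  apply hermMatrix_injective σ
  have hmap : (g * g').map σ = g.map σ * g'.map σ := Matrix.map_mul (f := (σ : L →+* L))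
  simp only [h.hermMatrix_pairAct, Fin.sum_univ_two, Matrix.mul_apply, hmap,
    Matrix.transpose_mul, map_add, map_mul, smul_add, mul_add, add_mul, Matrix.mul_smul,
    Matrix.smul_mul, smul_smul, add_smul, Matrix.mul_assoc]
  abel

theorem pairAct_one (h : RamData σ e η) (x : HermPair K L) : pairAct σ 1 1 x = x := by
  funext r
  apply hermMatrix_injective σ
  rw [h.hermMatrix_pairAct]
  have hr : ∑ s : Fin 2, algebraMap K L ((1 : Matrix (Fin 2) (Fin 2) K) r s) • hermMatrix σ (x s)
      = hermMatrix σ (x r) := by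
    simp [Matrix.one_apply, apply_ite, ite_smul]
  rw [hr, Matrix.map_one _ (map_zero σ) (map_one σ)]
  simp

theorem pairAct_add (h : RamData σ e η) (g : Matrix (Fin 2) (Fin 2) L)
    (k : Matrix (Fin 2) (Fin 2) K) (x y : HermPair K L) :
    pairAct σ g k (x + y) = pairAct σ g k x + pairAct σ g k y := by
  funext r
  apply hermMatrix_injective σ
  simp only [Pi.add_apply, hermMatrix_add, h.hermMatrix_pairAct, Fin.sum_univ_two, smul_add,
    mul_add, add_mul]
  abel

theorem mem_orbit_iff (h : RamData σ e η) {x y : HermPair K L} :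
    y ∈ orbit σ x ↔ ∃ g k, IntMat g ∧ IntMat k ∧ y = pairAct σ g k x := by
  constructor
  · rintro ⟨g, k, hgk⟩
    refine ⟨_, _, intMat_coe g, intMat_coe k, ?_⟩
    funext r
    apply hermMatrix_injective σ
    rw [hgk r, h.hermMatrix_pairAct]
    rfl
  · rintro ⟨g, k, hg, hk, rfl⟩
    obtain ⟨g, rfl⟩ := hg.exists_coe
    obtain ⟨k, rfl⟩ := hk.exists_coe
    refine ⟨g, k, fun r => ?_⟩
    rw [h.hermMatrix_pairAct]
    rfl

theorem mem_orbit_of_eq (h : RamData σ e η) {x y : HermPair K L} (g : Matrix (Fin 2) (Fin 2) L)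
    (k : Matrix (Fin 2) (Fin 2) K) (hg : IntMat g) (hk : IntMat k) (hy : pairAct σ g k x = y) :
    y ∈ orbit σ x :=
  h.mem_orbit_iff.2 ⟨g, k, hg, hk, hy.symm⟩

theorem mem_orbit_trans (h : RamData σ e η) {x y z : HermPair K L} (hy : y ∈ orbit σ x)
    (hz : z ∈ orbit σ y) : z ∈ orbit σ x := by
  obtain ⟨g, k, hg, hk, rfl⟩ := h.mem_orbit_iff.1 hy
  obtain ⟨g', k', hg', hk', rfl⟩ := h.mem_orbit_iff.1 hz
  exact h.mem_orbit_of_eq _ _ (hg'.mul hg) (hk'.mul hk) (h.pairAct_pairAct _ _ _ _ _).symm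

theorem mem_orbit_symm (h : RamData σ e η) {x y : HermPair K L} (hy : y ∈ orbit σ x) :
    x ∈ orbit σ y := by
  obtain ⟨g, k, hg, hk, rfl⟩ := h.mem_orbit_iff.1 hy
  refine h.mem_orbit_of_eq _ _ hg.inv hk.inv ?_
  rw [h.pairAct_pairAct, hg.inv_mul, hk.inv_mul, h.pairAct_one]

theorem orbit_eq_of_mem (h : RamData σ e η) {x y : HermPair K L} (hy : y ∈ orbit σ x) :
    orbit σ y = orbit σ x :=
  Set.ext fun _ => ⟨h.mem_orbit_trans hy, h.mem_orbit_trans (h.mem_orbit_symm hy)⟩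

/-! ### Covariance of the quadratic form -/

theorem negDet_smul_add (h : RamData σ e η) (x : HermPair K L) (a b : K) :
    negDet (a • x 0 + b • x 1) =
      negDet (x 0) * a ^ 2 + midCoeff σ x * (a * b) + negDet (x 1) * b ^ 2 := by
  apply (algebraMap K L).injective
  simp only [negDet, midCoeff, Prod.fst_add, Prod.snd_add, Prod.smul_fst, Prod.smul_snd]
  simp only [Algebra.smul_def, map_sub, map_add, map_mul, h.norm, h.trace, map_pow,
    AlgEquiv.commutes, h.conj_conj, Algebra.algebraMap_self, RingHom.id_apply]
  ring

theorem negDet_hermAct (h : RamData σ e η) (g : Matrix (Fin 2) (Fin 2) L) (y : K × L × K) :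
    negDet (hermAct σ g y) = Algebra.norm K g.det * negDet y := by
  apply (algebraMap K L).injective
  rw [map_mul, h.algebraMap_negDet, h.algebraMap_negDet, h.hermMatrix_hermAct, Matrix.det_mul,
    Matrix.det_mul, Matrix.det_transpose, h.norm]
  have : (g.map σ).det = σ g.det := by simp [Matrix.det_fin_two]
  rw [this]
  ring

/-- `F_{gx}(a, b) = N(det g₁) F_x((a, b) g₂)`. -/
theorem negDet_pairAct (h : RamData σ e η) (g : Matrix (Fin 2) (Fin 2) L)
    (k : Matrix (Fin 2) (Fin 2) K) (x : HermPair K L) (r : Fin 2) :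
    negDet (pairAct σ g k x r) = Algebra.norm K g.det *
      (negDet (x 0) * k r 0 ^ 2 + midCoeff σ x * (k r 0 * k r 1) + negDet (x 1) * k r 1 ^ 2) := by
  rw [pairAct, h.negDet_hermAct, h.negDet_smul_add]

theorem midCoeff_pairAct (h : RamData σ e η) (g : Matrix (Fin 2) (Fin 2) L)
    (k : Matrix (Fin 2) (Fin 2) K) (x : HermPair K L) :
    midCoeff σ (pairAct σ g k x) = Algebra.norm K g.det *
      (2 * negDet (x 0) * (k 0 0 * k 1 0) + midCoeff σ x * (k 0 0 * k 1 1 + k 0 1 * k 1 0)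
        + 2 * negDet (x 1) * (k 0 1 * k 1 1)) := by
  have h1 := h.negDet_smul_add (pairAct σ g k x) 1 1
  have h2 : (1 : K) • pairAct σ g k x 0 + (1 : K) • pairAct σ g k x 1
      = hermAct σ g ((k 0 0 + k 1 0) • x 0 + (k 0 1 + k 1 1) • x 1) := by
    apply hermMatrix_injective σ
    simp only [one_smul, hermMatrix_add, pairAct, h.hermMatrix_hermAct, hermMatrix_smul,
      mul_add, add_mul, add_smul]
    abel
  rw [h2, h.negDet_hermAct, h.negDet_smul_add, h.negDet_pairAct, h.negDet_pairAct] at h1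
  linear_combination -h1

theorem formDisc_pairAct (h : RamData σ e η) (g : Matrix (Fin 2) (Fin 2) L)
    (k : Matrix (Fin 2) (Fin 2) K) (x : HermPair K L) :
    formDisc σ (pairAct σ g k x) = (Algebra.norm K g.det * k.det) ^ 2 * formDisc σ x := by
  rw [formDisc, formDisc, h.midCoeff_pairAct, h.negDet_pairAct, h.negDet_pairAct,
    Matrix.det_fin_two k]
  ring

end RamData

end Action

/-! ### Quadratic extensions and discriminants -/

section Quadratic

variable {M : Type*} [Field M] {E : Type*} [Field E] [Algebra M E]

theorem isSplittingField_quadratic_iff (a b : M) :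
    (X ^ 2 + C a * X + C b : M[X]).IsSplittingField M E ↔
      ∃ θ : E, θ ^ 2 + algebraMap M E a * θ + algebraMap M E b = 0 ∧
        ∀ w : E, ∃ s t : M, w = algebraMap M E s + algebraMap M E t * θ := by
  have hmonic : (X ^ 2 + C a * X + C b : M[X]).Monic := by monicity!
  have hdeg : (X ^ 2 + C a * X + C b : M[X]).natDegree = 2 := by compute_degree!
  constructor
  · intro hs
    have hsp := hs.splits
    obtain ⟨θ, hθ⟩ := hsp.exists_eval_eq_zero (by
      rw [Polynomial.degree_map, Polynomial.degree_eq_natDegree hmonic.ne_zero, hdeg]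
      norm_num)
    have hθ' : θ ^ 2 + algebraMap M E a * θ + algebraMap M E b = 0 := by simpa using hθ
    refine ⟨θ, hθ', fun w => ?_⟩
    have hw : w ∈ Algebra.adjoin M ((X ^ 2 + C a * X + C b : M[X]).rootSet E) :=
      hs.adjoin_rootSet ▸ Algebra.mem_top
    induction hw using Algebra.adjoin_induction with
    | mem x hx =>
      rw [Polynomial.mem_rootSet] at hx
      have hx2 : x ^ 2 + algebraMap M E a * x + algebraMap M E b = 0 := by simpa using hx.2
      have h0 : (x - θ) * (x + θ + algebraMap M E a) = 0 := by linear_combination hx2 - hθ'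
      rcases mul_eq_zero.1 h0 with h | h
      · exact ⟨0, 1, by rw [map_zero, map_one]; linear_combination h⟩
      · exact ⟨-a, -1, by rw [map_neg, map_neg, map_one]; linear_combination h⟩
    | algebraMap r => exact ⟨r, 0, by simp⟩
    | add x y _ _ hx hy =>
      obtain ⟨s, t, rfl⟩ := hx
      obtain ⟨s', t', rfl⟩ := hy
      exact ⟨s + s', t + t', by simp only [map_add]; ring⟩
    | mul x y _ _ hx hy =>
      obtain ⟨s, t, rfl⟩ := hx
      obtain ⟨s', t', rfl⟩ := hy
      refine ⟨s * s' - t * t' * b, s * t' + t * s' - t * t' * a, ?_⟩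
      simp only [map_add, map_sub, map_mul]
      linear_combination (algebraMap M E t * algebraMap M E t') * hθ'
  · rintro ⟨θ, hθ, hspan⟩
    refine ⟨?_, ?_⟩
    · have : (X ^ 2 + C a * X + C b : M[X]).map (algebraMap M E)
          = (X - C θ) * (X - C (-algebraMap M E a - θ)) := by
        have hb : algebraMap M E b = θ * (-algebraMap M E a - θ) := by linear_combination hθ
        simp only [Polynomial.map_add, Polynomial.map_mul, Polynomial.map_pow, Polynomial.map_X,
          Polynomial.map_C, hb, map_mul, map_sub, map_neg]
        ring
      rw [this]
      exact (Polynomial.Splits.X_sub_C _).mul (Polynomial.Splits.X_sub_C _)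
    · rw [eq_top_iff]
      intro w _
      obtain ⟨s, t, rfl⟩ := hspan w
      have hmem : θ ∈ (X ^ 2 + C a * X + C b : M[X]).rootSet E := by
        rw [Polynomial.mem_rootSet]
        exact ⟨hmonic.ne_zero, by simpa using hθ⟩
      exact add_mem (Subalgebra.algebraMap_mem _ _)
        (mul_mem (Subalgebra.algebraMap_mem _ _) (Algebra.subset_adjoin hmem))

end Quadratic

section Fields

set_option linter.unusedSectionVars false

variable {K : Type*} [Field K] [ValuativeRel K] [TopologicalSpace K] [IsNonarchimedeanLocalField K]

/-- The discriminant of an Eisenstein polynomial. -/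
noncomputable def DyadicPair.Eisenstein.disc (p : Eisenstein K) : K := (p.a₁ : K) ^ 2 - 4 * p.a₂

/-- `d` and `d'` have the same class modulo non-zero squares. -/
def SqClassEq (d d' : K) : Prop := ∃ s : K, s ≠ 0 ∧ d' = s ^ 2 * d

theorem SqClassEq.symm {d d' : K} (h : SqClassEq d d') : SqClassEq d' d := by
  obtain ⟨s, hs, rfl⟩ := h
  exact ⟨s⁻¹, inv_ne_zero hs, by field_simp⟩

theorem SqClassEq.trans {d d' d'' : K} (h : SqClassEq d d') (h' : SqClassEq d' d'') :
    SqClassEq d d'' := by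
  obtain ⟨s, hs, rfl⟩ := h
  obtain ⟨t, ht, rfl⟩ := h'
  exact ⟨t * s, mul_ne_zero ht hs, by ring⟩

namespace DyadicPair.Eisenstein

theorem not_root (p : Eisenstein K) (z : K) : z ^ 2 + (p.a₁ : K) * z + p.a₂ ≠ 0 :=
  p.isUnif.form_ne_zero (p.val_a₁ p.isUnif) z

theorem disc_ne_sq [CharZero K] (p : Eisenstein K) (r : K) : p.disc ≠ r ^ 2 := by
  intro h
  apply p.not_root ((r - p.a₁) / 2)
  rw [disc] at h
  field_simp
  linear_combination -h

theorem generates_iff (p : Eisenstein K) (F : Type*) [Field F] [Algebra K F] :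
    p.Generates F ↔ ∃ θ : F, θ ^ 2 + algebraMap K F p.a₁ * θ + algebraMap K F p.a₂ = 0 ∧
        ∀ w : F, ∃ s t : K, w = algebraMap K F s + algebraMap K F t * θ :=
  isSplittingField_quadratic_iff _ _

/-- Eisenstein polynomials whose roots generate the same extension have discriminants in the same
square class. -/
theorem sqClassEq_of_generates [CharZero K] {p p' : Eisenstein K} {F : Type*} [Field F]
    [Algebra K F] (h : p.Generates F) (h' : p'.Generates F) : SqClassEq p.disc p'.disc := by
  obtain ⟨θ, hθ, hspan⟩ := (p.generates_iff F).1 h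
  obtain ⟨θ', hθ', -⟩ := (p'.generates_iff F).1 h'
  obtain ⟨s, t, hst⟩ := hspan θ'
  have hne : ∀ z : K, algebraMap K F z ≠ θ := by
    rintro z rfl
    apply p.not_root z
    apply (algebraMap K F).injective
    simpa using hθ
  have hlin : ∀ u v : K, algebraMap K F u + algebraMap K F v * θ = 0 → v = 0 ∧ u = 0 := by
    intro u v huv
    have hv : v = 0 := by
      by_contra hv
      apply hne (-u / v)
      rw [map_div₀, map_neg, div_eq_iff (by simpa using hv)]
      linear_combination -huv
    subst hv
    exact ⟨rfl, by simpa using huv⟩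
  have hrel := hlin (s ^ 2 - t ^ 2 * p.a₂ + p'.a₁ * s + p'.a₂)
    (2 * s * t - t ^ 2 * p.a₁ + p'.a₁ * t) (by
      simp only [map_add, map_sub, map_mul, map_pow, map_ofNat]
      rw [hst] at hθ'
      linear_combination hθ' - (algebraMap K F t) ^ 2 * hθ)
  have ht : t ≠ 0 := by
    rintro rfl
    apply p'.not_root s
    linear_combination hrel.2
  -- with `θ' = s + t θ`, the trace of `2 θ' + a₁'` vanishes: `2 θ' + a₁' = t (2 θ + a₁)`
  have h1 : 2 * s - t * p.a₁ + p'.a₁ = 0 := by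
    apply mul_left_cancel₀ ht
    linear_combination hrel.1
  refine ⟨t, ht, ?_⟩
  rw [disc, disc]
  linear_combination (-4) * hrel.2 + (2 * s + t * p.a₁ + p'.a₁) * h1

/-- The square class of the discriminant determines the extension generated by the roots. -/
theorem generates_of_sqClassEq [CharZero K] {p p' : Eisenstein K} {F : Type*} [Field F]
    [Algebra K F] (h : p.Generates F) (hd : SqClassEq p.disc p'.disc) : p'.Generates F := by
  obtain ⟨θ, hθ, hspan⟩ := (p.generates_iff F).1 h
  obtain ⟨s, hs, hd⟩ := hd
  have : CharZero F := charZero_of_injective_algebraMap (algebraMap K F).injective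
  have hd' : algebraMap K F p'.a₁ ^ 2 - 4 * algebraMap K F p'.a₂
      = algebraMap K F s ^ 2 * (algebraMap K F p.a₁ ^ 2 - 4 * algebraMap K F p.a₂) := by
    have := congrArg (algebraMap K F) hd
    simpa only [disc, map_sub, map_mul, map_pow, map_ofNat] using this
  have hs' : algebraMap K F s ≠ 0 := by simpa using hs
  refine (p'.generates_iff F).2 ⟨algebraMap K F ((s * p.a₁ - p'.a₁) / 2) + algebraMap K F s * θ,
    ?_, fun w => ?_⟩
  · simp only [map_div₀, map_sub, map_mul, map_ofNat]
    field_simp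
    linear_combination -hd' + 4 * algebraMap K F s ^ 2 * hθ
  · obtain ⟨x, y, rfl⟩ := hspan w
    refine ⟨x - y / s * ((s * p.a₁ - p'.a₁) / 2), y / s, ?_⟩
    simp only [map_div₀, map_sub, map_mul, map_ofNat]
    field_simp
    ring

theorem nonempty_algEquiv {p : Eisenstein K} {F F' : Type*} [Field F] [Algebra K F]
    [Field F'] [Algebra K F'] (h : p.Generates F) (h' : p.Generates F') :
    Nonempty (F ≃ₐ[K] F') := by
  have := h
  have := h'
  unfold Generates at *
  exact ⟨(Polynomial.IsSplittingField.algEquiv F p.poly).trans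
    (Polynomial.IsSplittingField.algEquiv F' p.poly).symm⟩

theorem Generates.congr {p : Eisenstein K} {F F' : Type*} [Field F] [Algebra K F]
    [Field F'] [Algebra K F'] (h : p.Generates F) (f : F ≃ₐ[K] F') : p.Generates F' := by
  have := h
  unfold Generates at *
  exact Polynomial.IsSplittingField.of_algEquiv F' p.poly f

/-- Two Eisenstein polynomials with the same splitting field are related by an integral affine
substitution of the roots. -/
theorem exists_substitution [CharZero K] {p p' : Eisenstein K} (hd : SqClassEq p.disc p'.disc) :
    ∃ α β : K, valuation K α < 1 ∧ valuation K β = 1 ∧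
      (p'.a₁ : K) = β * p.a₁ - 2 * α ∧
      (p'.a₂ : K) = α ^ 2 - α * β * p.a₁ + β ^ 2 * p.a₂ := by
  obtain ⟨s, hs, hd⟩ := hd
  have h2 : (p'.a₂ : K) = ((s * p.a₁ - p'.a₁) / 2 : K) ^ 2 - ((s * p.a₁ - p'.a₁) / 2) * s * p.a₁
      + s ^ 2 * p.a₂ := by
    rw [disc, disc] at hd
    field_simp
    linear_combination -hd
  refine ⟨(s * p.a₁ - p'.a₁) / 2, s, ?_, ?_, by ring, h2⟩
  all_goals
    have hv := p.isUnif.valuation_form (A := -(p.a₁ : K)) (by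
      rw [Valuation.map_neg]; exact p.val_a₁ p.isUnif) ((s * p.a₁ - p'.a₁) / 2 : K) s
    have he : ((s * p.a₁ - p'.a₁) / 2 : K) ^ 2 + -(p.a₁ : K) * ((s * p.a₁ - p'.a₁) / 2) * s
        + p.a₂ * s ^ 2 = p'.a₂ := by rw [h2]; ring
    rw [he, p'.isUnif.val_eq p.isUnif] at hv
    have hα : valuation K ((s * p.a₁ - p'.a₁) / 2 : K) < 1 := by
      rw [← pow_lt_one_iff_of_nonneg zero_le two_ne_zero]
      exact (hv ▸ le_max_left _ _ : _ ≤ valuation K (p.a₂ : K)).trans_lt p.isUnif.lt_one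
  · exact hα
  · have hα2 : valuation K ((s * p.a₁ - p'.a₁) / 2 : K) ^ 2 < valuation K (p.a₂ : K) := by
      calc _ ≤ valuation K (p.a₂ : K) ^ 2 :=
            pow_le_pow_left₀ zero_le (p.isUnif.le_of_lt_one _ hα) 2
        _ < valuation K (p.a₂ : K) ^ 1 := p.isUnif.val_pow_lt_iff.2 (by norm_num)
        _ = _ := pow_one _
    rcases max_choice (valuation K ((s * p.a₁ - p'.a₁) / 2 : K) ^ 2)
      (valuation K (p.a₂ : K) * valuation K s ^ 2) with h | h
    · rw [h] at hv
      exact absurd hv.symm hα2.ne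
    · rw [h] at hv
      have : valuation K s ^ 2 = 1 := by
        apply mul_left_cancel₀ p.isUnif.val_pos.ne'
        rw [← hv, mul_one]
      exact (pow_eq_one_iff_of_nonneg zero_le two_ne_zero).1 this

end DyadicPair.Eisenstein

end Fields

/-! ### Normal forms of orbits -/

section NormalForm

set_option linter.unusedSectionVars false

variable {K : Type*} [Field K] [ValuativeRel K] [TopologicalSpace K] [IsNonarchimedeanLocalField K]
variable {L : Type*} [Field L] [ValuativeRel L] [TopologicalSpace L]
  [IsNonarchimedeanLocalField L] [Algebra K L]

/-- The pairs `x` in `V_𝒪` which are congruent to `(((0, 1), (1, 0)), ((1, 0), (0, 0)))` modulo the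
maximal ideals. -/
def baseSet (K L : Type*) [Field K] [ValuativeRel K] [Field L] [ValuativeRel L] :
    Set (HermPair K L) :=
  {x | (valuation K (x 0).1 < 1 ∧ valuation L ((x 0).2.1 - 1) < 1 ∧ valuation K (x 0).2.2 < 1) ∧
    valuation K ((x 1).1 - 1) < 1 ∧ valuation L (x 1).2.1 < 1 ∧ valuation K (x 1).2.2 < 1}

theorem val_eq_one_of_sub {E : Type*} [Field E] [ValuativeRel E] {x : E}
    (h : valuation E (x - 1) < 1) : valuation E x = 1 := by
  have := Valuation.map_add_eq_of_lt_right (valuation E) (x := x - 1) (y := 1) (by simpa using h)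
  simpa using this

namespace RamData

variable {σ : L ≃ₐ[K] L} {e : Eisenstein K} {η : L}

theorem negDet_stdRep_zero (_ : RamData σ e η) (p : Eisenstein K) :
    negDet (stdRep L p 0) = 1 := by
  simp [negDet, stdRep]

theorem negDet_stdRep_one (h : RamData σ e η) (p : Eisenstein K) :
    negDet (stdRep L p 1) = p.a₂ := by
  simp [negDet, stdRep, h.norm_algebraMap]

theorem norm_zero (h : RamData σ e η) : Algebra.norm K (0 : L) = 0 := by
  simpa using h.norm_algebraMap 0

theorem hermAct_one (h : RamData σ e η) (y : K × L × K) : hermAct σ 1 y = y := by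
  ext <;> simp [hermAct, h.norm_zero]

theorem hermAct_lower (h : RamData σ e η) (u t : L) (y : K × L × K) :
    hermAct σ !![1, 0; u, t] y = (y.1, algebraMap K L y.1 * σ u + σ t * y.2.1,
      Algebra.norm K u * y.1 + Algebra.trace K L (u * σ t * y.2.1) + Algebra.norm K t * y.2.2) := by
  ext <;> simp [hermAct, h.norm_zero]

theorem trace_algebraMap (h : RamData σ e η) (s : K) :
    Algebra.trace K L (algebraMap K L s) = 2 * s := by
  simpa using h.trace_mk s 0

theorem midCoeff_stdRep (h : RamData σ e η) (p : Eisenstein K) :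
    midCoeff σ (stdRep L p) = p.a₁ := by
  simp [midCoeff, stdRep, h.trace_algebraMap]
  ring

theorem formDisc_stdRep (h : RamData σ e η) (p : Eisenstein K) :
    formDisc σ (stdRep L p) = p.disc := by
  rw [formDisc, h.midCoeff_stdRep, h.negDet_stdRep_zero, h.negDet_stdRep_one, one_mul,
    Eisenstein.disc]

theorem generates_fieldOf (h : RamData σ e η) (p : Eisenstein K) :
    p.Generates (fieldOf σ (stdRep L p)) := by
  have hp : formPoly σ (stdRep L p) = p.poly := by
    have h0 := h.negDet_stdRep_zero p
    have h1 := h.negDet_stdRep_one p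
    have h2 := h.midCoeff_stdRep p
    unfold negDet at h0 h1
    unfold midCoeff at h2
    rw [formPoly, h0, h1, h2, Eisenstein.poly, C_1, one_mul]
  unfold Eisenstein.Generates
  rw [← hp]
  exact Polynomial.IsSplittingField.splittingField _

/-- The orbit of `w_p` depends only on the quadratic extension generated by the roots of `p`. -/
theorem orbit_stdRep_eq (h : RamData σ e η) [CharZero K] [ValuativeExtension K L]
    {p p' : Eisenstein K} (hd : SqClassEq p.disc p'.disc) :
    orbit σ (stdRep L p') = orbit σ (stdRep L p) := by
  obtain ⟨α, β, hα, hβ, h1, h2⟩ := Eisenstein.exists_substitution hd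
  have hβ0 : β ≠ 0 := by
    rintro rfl
    simp at hβ
  -- `(1, -π')` is the basis `(1, -α + β (-π))` of the order generated by the root `π` of `p`
  refine h.orbit_eq_of_mem (h.mem_orbit_of_eq !![1, 0; -algebraMap K L α, algebraMap K L β]
    !![1 / β, 0; -(α / β), 1] (intMat_of (by simp) (by simp) ?_ ?_ ?_)
    (intMat_of ?_ (by simp) ?_ (by simp) ?_) ?_)
  · rw [Valuation.map_neg, vL_le_one_iff]; exact hα.le
  · rw [vL_le_one_iff]; exact hβ.le
  · have := (vL_eq_iff (L := L) β 1).2 (by simpa using hβ)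
    simpa using this
  · simp [hβ]
  · rw [Valuation.map_neg, map_div₀, hβ, div_one]; exact hα.le
  · simp [hβ]
  · have e1 : Algebra.norm K (-algebraMap K L α) = α ^ 2 := by
      rw [h.norm_neg, h.norm_algebraMap]
    have hβL : algebraMap K L β ≠ 0 := by simpa using hβ0
    refine funext (Fin.forall_fin_two.2 ⟨?_, ?_⟩)
    · have et : Algebra.trace K L (-algebraMap K L α * algebraMap K L β * (algebraMap K L β)⁻¹)
          = -(2 * α) := by
        rw [mul_inv_cancel_right₀ hβL, map_neg, h.trace_algebraMap]
      have e2 : pairAct σ !![1, 0; -algebraMap K L α, algebraMap K L β] !![1 / β, 0; -(α / β), 1]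
          (stdRep L p) 0 = hermAct σ !![1, 0; -algebraMap K L α, algebraMap K L β]
            (0, (algebraMap K L β)⁻¹, β⁻¹ * p.a₁) := by
        rw [pairAct]
        congr 1
        ext <;> simp [stdRep, Algebra.smul_def]
      rw [e2, h.hermAct_lower, e1, h.norm_algebraMap, AlgEquiv.commutes, et]
      ext
      · simp [stdRep]
      · simp [stdRep, hβL]
      · simp only [stdRep, Matrix.cons_val_zero, h1]
        field_simp
        ring
    · have e2 : pairAct σ !![1, 0; -algebraMap K L α, algebraMap K L β] !![1 / β, 0; -(α / β), 1]
          (stdRep L p) 1 = hermAct σ !![1, 0; -algebraMap K L α, algebraMap K L β]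
            (1, algebraMap K L (p.a₁ - α / β), p.a₁ ^ 2 - p.a₂ - α / β * p.a₁) := by
        rw [pairAct]
        congr 1
        ext
        · simp [stdRep]
        · simp [stdRep, Algebra.smul_def]
          ring
        · simp [stdRep]
          ring
      rw [e2, h.hermAct_lower, e1, h.norm_algebraMap, ← map_neg, AlgEquiv.commutes]
      simp only [← map_mul, AlgEquiv.commutes]
      rw [h.trace_algebraMap]
      ext
      · simp [stdRep]
      · simp only [stdRep, Matrix.cons_val_one, Matrix.cons_val_fin_one,
          ← map_add, h1]
        congr 1
        field_simp
        ring
      · simp only [stdRep, Matrix.cons_val_one, Matrix.cons_val_fin_one, h1, h2]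
        field_simp
        ring

/-- The points `w_η` and `w_e` lie in one orbit, by a unipotent change of basis
over the integers of `L`. -/
theorem orbit_wEta (h : RamData σ e η) [ValuativeExtension K L] {η₂ : L}
    (hη₂ : η + η₂ = -algebraMap K L e.a₁) :
    orbit σ (wEta K η₂) = orbit σ (stdRep L e) := by
  have hση : σ η = η₂ := by rw [h.conj]; linear_combination -hη₂
  have hση₂ : σ η₂ = η := by rw [← hση, h.conj_conj]
  have hv : valuation L η₂ ≤ 1 := by
    rw [← hση, h.val_conj]
    exact h.isUnif_eta.lt_one.le
  refine (h.orbit_eq_of_mem (h.mem_orbit_of_eq !![1, 0; -η₂, 1] 1 (intMat_of (by simp) (by simp)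
    (by rwa [Valuation.map_neg]) (by simp) (by simp)) intMat_one ?_)).symm
  funext r
  have hr := h.root
  have e1 : Algebra.trace K L (-η₂) = e.a₁ := by
    apply (algebraMap K L).injective
    rw [h.trace, map_neg, hση₂]
    linear_combination -hη₂
  have e2 : Algebra.norm K (-η₂) = e.a₂ := by
    apply (algebraMap K L).injective
    rw [h.norm, map_neg, hση₂]
    linear_combination η * hη₂ - hr
  have e3 : Algebra.trace K L (η₂ * η₂) = e.a₁ ^ 2 - 2 * e.a₂ := by
    apply (algebraMap K L).injective
    rw [h.trace, map_mul, hση₂, map_sub, map_pow, map_mul, map_ofNat]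
    linear_combination (η₂ - η - algebraMap K L e.a₁) * hη₂ + 2 * hr
  revert r
  refine Fin.forall_fin_two.2 ⟨?_, ?_⟩
  · simp [pairAct, h.hermAct_lower, stdRep, wEta, e1]
  · simp [pairAct, h.hermAct_lower, stdRep, wEta, e2, e3, hση₂]
    refine ⟨by linear_combination -hη₂, by ring⟩

section

variable [ValuativeExtension K L]

theorem trace_lt_one (h : RamData σ e η) {w : L} (hw : valuation L w < 1) :
    valuation K (Algebra.trace K L w) < 1 := by
  rw [← vL_lt_one_iff (L := L), h.trace]
  exact Valuation.map_add_lt _ hw (by rwa [h.val_conj])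

theorem trace_le_one (h : RamData σ e η) {w : L} (hw : valuation L w ≤ 1) :
    valuation K (Algebra.trace K L w) ≤ 1 := by
  rw [← vL_le_one_iff (L := L), h.trace]
  exact val_add_le hw (by rwa [h.val_conj])

theorem norm_eq_one (h : RamData σ e η) {w : L} (hw : valuation L w = 1) :
    valuation K (Algebra.norm K w) = 1 := by
  apply le_antisymm ((h.le_one_iff_norm w).1 hw.le)
  rw [← not_lt, ← h.lt_one_iff_norm, hw]
  exact lt_irrefl 1

theorem negDet_base_zero (h : RamData σ e η) {x : HermPair K L} (hx : x ∈ baseSet K L) :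
    valuation K (negDet (x 0)) = 1 := by
  have h1 := h.norm_eq_one (val_eq_one_of_sub hx.1.2.1)
  rw [negDet, sub_eq_add_neg, Valuation.map_add_eq_of_lt_left _ _, h1]
  rw [Valuation.map_neg, h1, map_mul]
  exact mul_lt_one_of_lt_of_le hx.1.1 hx.1.2.2.le

theorem midCoeff_base (h : RamData σ e η) {x : HermPair K L} (hx : x ∈ baseSet K L) :
    valuation K (midCoeff σ x) < 1 := by
  rw [midCoeff]
  refine Valuation.map_sub_lt _ (Valuation.map_sub_lt _ (h.trace_lt_one ?_) ?_) ?_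
  · rw [map_mul, h.val_conj, val_eq_one_of_sub hx.1.2.1, one_mul]
    exact hx.2.2.1
  · rw [map_mul]
    exact mul_lt_one_of_lt_of_le hx.1.1 hx.2.2.2.le
  · rw [map_mul, val_eq_one_of_sub hx.2.1, mul_one]
    exact hx.1.2.2

theorem negDet_base_one (h : RamData σ e η) {x : HermPair K L} (hx : x ∈ baseSet K L) :
    valuation K (negDet (x 1)) < 1 := by
  rw [negDet]
  refine Valuation.map_sub_lt _ ((h.lt_one_iff_norm _).1 hx.2.2.1) ?_
  rw [map_mul, val_eq_one_of_sub hx.2.1, one_mul]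
  exact hx.2.2.2

/-- Whether `F_x` is an Eisenstein form, for `x` in `baseSet`, depends only on the orbit of `x`. -/
theorem isUnif_negDet_of_mem_orbit (h : RamData σ e η) {x y : HermPair K L}
    (hx : valuation K (negDet (x 0)) = 1) (hx1 : valuation K (midCoeff σ x) < 1)
    (hy : y ∈ baseSet K L) (hxy : y ∈ orbit σ x)
    (hu : IsUnif (negDet (x 1))) : IsUnif (negDet (y 1)) := by
  obtain ⟨g, k, hg, hk, rfl⟩ := h.mem_orbit_iff.1 hxy
  have hlt := h.negDet_base_one hy
  have hx0 : negDet (x 0) ≠ 0 := by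
    intro h0
    rw [h0, map_zero] at hx
    exact zero_ne_one hx
  have hC : IsUnif (negDet (x 1) / negDet (x 0)) := hu.of_val_eq (by rw [map_div₀, hx, div_one])
  have hv := hC.valuation_form (A := midCoeff σ x / negDet (x 0))
    (hC.le_of_lt_one _ (by rw [map_div₀, hx, div_one]; exact hx1)) (k 1 0) (k 1 1)
  have heq : valuation K (negDet (pairAct σ g k x 1)) =
      max (valuation K (k 1 0) ^ 2) (valuation K (negDet (x 1) / negDet (x 0)) *
        valuation K (k 1 1) ^ 2) := by
    rw [← hv, h.negDet_pairAct, map_mul, h.norm_eq_one hg.det, one_mul]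
    have : negDet (x 0) * k 1 0 ^ 2 + midCoeff σ x * (k 1 0 * k 1 1) + negDet (x 1) * k 1 1 ^ 2
        = negDet (x 0) * (k 1 0 ^ 2 + midCoeff σ x / negDet (x 0) * k 1 0 * k 1 1
          + negDet (x 1) / negDet (x 0) * k 1 1 ^ 2) := by
      field_simp
    rw [this, map_mul, hx, one_mul]
  rw [heq, max_lt_iff] at hlt
  have hk10 : valuation K (k 1 0) < 1 := (pow_lt_one_iff_of_nonneg zero_le two_ne_zero).1 hlt.1
  have hk11 : valuation K (k 1 1) = 1 := by
    refine le_antisymm (hk.int 1 1) ?_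
    by_contra hlt1
    push Not at hlt1
    have hd := hk.det
    rw [Matrix.det_fin_two] at hd
    have : valuation K (k 0 0 * k 1 1 - k 0 1 * k 1 0) < 1 := by
      refine Valuation.map_sub_lt _ ?_ ?_
      · rw [map_mul, mul_comm]; exact mul_lt_one_of_lt_of_le hlt1 (hk.int _ _)
      · rw [map_mul, mul_comm]; exact mul_lt_one_of_lt_of_le hk10 (hk.int _ _)
    exact absurd hd this.ne
  apply hC.of_val_eq
  rw [heq, hk11, one_pow, mul_one, max_eq_right]
  calc valuation K (k 1 0) ^ 2 ≤ valuation K (negDet (x 1) / negDet (x 0)) ^ 2 :=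
        pow_le_pow_left₀ zero_le (hC.le_of_lt_one _ hk10) 2
    _ ≤ valuation K (negDet (x 1) / negDet (x 0)) ^ 1 := hC.val_pow_le_iff.2 (by norm_num)
    _ = _ := pow_one _

/-- Every point of `baseSet` whose form is an Eisenstein form lies in the orbit of some `w_p`. -/
theorem exists_stdRep_mem_orbit (h : RamData σ e η) {x : HermPair K L} (hx : x ∈ baseSet K L)
    (hu : IsUnif (negDet (x 1))) : ∃ p : Eisenstein K, stdRep L p ∈ orbit σ x := by
  have hd : valuation K (x 1).1 = 1 := val_eq_one_of_sub hx.2.1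
  have hd0 : (x 1).1 ≠ 0 := by
    intro h0
    rw [h0, map_zero] at hd
    exact zero_ne_one hd
  -- a shear removes the first entry of `x 0`
  obtain ⟨y, hy, hyB, hy0⟩ : ∃ y ∈ orbit σ x, y ∈ baseSet K L ∧ (y 0).1 = 0 := by
    have hr : valuation K (-((x 0).1 / (x 1).1)) < 1 := by
      rw [Valuation.map_neg, map_div₀, hd, div_one]; exact hx.1.1
    refine ⟨_, h.mem_orbit_of_eq 1 !![1, -((x 0).1 / (x 1).1); 0, 1] intMat_one
      (intMat_of (by simp) hr.le (by simp) (by simp) (by simp)) rfl, ?_, ?_⟩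
    · have e0 : pairAct σ 1 !![1, -((x 0).1 / (x 1).1); 0, 1] x 0
          = x 0 + (-((x 0).1 / (x 1).1)) • x 1 := by
        rw [pairAct, h.hermAct_one]
        simp
      have e1 : pairAct σ 1 !![1, -((x 0).1 / (x 1).1); 0, 1] x 1 = x 1 := by
        rw [pairAct, h.hermAct_one]
        simp
      rw [baseSet, Set.mem_ofPred_eq, e0, e1]
      refine ⟨⟨?_, ?_, ?_⟩, hx.2⟩
      · refine Valuation.map_add_lt _ hx.1.1 ?_
        rw [Prod.smul_fst, smul_eq_mul, map_mul, hd, mul_one]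
        exact hr
      · have : (x 0 + (-((x 0).1 / (x 1).1)) • x 1).2.1 - 1 = ((x 0).2.1 - 1)
            + algebraMap K L (-((x 0).1 / (x 1).1)) * (x 1).2.1 := by
          simp [Algebra.smul_def]; ring
        rw [this]
        refine Valuation.map_add_lt _ hx.1.2.1 ?_
        rw [map_mul]
        exact mul_lt_one_of_lt_of_le ((vL_lt_one_iff _).2 hr) hx.2.2.1.le
      · refine Valuation.map_add_lt _ hx.1.2.2 ?_
        rw [Prod.smul_snd, Prod.smul_snd, smul_eq_mul, map_mul]
        exact mul_lt_one_of_lt_of_le hr hx.2.2.2.le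
    · rw [pairAct, h.hermAct_one]
      simp
      field_simp
      ring
  have huy := h.isUnif_negDet_of_mem_orbit (h.negDet_base_zero hx) (h.midCoeff_base hx) hyB hy hu
  -- a diagonal matrix and a scaling normalize the two unit entries
  have hb : valuation L (y 0).2.1 = 1 := val_eq_one_of_sub hyB.1.2.1
  have hb0 : (y 0).2.1 ≠ 0 := by
    intro h0
    rw [h0, map_zero] at hb
    exact zero_ne_one hb
  have hd' : valuation K (y 1).1 = 1 := val_eq_one_of_sub hyB.2.1
  have hd0' : (y 1).1 ≠ 0 := by
    intro h0
    rw [h0, map_zero] at hd'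
    exact zero_ne_one hd'
  have ht : valuation L (σ (y 0).2.1)⁻¹ = 1 := by rw [map_inv₀, h.val_conj, hb, inv_one]
  obtain ⟨C, E, F, hz, hC, hE, hF⟩ : ∃ (C : K) (E : L) (F : K),
      (![(0, 1, C), (1, E, F)] : HermPair K L) ∈ orbit σ y ∧ valuation K C < 1 ∧
        valuation L E < 1 ∧ valuation K F < 1 := by
    refine ⟨Algebra.norm K (σ (y 0).2.1)⁻¹ * (y 0).2.2,
      algebraMap K L ((y 1).1⁻¹) * ((y 0).2.1)⁻¹ * (y 1).2.1,
      Algebra.norm K (σ (y 0).2.1)⁻¹ * ((y 1).1⁻¹ * (y 1).2.2), ?_, ?_, ?_, ?_⟩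
    · refine h.mem_orbit_of_eq !![1, 0; 0, (σ (y 0).2.1)⁻¹] !![1, 0; 0, (y 1).1⁻¹]
        (intMat_of (by simp) (by simp) (by simp) ht.le (by simpa using ht))
        (intMat_of (by simp) (by simp) (by simp) (by simp [hd']) (by simp [hd'])) ?_
      refine funext (Fin.forall_fin_two.2 ⟨?_, ?_⟩)
      · simp [pairAct, h.hermAct_lower, hy0, h.conj_conj, hb0]
      · simp [pairAct, h.hermAct_lower, hd0', h.conj_conj, h.norm_zero, Algebra.smul_def]
        ring
    · rw [map_mul, h.norm_eq_one ht, one_mul]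
      exact hyB.1.2.2
    · have : valuation L (algebraMap K L ((y 1).1⁻¹)) = 1 := by
        have := (vL_eq_iff (L := L) ((y 1).1⁻¹) 1).2 (by simp [hd'])
        simpa using this
      rw [map_mul, map_mul, this, map_inv₀, hb, inv_one, one_mul, one_mul]
      exact hyB.2.2.1
    · rw [map_mul, map_mul, h.norm_eq_one ht, map_inv₀, hd', inv_one, one_mul, one_mul]
      exact hyB.2.2.2
  have hzB : (![(0, 1, C), (1, E, F)] : HermPair K L) ∈ baseSet K L := by
    simp [baseSet, hC, hE, hF]
  have huz := h.isUnif_negDet_of_mem_orbit (h.negDet_base_zero hyB) (h.midCoeff_base hyB) hzB hz huy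
  have hnd : negDet ((![(0, 1, C), (1, E, F)] : HermPair K L) 1) = Algebra.norm K E - F := by
    simp [negDet]
  rw [hnd] at huz
  have ha₁ : valuation K (Algebra.trace K L E - C) < 1 :=
    Valuation.map_sub_lt _ (h.trace_lt_one hE) hC
  let p : Eisenstein K :=
    { a₁ := ⟨Algebra.trace K L E - C, ha₁.le⟩
      a₂ := ⟨Algebra.norm K E - F, huz.lt_one.le⟩
      a₁_mem := (mem_maximal_iff _).2 ha₁
      a₂_mem := (mem_maximal_iff _).2 huz.lt_one
      a₂_not_mem := by
        rw [huz.mem_maximal_pow]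
        have := (huz.val_pow_lt_iff (m := 2) (n := 1)).2 (by norm_num)
        rw [pow_one] at this
        exact not_le.2 this }
  refine ⟨p, h.mem_orbit_trans hy (h.mem_orbit_trans hz ?_)⟩
  have hp1 : (p.a₁ : K) = Algebra.trace K L E - C := rfl
  have hp2 : (p.a₂ : K) = Algebra.norm K E - F := rfl
  -- a lower triangular matrix makes both off-diagonal entries rational
  refine h.mem_orbit_of_eq !![1, 0; algebraMap K L p.a₁ - σ E, 1] 1 (intMat_of (by simp) (by simp)
    ?_ (by simp) (by simp)) intMat_one ?_
  · refine val_sub_le ((vL_le_one_iff _).2 ha₁.le) ?_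
    rw [h.val_conj]
    exact hE.le
  · refine funext (Fin.forall_fin_two.2 ⟨?_, ?_⟩)
    · simp [pairAct, h.hermAct_lower, stdRep, h.trace_algebraMap, h.trace_conj]
      rw [hp1]
      ring
    · simp [pairAct, h.hermAct_lower, stdRep, h.conj_conj]
      apply (algebraMap K L).injective
      have hq1 := congrArg (algebraMap K L) hp1
      have hq2 := congrArg (algebraMap K L) hp2
      simp only [map_sub, h.trace, h.norm] at hq1 hq2
      simp only [map_add, map_sub, map_mul, map_pow, h.trace, h.norm, h.conj_conj,
        AlgEquiv.commutes, hq2]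
      ring

end

end RamData

end NormalForm

/-! ### Norms and traces modulo powers of the maximal ideal -/

section Residue

set_option linter.unusedSectionVars false

variable {K : Type*} [Field K] [ValuativeRel K] [TopologicalSpace K] [IsNonarchimedeanLocalField K]

theorem exists_sq_sub_lt [CharP 𝓀[K] 2] {u : K} (hu : valuation K u ≤ 1) :
    ∃ r : K, valuation K r ≤ 1 ∧ valuation K (r ^ 2 - u) < 1 := by
  obtain ⟨s, hs⟩ := (bijective_frobenius 𝓀[K] 2).2 (IsLocalRing.residue 𝒪[K] ⟨u, hu⟩)
  obtain ⟨r, rfl⟩ := IsLocalRing.residue_surjective s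
  refine ⟨r, r.2, ?_⟩
  rw [frobenius_def, ← map_pow, ← sub_eq_zero, ← map_sub, IsLocalRing.residue_eq_zero_iff,
    mem_maximal_iff] at hs
  exact hs

theorem IsUnif.le_addVal_iff {c : K} (hc : IsUnif c) (n : ℕ) (x : 𝒪[K]) :
    (n : ℕ∞) ≤ IsDiscreteValuationRing.addVal 𝒪[K] x ↔ valuation K (x : K) ≤ valuation K c ^ n := by
  obtain ⟨ϖ, hϖ⟩ := IsDiscreteValuationRing.exists_irreducible 𝒪[K]
  have h1 : (n : ℕ∞) = IsDiscreteValuationRing.addVal 𝒪[K] (ϖ ^ n) := by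
    rw [IsDiscreteValuationRing.addVal_pow, IsDiscreteValuationRing.addVal_uniformizer hϖ]
    simp
  rw [h1, IsDiscreteValuationRing.addVal_le_iff_dvd, ← Ideal.mem_span_singleton,
    ← Ideal.span_singleton_pow, ← hϖ.maximalIdeal_eq, hc.mem_maximal_pow]

theorem IsUnif.val_two [CharZero K] {c : K} (hc : IsUnif c) :
    valuation K (2 : K) = valuation K c ^ twoOrd K := by
  have h2 : valuation K (2 : K) ≤ 1 := by
    have := (2 : 𝒪[K]).2
    exact this
  obtain ⟨n, hn⟩ := hc.exists_eq_pow (x := (2 : K)) two_ne_zero h2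
  have hval : ∀ k : ℕ, (k : ℕ∞) ≤ IsDiscreteValuationRing.addVal 𝒪[K] 2 ↔ k ≤ n := by
    intro k
    rw [hc.le_addVal_iff, ← hc.val_pow_le_iff, ← hn]
    rfl
  have : IsDiscreteValuationRing.addVal 𝒪[K] 2 = n := by
    apply le_antisymm
    · by_contra hlt
      push Not at hlt
      have h3 := (hval (n + 1)).1 (by exact_mod_cast Order.add_one_le_of_lt hlt)
      omega
    · exact (hval n).2 le_rfl
  rw [hn, twoOrd, this, ENat.toNat_natCast]

theorem one_le_twoOrd [CharZero K] [CharP 𝓀[K] 2] : 1 ≤ twoOrd K := by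
  obtain ⟨ϖ, hϖ⟩ := IsDiscreteValuationRing.exists_irreducible 𝒪[K]
  have hc : IsUnif (ϖ : K) := by
    refine isUnif_of_mem hϖ.not_isUnit ?_
    rw [hϖ.maximalIdeal_eq, Ideal.span_singleton_pow, Ideal.mem_span_singleton]
    intro h
    have := (pow_dvd_pow_iff hϖ.ne_zero hϖ.not_isUnit (n := 2) (m := 1)).1 (by simpa using h)
    omega
  by_contra h0
  have h1 := hc.val_two
  have h2 : twoOrd K = 0 := by omega
  rw [h2, pow_zero] at h1
  exact absurd h1 (val_two_lt_one (E := K)).ne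

namespace DyadicPair.Eisenstein

theorem le_ell_iff (p : Eisenstein K) {c : K} (hc : IsUnif c) (n : ℕ) :
    n ≤ p.ell ↔ n ≤ twoOrd K + 1 ∧ valuation K (p.a₁ : K) ≤ valuation K c ^ n := by
  have hne : min (IsDiscreteValuationRing.addVal 𝒪[K] p.a₁) ((twoOrd K + 1 : ℕ) : ℕ∞) ≠ ⊤ :=
    ne_top_of_le_ne_top (ENat.natCast_ne_top _) (min_le_right _ _)
  rw [← hc.le_addVal_iff, ← Nat.cast_le (α := ℕ∞), ell, ENat.natCast_toNat hne, le_min_iff,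
    and_comm, Nat.cast_le]

theorem ell_le (p : Eisenstein K) : p.ell ≤ twoOrd K + 1 :=
  ((p.le_ell_iff p.isUnif p.ell).1 le_rfl).1

theorem one_le_ell (p : Eisenstein K) : 1 ≤ p.ell :=
  (p.le_ell_iff p.isUnif 1).2 ⟨by omega, by rw [pow_one]; exact p.val_a₁ p.isUnif⟩

end DyadicPair.Eisenstein

end Residue

section Level

set_option linter.unusedSectionVars false

variable {K : Type*} [Field K] [ValuativeRel K] [TopologicalSpace K] [IsNonarchimedeanLocalField K]
variable {L : Type*} [Field L] [ValuativeRel L] [TopologicalSpace L]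
  [IsNonarchimedeanLocalField L] [Algebra K L]

/-- Some integer of `L` has trace `a₁` and norm `a₂` modulo the `i`-th power of `c`. -/
def LevelRel (L : Type*) [Field L] [ValuativeRel L] [Algebra K L] (c : K) (i : ℕ) (a₁ a₂ : K) :
    Prop :=
  ∃ w : L, valuation L w ≤ 1 ∧ valuation K (Algebra.trace K L w - a₁) ≤ valuation K c ^ i ∧
    valuation K (Algebra.norm K w - a₂) ≤ valuation K c ^ i

/-- `G` cuts out, over each `a₂` in the maximal ideal, one class of `a₁` modulo `c ^ i`, and this
class depends on `a₂` in a non-expanding way. -/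
structure CosetRel (c : K) (i : ℕ) (G : K → K → Prop) : Prop where
  exists_mem : ∀ a₂, valuation K a₂ < 1 → ∃ a₁, valuation K a₁ < 1 ∧ G a₁ a₂
  sub_le : ∀ a₁ a₁' a₂ a₂', valuation K a₂ < 1 → valuation K a₂' < 1 → G a₁ a₂ → G a₁' a₂' →
    ∀ j ≤ i, valuation K (a₂ - a₂') ≤ valuation K c ^ j →
      valuation K (a₁ - a₁') ≤ valuation K c ^ j
  stable : ∀ a₁ a₁' a₂, G a₁ a₂ → valuation K (a₁' - a₁) ≤ valuation K c ^ i → G a₁' a₂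

theorem cosetRel_le {c : K} (hc : IsUnif c) {n : ℕ} :
    CosetRel c n (fun a₁ _ => valuation K a₁ ≤ valuation K c ^ n) where
  exists_mem _ _ := ⟨0, by simp, by simp⟩
  sub_le _ _ _ _ _ _ h h' _ hj _ :=
    (val_sub_le h h').trans (hc.val_pow_le_iff.2 hj)
  stable a₁ a₁' a₂ h h' := by
    have := val_add_le h' h
    rwa [sub_add_cancel] at this

theorem levelSet_nonempty_iff {c : K} (hc : IsUnif c) (p : Eisenstein K) (i : ℕ) :
    (levelSet L p i i).Nonempty ↔ LevelRel L c i p.a₁ p.a₂ := by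
  constructor
  · rintro ⟨w, ⟨a, ha, ha'⟩, b, hb, hb'⟩
    refine ⟨w, w.2, ?_, ?_⟩
    · rw [ha', add_sub_cancel_left]; exact (hc.mem_maximal_pow _ _).1 ha
    · rw [hb', add_sub_cancel_left]; exact (hc.mem_maximal_pow _ _).1 hb
  · rintro ⟨w, hw, ha, hb⟩
    have h1 : valuation K c ^ i ≤ 1 := pow_le_one' hc.lt_one.le i
    exact ⟨⟨w, hw⟩, ⟨⟨_, ha.trans h1⟩, (hc.mem_maximal_pow _ _).2 ha, by simp⟩,
      ⟨_, hb.trans h1⟩, (hc.mem_maximal_pow _ _).2 hb, by simp⟩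

theorem LevelRel.mono {c : K} (hc : IsUnif c) {i j : ℕ} (hij : i ≤ j) {a₁ a₂ : K}
    (h : LevelRel L c j a₁ a₂) : LevelRel L c i a₁ a₂ := by
  obtain ⟨w, hw, h1, h2⟩ := h
  exact ⟨w, hw, h1.trans (hc.val_pow_le_iff.2 hij), h2.trans (hc.val_pow_le_iff.2 hij)⟩

theorem isGreatest_level_iff {c : K} (hc : IsUnif c) (p : Eisenstein K) (i : ℕ) :
    IsGreatest {n : ℕ | (levelSet L p n n).Nonempty} i ↔
      LevelRel L c i p.a₁ p.a₂ ∧ ¬ LevelRel L c (i + 1) p.a₁ p.a₂ := by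
  constructor
  · rintro ⟨h1, h2⟩
    refine ⟨(levelSet_nonempty_iff hc p i).1 h1, fun h => ?_⟩
    have := h2 ((levelSet_nonempty_iff hc p (i + 1)).2 h)
    omega
  · rintro ⟨h1, h2⟩
    refine ⟨(levelSet_nonempty_iff hc p i).2 h1, fun n hn => ?_⟩
    by_contra hlt
    push Not at hlt
    exact h2 (((levelSet_nonempty_iff hc p n).1 hn).mono hc hlt)

theorem IsUnif.disc_le [CharZero K] {c : K} (hc : IsUnif c) (p : Eisenstein K) {n : ℕ}
    (h1 : valuation K (p.a₁ : K) ≤ valuation K c ^ n) (h2 : n ≤ twoOrd K) :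
    valuation K p.disc ≤ valuation K c ^ (2 * n) := by
  rw [Eisenstein.disc]
  apply val_sub_le
  · rw [map_pow, mul_comm, pow_mul]
    exact pow_le_pow_left₀ zero_le h1 2
  · have : (4 : K) * p.a₂ = 2 ^ 2 * p.a₂ := by norm_num
    rw [this, map_mul, map_pow, hc.val_two, ← pow_mul, p.isUnif.val_eq hc, ← pow_succ]
    exact hc.val_pow_le_iff.2 (by omega)

namespace RamData

variable {σ : L ≃ₐ[K] L} {e : Eisenstein K} {η : L} [ValuativeExtension K L]

theorem norm_eta (h : RamData σ e η) : Algebra.norm K η = e.a₂ := by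
  simpa using h.norm_mk 0 1

/-- The bound for the trace of a product with an element of the maximal ideal. -/
theorem trace_mul_conj_le (h : RamData σ e η) {δ : ℕ}
    (hδ : valuation K e.disc = valuation K (e.a₂ : K) ^ δ) {j : ℕ} (hj : j + 1 ≤ δ)
    {w z : L} (hw : valuation L w < 1)
    (hz : valuation K (Algebra.norm K z) ≤ valuation K (e.a₂ : K) ^ j) :
    valuation K (Algebra.trace K L (w * σ z)) ≤ valuation K (e.a₂ : K) ^ (j + 1) := by
  apply h.trace_le hδ hj
  rw [map_mul, h.norm_conj, pow_succ']
  exact val_mul_le (e.isUnif.le_of_lt_one _ ((h.lt_one_iff_norm w).1 hw)) hz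

/-- Up to the exponent `δ` of the discriminant, every element of the maximal ideal is a norm modulo
`𝔭 ^ k`: the residue field is perfect, so the norms of multiples of `η ^ k` by elements of `K`
reach every class of `𝔭 ^ k` modulo `𝔭 ^ (k + 1)`, and for `k < δ` the traces that occur in the norm
of a sum do not interfere. -/
theorem exists_norm_sub_le (h : RamData σ e η) [CharP 𝓀[K] 2] {δ : ℕ}
    (hδ : valuation K e.disc = valuation K (e.a₂ : K) ^ δ) {a : K} (ha : valuation K a < 1) (k : ℕ)
    (hk : k ≤ δ) : ∃ w : L, valuation L w < 1 ∧
      valuation K (Algebra.norm K w - a) ≤ valuation K (e.a₂ : K) ^ k := by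
  induction k with
  | zero => exact ⟨0, by simp, by simpa [h.norm_zero] using ha.le⟩
  | succ k ih =>
    rcases Nat.eq_zero_or_pos k with rfl | hk0
    · exact ⟨0, by simp, by simpa [h.norm_zero] using e.isUnif.le_of_lt_one _ ha⟩
    obtain ⟨w, hw, hwa⟩ := ih (by omega)
    -- correct `w` by a multiple of `η ^ k` whose norm cancels the error
    have hu : valuation K ((a - Algebra.norm K w) / (e.a₂ : K) ^ k) ≤ 1 := by
      rw [map_div₀, map_pow, Valuation.map_sub_swap]
      exact (div_le_one₀ (e.isUnif.val_pow_pos k)).2 hwa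
    obtain ⟨r, hr, hru⟩ := exists_sq_sub_lt hu
    have hz : Algebra.norm K (algebraMap K L r * η ^ k) = r ^ 2 * (e.a₂ : K) ^ k := by
      rw [map_mul, map_pow, h.norm_algebraMap, h.norm_eta]
    have hzle : valuation K (Algebra.norm K (algebraMap K L r * η ^ k))
        ≤ valuation K (e.a₂ : K) ^ k := by
      rw [hz, map_mul, map_pow, map_pow]
      exact mul_le_of_le_one_left zero_le (pow_le_one' hr 2)
    refine ⟨w + algebraMap K L r * η ^ k, ?_, ?_⟩
    · refine Valuation.map_add_lt _ hw ?_
      rw [h.lt_one_iff_norm]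
      exact hzle.trans_lt (pow_lt_one₀ zero_le e.isUnif.lt_one (by omega))
    · have : Algebra.norm K (w + algebraMap K L r * η ^ k) - a =
          Algebra.trace K L (w * σ (algebraMap K L r * η ^ k)) +
            (r ^ 2 - (a - Algebra.norm K w) / (e.a₂ : K) ^ k) * (e.a₂ : K) ^ k := by
        have he0 := e.isUnif.ne_zero
        rw [h.norm_add, hz]
        field_simp
        ring
      rw [this]
      refine val_add_le (h.trace_mul_conj_le hδ hk hw hzle) ?_
      rw [pow_succ' (valuation K (e.a₂ : K)) k, map_mul, map_pow]
      gcongr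
      exact e.isUnif.le_of_lt_one _ hru

/-- If two elements of `L` in the maximal ideal have norms congruent modulo `𝔭 ^ j`, with
`j ≤ δ`, then they are congruent modulo `𝔓 ^ j`. -/
theorem norm_sub_le (h : RamData σ e η) {δ : ℕ}
    (hδ : valuation K e.disc = valuation K (e.a₂ : K) ^ δ) {j : ℕ} (hj : j ≤ δ) {w z : L}
    (hw : valuation L w < 1) (hz : valuation L z < 1)
    (hwz : valuation K (Algebra.norm K z - Algebra.norm K w) ≤ valuation K (e.a₂ : K) ^ j) :
    valuation K (Algebra.norm K (z - w)) ≤ valuation K (e.a₂ : K) ^ j := by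
  suffices ∀ k ≤ j, valuation K (Algebra.norm K (z - w)) ≤ valuation K (e.a₂ : K) ^ k from
    this j le_rfl
  intro k
  induction k with
  | zero =>
    intro _
    rw [pow_zero, ← h.le_one_iff_norm]
    exact (Valuation.map_sub_lt _ hz hw).le
  | succ k ih =>
    intro hk
    have : Algebra.norm K (z - w) = (Algebra.norm K z - Algebra.norm K w)
        - Algebra.trace K L (w * σ (z - w)) := by
      have := h.norm_add w (z - w)
      rw [add_sub_cancel] at this
      rw [this]
      ring
    rw [this]
    exact val_sub_le (hwz.trans (e.isUnif.val_pow_le_iff.2 hk))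
      (h.trace_mul_conj_le hδ (hk.trans hj) hw (ih (by omega)))

theorem trace_sub_le (h : RamData σ e η) {δ : ℕ}
    (hδ : valuation K e.disc = valuation K (e.a₂ : K) ^ δ) {j : ℕ} (hj : j ≤ δ) {w z : L}
    (hw : valuation L w < 1) (hz : valuation L z < 1)
    (hwz : valuation K (Algebra.norm K z - Algebra.norm K w) ≤ valuation K (e.a₂ : K) ^ j) :
    valuation K (Algebra.trace K L z - Algebra.trace K L w) ≤ valuation K (e.a₂ : K) ^ j := by
  rw [← map_sub]
  exact h.trace_le hδ hj (h.norm_sub_le hδ hj hw hz hwz)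

theorem lt_one_of_norm_sub_le (h : RamData σ e η) {i : ℕ} (hi : 1 ≤ i) {a : K}
    (ha : valuation K a < 1) {w : L}
    (hw : valuation K (Algebra.norm K w - a) ≤ valuation K (e.a₂ : K) ^ i) : valuation L w < 1 := by
  rw [h.lt_one_iff_norm]
  have := Valuation.map_add_lt (valuation K)
    (hw.trans_lt (pow_lt_one₀ zero_le e.isUnif.lt_one (by omega))) ha
  rwa [sub_add_cancel] at this

/-- Up to the discriminant exponent, the norm of an element of the maximal ideal modulo `𝔭 ^ i` is
arbitrary, and it determines the trace modulo `𝔭 ^ i`. -/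
theorem cosetRel_level (h : RamData σ e η) [CharP 𝓀[K] 2] {δ : ℕ}
    (hδ : valuation K e.disc = valuation K (e.a₂ : K) ^ δ) {i : ℕ} (hi : 1 ≤ i) (hiδ : i ≤ δ) :
    CosetRel (e.a₂ : K) i (LevelRel L (e.a₂ : K) i) where
  exists_mem a₂ ha₂ := by
    obtain ⟨w, hw, hwa⟩ := h.exists_norm_sub_le hδ ha₂ i hiδ
    exact ⟨Algebra.trace K L w, h.trace_lt_one hw, w, hw.le, by simp, hwa⟩
  sub_le a₁ a₁' a₂ a₂' h2 h2' := by
    rintro ⟨w, -, hw1, hw2⟩ ⟨w', -, hw1', hw2'⟩ j hj h22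
    have hji := e.isUnif.val_pow_le_iff.2 hj
    have := h.trace_sub_le hδ (hj.trans hiδ) (h.lt_one_of_norm_sub_le hi h2' hw2')
      (h.lt_one_of_norm_sub_le hi h2 hw2) (by
        have h3 := val_sub_le (val_add_le (hw2.trans hji) h22) (hw2'.trans hji)
        convert h3 using 2
        ring)
    have h4 := val_add_le (val_sub_le this (hw1.trans hji)) (hw1'.trans hji)
    convert h4 using 2
    ring
  stable a₁ a₁' a₂ := by
    rintro ⟨w, hw, hw1, hw2⟩ h1
    refine ⟨w, hw, ?_, hw2⟩
    have := val_sub_le hw1 h1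
    convert this using 2
    ring

/-- A lower bound for the level depends only on the quadratic extension. -/
theorem levelRel_congr (h : RamData σ e η) [CharZero K] {p p' : Eisenstein K}
    (hd : SqClassEq p.disc p'.disc) {i : ℕ} (hp : LevelRel L (e.a₂ : K) i p.a₁ p.a₂) :
    LevelRel L (e.a₂ : K) i p'.a₁ p'.a₂ := by
  obtain ⟨α, β, hα, hβ, h1, h2⟩ := Eisenstein.exists_substitution hd
  obtain ⟨w, hw, hw1, hw2⟩ := hp
  have htr : Algebra.trace K L (algebraMap K L β * w - algebraMap K L α)
      = β * Algebra.trace K L w - 2 * α := by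
    rw [map_sub, h.trace_algebraMap, ← Algebra.smul_def, map_smul, smul_eq_mul]
  have hno : Algebra.norm K (algebraMap K L β * w - algebraMap K L α)
      = β ^ 2 * Algebra.norm K w - α * β * Algebra.trace K L w + α ^ 2 := by
    apply (algebraMap K L).injective
    simp only [h.norm, h.trace, map_sub, map_add, map_mul, map_pow, AlgEquiv.commutes]
    ring
  refine ⟨algebraMap K L β * w - algebraMap K L α, ?_, ?_, ?_⟩
  · refine val_sub_le ?_ ((vL_le_one_iff _).2 hα.le)
    exact (val_mul_le ((vL_le_one_iff _).2 hβ.le) hw).trans_eq (one_mul 1)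
  · rw [htr, h1]
    have : β * Algebra.trace K L w - 2 * α - (β * p.a₁ - 2 * α)
        = β * (Algebra.trace K L w - p.a₁) := by ring
    rw [this, map_mul, hβ, one_mul]
    exact hw1
  · rw [hno, h2]
    have : β ^ 2 * Algebra.norm K w - α * β * Algebra.trace K L w + α ^ 2
        - (α ^ 2 - α * β * p.a₁ + β ^ 2 * p.a₂)
        = β ^ 2 * (Algebra.norm K w - p.a₂) - α * β * (Algebra.trace K L w - p.a₁) := by ring
    rw [this]
    refine val_sub_le ?_ ?_
    · rw [map_mul, map_pow, hβ, one_pow, one_mul]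
      exact hw2
    · rw [map_mul, map_mul, hβ, mul_one]
      exact (mul_le_of_le_one_left zero_le hα.le).trans hw1

theorem levelRel_self (h : RamData σ e η) (i : ℕ) :
    LevelRel L (e.a₂ : K) i e.a₁ e.a₂ := by
  refine ⟨-η, ?_, ?_, ?_⟩
  · rw [Valuation.map_neg]
    exact h.isUnif_eta.lt_one.le
  · have := h.trace_mk 0 (-1)
    simp at this
    simp [this]
  · simp [h.norm_neg, h.norm_eta]

end RamData

/-- A lower bound, up to `ord 2 + 1`, for the order of `a₁` depends only on the quadratic
extension. -/
theorem a₁_le_congr [CharZero K] {c : K} (hc : IsUnif c) {p p' : Eisenstein K}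
    (hd : SqClassEq p.disc p'.disc) {n : ℕ} (hn : n ≤ twoOrd K + 1)
    (hp : valuation K (p.a₁ : K) ≤ valuation K c ^ n) :
    valuation K (p'.a₁ : K) ≤ valuation K c ^ n := by
  obtain ⟨α, β, hα, hβ, h1, -⟩ := Eisenstein.exists_substitution hd
  rw [h1]
  apply val_sub_le
  · rwa [map_mul, hβ, one_mul]
  · refine le_trans ?_ (hc.val_pow_le_iff.2 hn)
    rw [map_mul, hc.val_two, pow_succ]
    gcongr
    exact hc.le_of_lt_one _ hα

namespace RamData

variable {σ : L ≃ₐ[K] L} {e : Eisenstein K} {η : L} [ValuativeExtension K L]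

theorem trace_add_le (h : RamData σ e η) [CharZero K] {s : K} (hs : valuation K s < 1) (t : K)
    {n : ℕ} (hn : n ≤ twoOrd K + 1) :
    valuation K (Algebra.trace K L (algebraMap K L s + algebraMap K L t * η) + e.a₁ * t)
      ≤ valuation K (e.a₂ : K) ^ n := by
  rw [h.trace_mk, sub_add_cancel]
  refine le_trans ?_ (e.isUnif.val_pow_le_iff.2 hn)
  rw [map_mul, e.isUnif.val_two, pow_succ]
  gcongr
  exact e.isUnif.le_of_lt_one _ hs

/-- The level is at least `i` if `i` bounds the order of `a₁` from below for both extensions: the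
traces involved then vanish modulo `𝔭 ^ i`. -/
theorem levelRel_of_le (h : RamData σ e η) [CharZero K] [CharP 𝓀[K] 2] {δ : ℕ}
    (hδ : valuation K e.disc = valuation K (e.a₂ : K) ^ δ) {i : ℕ} (hiδ : i ≤ δ)
    (hi : i ≤ e.ell) {a₁ a₂ : K} (h1 : valuation K a₁ ≤ valuation K (e.a₂ : K) ^ i)
    (h2 : valuation K a₂ < 1) : LevelRel L (e.a₂ : K) i a₁ a₂ := by
  obtain ⟨w, hw, hwa⟩ := h.exists_norm_sub_le hδ h2 i hiδ
  obtain ⟨s, t, rfl⟩ := h.span w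
  rw [h.lt_one_iff_mk] at hw
  obtain ⟨him, hie⟩ := (e.le_ell_iff e.isUnif i).1 hi
  refine ⟨_, ((h.lt_one_iff_mk s t).2 hw).le, ?_, hwa⟩
  have h3 := h.trace_add_le hw.1 t him
  have h4 : valuation K ((e.a₁ : K) * t) ≤ valuation K (e.a₂ : K) ^ i := by
    rw [map_mul]
    exact (mul_le_of_le_one_right zero_le hw.2).trans hie
  have := val_sub_le (val_sub_le h3 h4) h1
  rwa [add_sub_cancel_right] at this

/-- If the norm of `s + t η` is a uniformizer, then `t` is a unit and `s` is not. -/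
theorem coords_of_norm_isUnif (h : RamData σ e η) {s t : K}
    (hu : IsUnif (Algebra.norm K (algebraMap K L s + algebraMap K L t * η))) :
    valuation K s < 1 ∧ valuation K t = 1 := by
  have hlt := (h.lt_one_iff_mk s t).1 ((h.lt_one_iff_norm _).2 hu.lt_one)
  refine ⟨hlt.1, le_antisymm hlt.2 ?_⟩
  by_contra hlt1
  push Not at hlt1
  have hv := h.valK_norm_mk s t
  rw [hu.val_eq e.isUnif] at hv
  have : max (valuation K s ^ 2) (valuation K (e.a₂ : K) * valuation K t ^ 2)
      ≤ valuation K (e.a₂ : K) ^ 2 := by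
    apply max_le
    · exact pow_le_pow_left₀ zero_le (e.isUnif.le_of_lt_one _ hlt.1) 2
    · rw [pow_two (valuation K (e.a₂ : K))]
      gcongr
      calc valuation K t ^ 2 ≤ valuation K t ^ 1 := pow_le_pow_right_of_le_one' hlt.2 (by norm_num)
        _ = valuation K t := pow_one _
        _ ≤ _ := e.isUnif.le_of_lt_one _ hlt1
  rw [← hv] at this
  have h3 := (e.isUnif.val_pow_le_iff (m := 1) (n := 2)).1 (by simpa using this)
  omega

theorem isUnif_norm_of_sub_le (_ : RamData σ e η) {i : ℕ} (hi : 2 ≤ i) (p : Eisenstein K) {w : L}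
    (hw : valuation K (Algebra.norm K w - p.a₂) ≤ valuation K (e.a₂ : K) ^ i) :
    IsUnif (Algebra.norm K w) := by
  apply p.isUnif.of_val_eq
  have hlt : valuation K (Algebra.norm K w - p.a₂) < valuation K (p.a₂ : K) := by
    refine hw.trans_lt ?_
    rw [p.isUnif.val_eq e.isUnif]
    simpa using e.isUnif.val_pow_lt_iff.2 (show 1 < i by omega)
  have := Valuation.map_add_eq_of_lt_right (valuation K) hlt
  rwa [sub_add_cancel] at this

theorem a₁_le_iff_of_levelRel (h : RamData σ e η) [CharZero K] {i : ℕ} (hi : 2 ≤ i)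
    {p : Eisenstein K} (hp : LevelRel L (e.a₂ : K) i p.a₁ p.a₂) {n : ℕ} (hni : n ≤ i)
    (hn : n ≤ twoOrd K + 1) :
    valuation K (p.a₁ : K) ≤ valuation K (e.a₂ : K) ^ n ↔
      valuation K (e.a₁ : K) ≤ valuation K (e.a₂ : K) ^ n := by
  obtain ⟨w, hw, hw1, hw2⟩ := hp
  obtain ⟨s, t, rfl⟩ := h.span w
  obtain ⟨hs, ht⟩ := h.coords_of_norm_isUnif (h.isUnif_norm_of_sub_le hi p hw2)
  have h3 := h.trace_add_le hs t hn
  have h4 := val_sub_le h3 (hw1.trans (e.isUnif.val_pow_le_iff.2 hni))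
  have h5 : valuation K (e.a₁ : K) = valuation K (e.a₁ * t : K) := by rw [map_mul, ht, mul_one]
  rw [h5]
  constructor
  · intro h1
    have := val_sub_le h4 h1
    convert this using 2
    ring
  · intro h1
    have := val_sub_le h4 h1
    convert this using 2
    ring

/-- Level above `ℓ(e)`, or equal to it if `ℓ(e)` takes its largest value, forces `ℓ(p) = ℓ(e)`. -/
theorem ell_eq_of_levelRel (h : RamData σ e η) [CharZero K] [CharP 𝓀[K] 2] {i : ℕ}
    (hi : e.ell ≤ i) (hi' : e.ell < i ∨ e.ell = twoOrd K + 1)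
    {p : Eisenstein K} (hp : LevelRel L (e.a₂ : K) i p.a₁ p.a₂) : p.ell = e.ell := by
  have hm := one_le_twoOrd (K := K)
  have he1 := e.one_le_ell
  have hel := e.ell_le
  have key := fun n hni hn => h.a₁_le_iff_of_levelRel (by omega) hp (n := n) hni hn
  have h1 : e.ell ≤ p.ell := (p.le_ell_iff e.isUnif _).2
    ⟨hel, (key _ hi hel).2 ((e.le_ell_iff e.isUnif _).1 le_rfl).2⟩
  refine le_antisymm ?_ h1
  by_contra hlt
  push Not at hlt
  have hpl := p.ell_le
  have h2 := (p.le_ell_iff e.isUnif (e.ell + 1)).1 hlt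
  have h3 := (e.le_ell_iff e.isUnif (e.ell + 1)).2 ⟨h2.1, (key _ (by omega) h2.1).1 h2.2⟩
  omega

end RamData

end Level

/-! ### Artin–Schreier classes -/

section ArtinSchreier

set_option linter.unusedSectionVars false

variable {K : Type*} [Field K] [ValuativeRel K] [TopologicalSpace K] [IsNonarchimedeanLocalField K]

theorem exists_sq_of_residue [CharP 𝓀[K] 2] {b : 𝒪[K]}
    (h : ∃ y : 𝓀[K], y ^ 2 + y + IsLocalRing.residue 𝒪[K] b = 0) :
    ∃ y : K, 1 - 4 * (b : K) = y ^ 2 := by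
  obtain ⟨y, hy⟩ := h
  obtain ⟨y, rfl⟩ := IsLocalRing.residue_surjective y
  rw [← map_pow, ← map_add, ← map_add, IsLocalRing.residue_eq_zero_iff] at hy
  obtain ⟨z, hz⟩ := exists_artinSchreier_root ⟨y, hy⟩
  refine ⟨1 + 2 * z, ?_⟩
  have hz' : (z : K) ^ 2 + z + b = 0 := by
    have := congrArg Subtype.val hz
    simpa using this
  linear_combination (-4) * hz'

/-- The elements `1 - 4 b` with `b` integral fill at most two classes modulo squares: the classes
of `y ^ 2 + y + b` over a finite field of characteristic `2`. -/
theorem exists_mul_eq_sq [CharP 𝓀[K] 2] {b b' : K} (hb : valuation K b ≤ 1)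
    (hb' : valuation K b' ≤ 1) (h : ∀ y : K, 1 - 4 * b ≠ y ^ 2) (h' : ∀ y : K, 1 - 4 * b' ≠ y ^ 2) :
    ∃ y : K, (1 - 4 * b) * (1 - 4 * b') = y ^ 2 := by
  let f : 𝓀[K] →+ 𝓀[K] := (frobenius 𝓀[K] 2).toAddMonoidHom + AddMonoidHom.id _
  have hf : ∀ y, f y = y ^ 2 + y := fun y => rfl
  have hker : Nat.card f.ker = 2 := by
    have : (f.ker : Set 𝓀[K]) = {0, 1} := by
      ext y
      rw [SetLike.mem_coe, AddMonoidHom.mem_ker, hf, Set.mem_insert_iff, Set.mem_singleton_iff]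
      have : y ^ 2 + y = y * (y - 1) := by
        rw [CharTwo.sub_eq_add]; ring
      rw [this, mul_eq_zero, sub_eq_zero]
    rw [← SetLike.coe_sort_coe, this]
    simp
  have hindex : f.range.index = 2 := by rw [AddSubgroup.index_range, hker]
  have hmem : ∀ b : 𝒪[K], (∀ y : K, 1 - 4 * (b : K) ≠ y ^ 2) →
      IsLocalRing.residue 𝒪[K] b ∉ f.range := by
    rintro b hb ⟨y, hy⟩
    obtain ⟨z, hz⟩ := exists_sq_of_residue (b := b) ⟨y, by
      rw [← hf, hy]; exact CharTwo.add_self_eq_zero _⟩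
    exact hb z hz
  let B : 𝒪[K] := ⟨b, hb⟩
  let B' : 𝒪[K] := ⟨b', hb'⟩
  have hsum : IsLocalRing.residue 𝒪[K] B + IsLocalRing.residue 𝒪[K] B' ∈ f.range := by
    rw [AddSubgroup.add_mem_iff_of_index_two hindex]
    exact iff_of_false (hmem B h) (hmem B' h')
  obtain ⟨y, hy⟩ := hsum
  have h4 : IsLocalRing.residue 𝒪[K] (4 * B * B') = 0 := by
    have : IsLocalRing.residue 𝒪[K] 2 = 0 := by
      rw [map_ofNat]
      exact CharTwo.two_eq_zero
    have e4 : (4 : 𝒪[K]) = 2 * 2 := by norm_num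
    rw [e4, map_mul, map_mul, map_mul, this, zero_mul, zero_mul, zero_mul]
  obtain ⟨z, hz⟩ := exists_sq_of_residue (b := B + B' - 4 * B * B') ⟨y, by
    rw [← hf, hy, map_sub, h4, sub_zero, map_add]; exact CharTwo.add_self_eq_zero _⟩
  refine ⟨z, ?_⟩
  rw [← hz]
  have : ((B + B' - 4 * B * B' : 𝒪[K]) : K) = b + b' - 4 * b * b' := rfl
  rw [this]
  ring

/-- An element close to a non-zero square is a square. -/
theorem exists_sq_of_sub_lt [CharP 𝓀[K] 2] [CharZero K] {x : K}
    (h : valuation K (x - 1) < valuation K (4 : K)) : ∃ y : K, y ≠ 0 ∧ x = y ^ 2 := by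
  have h4 : (4 : K) ≠ 0 := by norm_num
  have h40 : 0 < valuation K (4 : K) := by simp [zero_lt_iff]
  have hb : valuation K ((1 - x) / 4) < 1 := by
    rw [map_div₀, Valuation.map_sub_swap]
    exact (div_lt_one₀ h40).2 h
  obtain ⟨y, hy⟩ := exists_sq_of_residue (b := ⟨(1 - x) / 4, hb.le⟩) ⟨0, by
    have : IsLocalRing.residue 𝒪[K] ⟨(1 - x) / 4, hb.le⟩ = 0 := by
      rw [IsLocalRing.residue_eq_zero_iff, mem_maximal_iff]
      exact hb
    rw [this]
    ring⟩
  have hx : x = y ^ 2 := by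
    rw [← hy]
    field_simp
    ring
  refine ⟨y, ?_, hx⟩
  rintro rfl
  rw [hx] at h
  have h2 : valuation K (4 : K) ≤ 1 := (4 : 𝒪[K]).2
  simp at h
  exact absurd h2 (not_le.2 h)

end ArtinSchreier

section Unramified

set_option linter.unusedSectionVars false

variable {K : Type*} [Field K] [ValuativeRel K] [TopologicalSpace K] [IsNonarchimedeanLocalField K]
variable {L : Type*} [Field L] [ValuativeRel L] [TopologicalSpace L]
  [IsNonarchimedeanLocalField L] [Algebra K L]

theorem one_sub_four_mul_ne_zero [CharP 𝓀[K] 2] {b : K} (hb : valuation K b ≤ 1) :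
    1 - 4 * b ≠ 0 := by
  intro h
  have h2 := val_two_lt_one (E := K)
  have h4 : valuation K (4 * b) < 1 := by
    have : (4 : K) * b = 2 * (2 * b) := by ring
    rw [this, map_mul, map_mul]
    exact mul_lt_one_of_lt_of_le h2 (mul_le_one' h2.le hb)
  rw [← sub_eq_zero.1 h, map_one] at h4
  exact lt_irrefl _ h4

namespace RamData

variable {σ : L ≃ₐ[K] L} {e : Eisenstein K} {η : L} [ValuativeExtension K L]

/-- If `p` has level at least `δ`, then modulo squares its discriminant is that of `L / K` times
some `1 - 4 b` with `b` integral. -/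
theorem sqClassEq_disc_of_levelRel (h : RamData σ e η) [CharZero K] [CharP 𝓀[K] 2] {δ : ℕ}
    (hδ : valuation K e.disc = valuation K (e.a₂ : K) ^ δ) (hδ2 : 2 ≤ δ) {p : Eisenstein K}
    (hp : LevelRel L (e.a₂ : K) δ p.a₁ p.a₂) :
    ∃ b : K, valuation K b ≤ 1 ∧ SqClassEq (e.disc * (1 - 4 * b)) p.disc := by
  obtain ⟨w, hw, hw1, hw2⟩ := hp
  have hu := h.isUnif_norm_of_sub_le hδ2 p hw2
  obtain ⟨s, t, rfl⟩ := h.span w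
  obtain ⟨hs, ht⟩ := h.coords_of_norm_isUnif hu
  have ht0 : t ≠ 0 := by
    rintro rfl
    simp at ht
  set T := Algebra.trace K L (algebraMap K L s + algebraMap K L t * η) with hT
  set N := Algebra.norm K (algebraMap K L s + algebraMap K L t * η) with hN
  have hTe : T = 2 * s - e.a₁ * t := h.trace_mk s t
  have hNe : N = s ^ 2 + (-e.a₁) * s * t + e.a₂ * t ^ 2 := h.norm_mk s t
  have hdisc : T ^ 2 - 4 * N = t ^ 2 * e.disc := by
    rw [hTe, hNe, Eisenstein.disc]
    ring
  have hDv : valuation K (t ^ 2 * e.disc) = valuation K e.disc := by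
    rw [map_mul, map_pow, ht, one_pow, one_mul]
  have hD0 : e.disc ≠ 0 := by
    intro h0
    rw [h0, map_zero] at hδ
    exact (e.isUnif.val_pow_pos δ).ne hδ
  obtain ⟨ε₁, h1⟩ : ∃ ε : K, ε = T - p.a₁ := ⟨_, rfl⟩
  obtain ⟨ε₂, h2⟩ : ∃ ε : K, ε = N - p.a₂ := ⟨_, rfl⟩
  rw [← h1, ← hδ] at hw1
  rw [← h2, ← hδ] at hw2
  have hDle : valuation K e.disc ≤ 1 := hδ ▸ pow_le_one' e.isUnif.lt_one.le δ
  clear_value T N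
  have hp : p.disc = (T - ε₁) ^ 2 - 4 * (N - ε₂) := by rw [h1, h2, Eisenstein.disc]; ring
  have hneg : IsUnif (-N) := hu.of_val_eq (Valuation.map_neg _ _)
  have hmax := hneg.valuation_form (A := 0) (by simp) T 2
  have hTN : T ^ 2 + 0 * T * 2 + -N * 2 ^ 2 = t ^ 2 * e.disc := by rw [← hdisc]; ring
  rw [hTN, hDv, Valuation.map_neg, ← map_pow (valuation K) T, ← map_pow (valuation K) 2,
    ← map_mul (valuation K)] at hmax
  have hT2 : valuation K (T ^ 2) ≤ valuation K e.disc := hmax ▸ le_max_left _ _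
  have hN4 : valuation K (N * 2 ^ 2) ≤ valuation K e.disc := hmax ▸ le_max_right _ _
  have hsq : ∀ {x y : K}, valuation K (x ^ 2) ≤ valuation K (y ^ 2) →
      valuation K x ≤ valuation K y := by
    intro x y hxy
    rw [map_pow, map_pow] at hxy
    exact (pow_le_pow_iff_left₀ zero_le zero_le two_ne_zero).1 hxy
  have hN1 : valuation K N ≤ 1 := hu.lt_one.le
  rcases max_choice (valuation K (T ^ 2)) (valuation K (N * 2 ^ 2)) with hc | hc
  · -- the trace dominates: rescale the root so that the traces agree
    rw [hc] at hmax
    have hT0 : T ≠ 0 := by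
      rintro h0
      rw [h0] at hmax
      simp at hmax
      exact hD0 hmax
    have hTpos : 0 < valuation K (T ^ 2) := by simpa [zero_lt_iff] using hT0
    have hρ : valuation K ((ε₁ / T) ^ 2) ≤ valuation K e.disc := by
      rw [div_pow, map_div₀, div_le_iff₀ hTpos, ← hmax, pow_two, map_mul]
      exact mul_le_mul' hw1 hw1
    have hDlt : valuation K e.disc < 1 := by
      rw [hδ]
      exact pow_lt_one₀ zero_le e.isUnif.lt_one (by omega)
    have hρ1 : valuation K (ε₁ / T) < 1 := by
      rw [← pow_lt_one_iff_of_nonneg zero_le two_ne_zero, ← map_pow]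
      exact hρ.trans_lt hDlt
    set ρ := ε₁ / T with hρdef
    have hερ : ε₁ = ρ * T := by rw [hρdef]; field_simp
    have hβ : valuation K (1 - ρ) = 1 := by
      apply val_eq_one_of_sub
      rw [sub_sub_cancel_left, Valuation.map_neg]
      exact hρ1
    have hβ0 : 1 - ρ ≠ 0 := by
      intro h0
      rw [h0, map_zero] at hβ
      exact zero_ne_one hβ
    refine ⟨(-ε₂ - N * (ρ ^ 2 - 2 * ρ)) / ((1 - ρ) ^ 2 * (t ^ 2 * e.disc)), ?_,
      t * (1 - ρ), mul_ne_zero ht0 hβ0, ?_⟩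
    · rw [map_div₀, map_mul, hDv, map_pow, hβ, one_pow, one_mul]
      refine (div_le_one₀ (by simpa [zero_lt_iff] using hD0)).2 ?_
      refine val_sub_le (by rwa [Valuation.map_neg]) ?_
      rw [mul_sub]
      refine val_sub_le ?_ ?_
      · rw [map_mul]
        exact (mul_le_of_le_one_left zero_le hN1).trans hρ
      · apply hsq
        have : (N * (2 * ρ)) ^ 2 = N * ((N * 2 ^ 2) * ρ ^ 2) := by ring
        rw [this, map_mul, map_mul (valuation K) (N * 2 ^ 2), pow_two e.disc,
          map_mul (valuation K) e.disc]
        exact (mul_le_of_le_one_left zero_le hN1).trans (mul_le_mul' hN4 hρ)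
    · rw [hp, hερ]
      field_simp
      linear_combination ((1 - ρ) ^ 2) * hdisc
  · -- otherwise `4 N` dominates
    rw [hc] at hmax
    have h40 : (4 : K) ≠ 0 := by norm_num
    have h4D : valuation K (4 * (t ^ 2 * e.disc)) = valuation K (2 ^ 2 * e.disc) := by
      rw [map_mul, hDv, map_mul]
      norm_num
    have hD4 : valuation K e.disc ≤ valuation K ((2 : K) ^ 2) := by
      rw [hmax, map_mul]
      exact mul_le_of_le_one_left zero_le hN1
    refine ⟨(2 * T * ε₁ - ε₁ ^ 2 - 4 * ε₂) / (4 * (t ^ 2 * e.disc)), ?_, t, ht0, ?_⟩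
    · rw [map_div₀, h4D]
      refine (div_le_one₀ (by simpa [zero_lt_iff] using hD0)).2 ?_
      refine val_sub_le (val_sub_le ?_ ?_) ?_
      · apply hsq
        have e1 : (2 * T * ε₁) ^ 2 = 2 ^ 2 * (T ^ 2 * ε₁ ^ 2) := by ring
        have e2 : (2 ^ 2 * e.disc) ^ 2 = 2 ^ 2 * (2 ^ 2 * e.disc ^ 2) := by ring
        rw [e1, e2, map_mul, map_mul, map_mul (valuation K) (2 ^ 2), map_mul (valuation K) (2 ^ 2)]
        refine mul_le_mul' le_rfl (mul_le_mul' (hT2.trans hD4) ?_)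
        rw [map_pow, map_pow]
        exact pow_le_pow_left₀ zero_le hw1 2
      · rw [pow_two ε₁, map_mul, map_mul]
        exact mul_le_mul' (hw1.trans hD4) hw1
      · have : (4 : K) = 2 ^ 2 := by norm_num
        rw [this, map_mul, map_mul]
        exact mul_le_mul' le_rfl hw2
    · rw [hp]
      field_simp
      linear_combination hdisc

/-- Besides `L` itself, at most one quadratic extension has level at least `δ`. -/
theorem sqClassEq_of_levelRel (h : RamData σ e η) [CharZero K] [CharP 𝓀[K] 2] {δ : ℕ}
    (hδ : valuation K e.disc = valuation K (e.a₂ : K) ^ δ) (hδ2 : 2 ≤ δ) {p p' : Eisenstein K}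
    (hp : LevelRel L (e.a₂ : K) δ p.a₁ p.a₂) (hp' : LevelRel L (e.a₂ : K) δ p'.a₁ p'.a₂)
    (hne : ¬ SqClassEq e.disc p.disc) (hne' : ¬ SqClassEq e.disc p'.disc) :
    SqClassEq p.disc p'.disc := by
  obtain ⟨b, hb, hpb⟩ := h.sqClassEq_disc_of_levelRel hδ hδ2 hp
  obtain ⟨b', hb', hpb'⟩ := h.sqClassEq_disc_of_levelRel hδ hδ2 hp'
  have hnsq : ∀ {b : K} {q : Eisenstein K}, valuation K b ≤ 1 →
      SqClassEq (e.disc * (1 - 4 * b)) q.disc → ¬ SqClassEq e.disc q.disc →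
      ∀ y : K, 1 - 4 * b ≠ y ^ 2 := by
    intro b q hb hq hn y hy
    refine hn (SqClassEq.trans ⟨y, ?_, by rw [hy, mul_comm]⟩ hq)
    rintro rfl
    exact one_sub_four_mul_ne_zero hb (by rw [hy]; ring)
  obtain ⟨y, hy⟩ := exists_mul_eq_sq hb hb' (hnsq hb hpb hne) (hnsq hb' hpb' hne')
  have h0 := one_sub_four_mul_ne_zero hb
  have h0' := one_sub_four_mul_ne_zero hb'
  refine hpb.symm.trans (SqClassEq.trans ⟨y / (1 - 4 * b), div_ne_zero ?_ h0, ?_⟩ hpb')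
  · rintro rfl
    rw [zero_pow two_ne_zero] at hy
    exact mul_ne_zero h0 h0' hy
  · rw [div_pow, ← hy]
    field_simp

end RamData

/-! ### Eisenstein extensions are ramified -/

/-- The algebra generated over the integers by the root of an Eisenstein polynomial is not
unramified: it maps to the dual numbers over the residue field in more than one way. -/
theorem not_formallyUnramified_of_root {A C : L} (hC : IsUnif C)
    (hA : valuation L A ≤ valuation L C) {E : Type*} [Field E] [Algebra L E] [Algebra 𝒪[L] E]
    [IsScalarTower 𝒪[L] L E] {φ : E} (hφ : φ ^ 2 + algebraMap L E A * φ + algebraMap L E C = 0)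
    (hspan : ∀ w : E, ∃ s t : L, w = algebraMap L E s + algebraMap L E t * φ) :
    ¬ Algebra.FormallyUnramified 𝒪[L] (integralClosure 𝒪[L] E) := by
  intro hunr
  have hne : ∀ z : L, algebraMap L E z ≠ φ := by
    rintro z rfl
    apply hC.form_ne_zero hA z
    apply (algebraMap L E).injective
    simpa using hφ
  have hinj : ∀ {s t s' t' : L}, algebraMap L E s + algebraMap L E t * φ
      = algebraMap L E s' + algebraMap L E t' * φ → s = s' ∧ t = t' := by
    intro s t s' t' hst
    have ht : t = t' := by
      by_contra ht
      apply hne ((s' - s) / (t - t'))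
      have : algebraMap L E (t - t') ≠ 0 := by simpa [sub_eq_zero] using ht
      rw [map_div₀, div_eq_iff this, map_sub, map_sub]
      linear_combination -hst
    subst ht
    exact ⟨by simpa using hst, rfl⟩
  have hAl : valuation L A < 1 := hA.trans_lt hC.lt_one
  -- the coordinates of an integral element are integral, by looking at its minimal polynomial
  have hint : ∀ b : integralClosure 𝒪[L] E, ∃ s t : 𝒪[L],
      (b : E) = algebraMap 𝒪[L] E s + algebraMap 𝒪[L] E t * φ := by
    rintro ⟨w, hw⟩
    have hwi : IsIntegral 𝒪[L] w := hw
    obtain ⟨s, t, rfl⟩ := hspan w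
    suffices valuation L s ≤ 1 ∧ valuation L t ≤ 1 by
      refine ⟨⟨s, this.1⟩, ⟨t, this.2⟩, ?_⟩
      rw [IsScalarTower.algebraMap_apply 𝒪[L] L E, IsScalarTower.algebraMap_apply 𝒪[L] L E]
      rfl
    by_cases ht : t = 0
    · subst ht
      simp only [map_zero, zero_mul, add_zero] at hwi
      rw [isIntegral_algebraMap_iff (algebraMap L E).injective] at hwi
      obtain ⟨y, hy⟩ := IsIntegrallyClosed.isIntegral_iff.1 hwi
      refine ⟨?_, by simp⟩
      rw [← hy]
      exact y.2
    · have hLint : IsIntegral L (algebraMap L E s + algebraMap L E t * φ) := hwi.tower_top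
      let q : L[X] := X ^ 2 + Polynomial.C (A * t - 2 * s) * X
        + Polynomial.C (s ^ 2 + -A * s * t + C * t ^ 2)
      have hq : q.Monic := by simp only [q]; monicity!
      have hqd : q.natDegree = 2 := by simp only [q]; compute_degree!
      have hq0 : aeval (algebraMap L E s + algebraMap L E t * φ) q = 0 := by
        simp only [q, map_add, map_mul, map_pow, aeval_X, aeval_C, map_sub, map_neg, map_ofNat]
        linear_combination (algebraMap L E t) ^ 2 * hφ
      have hmin : q = minpoly L (algebraMap L E s + algebraMap L E t * φ) := by
        refine (Polynomial.eq_of_monic_of_dvd_of_natDegree_le (minpoly.monic hLint) hq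
          (minpoly.dvd _ _ hq0) ?_)
        rw [hqd, minpoly.two_le_natDegree_iff hLint]
        rintro ⟨z, hz⟩
        apply ht
        exact (hinj (s := z) (t := 0) (by simpa using hz)).2.symm
      have hco := congrArg (fun f => coeff f 0) hmin
      rw [minpoly.isIntegrallyClosed_eq_field_fractions' L hwi] at hco
      simp only [q, coeff_map] at hco
      have h1 : valuation L (s ^ 2 + -A * s * t + C * t ^ 2) ≤ 1 := by
        have : (s ^ 2 + -A * s * t + C * t ^ 2) = algebraMap 𝒪[L] L
            ((minpoly 𝒪[L] (algebraMap L E s + algebraMap L E t * φ)).coeff 0) := by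
          rw [← hco]
          simp only [coeff_add, coeff_X_pow, coeff_C_mul, coeff_X_zero, coeff_C_zero, mul_zero,
            zero_add, OfNat.zero_ne_ofNat, ↓reduceIte, add_zero]
        rw [this]
        exact ((minpoly 𝒪[L] (algebraMap L E s + algebraMap L E t * φ)).coeff 0).2
      rw [hC.valuation_form (by rwa [Valuation.map_neg]), max_le_iff] at h1
      refine ⟨(pow_le_one_iff_of_nonneg zero_le two_ne_zero).1 h1.1, ?_⟩
      have := hC.le_pow_of_sq_mul_le (x := t) (j := 0) (by simpa [mul_comm] using h1.2)
      simpa using this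
  choose S T hST using hint
  have hinj' : ∀ {s t s' t' : 𝒪[L]}, algebraMap 𝒪[L] E s + algebraMap 𝒪[L] E t * φ
      = algebraMap 𝒪[L] E s' + algebraMap 𝒪[L] E t' * φ → s = s' ∧ t = t' := by
    intro s t s' t' hst
    simp only [IsScalarTower.algebraMap_apply 𝒪[L] L E] at hst
    obtain ⟨h1, h2⟩ := hinj hst
    exact ⟨Subtype.ext h1, Subtype.ext h2⟩
  let A' : 𝒪[L] := ⟨A, hAl.le⟩
  let C' : 𝒪[L] := ⟨C, hC.lt_one.le⟩
  have hA' : IsLocalRing.residue 𝒪[L] A' = 0 := by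
    rw [IsLocalRing.residue_eq_zero_iff, mem_maximal_iff]; exact hAl
  have hC' : IsLocalRing.residue 𝒪[L] C' = 0 := by
    rw [IsLocalRing.residue_eq_zero_iff, mem_maximal_iff]; exact hC.lt_one
  have hφ' : φ ^ 2 + algebraMap 𝒪[L] E A' * φ + algebraMap 𝒪[L] E C' = 0 := by
    rw [IsScalarTower.algebraMap_apply 𝒪[L] L E, IsScalarTower.algebraMap_apply 𝒪[L] L E]
    exact hφ
  have hone : S 1 = 1 ∧ T 1 = 0 := hinj' (by rw [← hST]; simp)
  have hzero : S 0 = 0 ∧ T 0 = 0 := hinj' (by rw [← hST]; simp)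
  have hadd : ∀ a b, S (a + b) = S a + S b ∧ T (a + b) = T a + T b := fun a b => hinj' (by
    rw [← hST, Subalgebra.coe_add, hST a, hST b]; simp only [map_add]; ring)
  have hmul : ∀ a b, S (a * b) = S a * S b - T a * T b * C' ∧
      T (a * b) = S a * T b + T a * S b - T a * T b * A' := fun a b => hinj' (by
    rw [← hST, Subalgebra.coe_mul, hST a, hST b]
    simp only [map_add, map_sub, map_mul]
    linear_combination (algebraMap 𝒪[L] E (T a) * algebraMap 𝒪[L] E (T b)) * hφ')
  have halg : ∀ r : 𝒪[L], S (algebraMap 𝒪[L] _ r) = r ∧ T (algebraMap 𝒪[L] _ r) = 0 :=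
    fun r => hinj' (by rw [← hST]; simp)
  -- the maps `s + t φ ↦ s + x t ε` to the dual numbers over the residue field are homomorphisms,
  -- since `φ ^ 2` vanishes in that field; they agree modulo `ε` but not at `φ`
  let f : 𝓀[L] → (integralClosure 𝒪[L] E →ₐ[𝒪[L]] DualNumber 𝓀[L]) := fun x =>
    { toFun := fun b => TrivSqZeroExt.inl (IsLocalRing.residue 𝒪[L] (S b))
        + TrivSqZeroExt.inr (x * IsLocalRing.residue 𝒪[L] (T b))
      map_one' := by simp [hone.1, hone.2]
      map_zero' := by simp [hzero.1, hzero.2]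
      map_add' := fun a b => by
        rw [(hadd a b).1, (hadd a b).2, map_add, map_add, mul_add, TrivSqZeroExt.inl_add,
          TrivSqZeroExt.inr_add]
        abel
      map_mul' := fun a b => by
        rw [(hmul a b).1, (hmul a b).2]
        ext
        · simp [hC']
        · simp [hA']
          ring
      commutes' := fun r => by
        rw [(halg r).1, (halg r).2]
        ext
        · simp [TrivSqZeroExt.algebraMap_eq_inl', IsLocalRing.ResidueField.algebraMap_eq]
        · simp [TrivSqZeroExt.algebraMap_eq_inl'] }
  have hf : f 0 = f 1 := by
    refine Algebra.FormallyUnramified.ext' (TrivSqZeroExt.fstHom 𝓀[L] 𝓀[L] 𝓀[L]).toRingHom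
      ⟨2, ?_⟩ _ _ (fun b => by simp [f])
    rw [pow_two, Ideal.zero_eq_bot, eq_bot_iff, Ideal.mul_le]
    intro a ha b hb
    have ha' : a.fst = 0 := ha
    have hb' : b.fst = 0 := hb
    rw [Ideal.mem_bot]
    ext <;> simp [ha', hb']
  have hφint : IsIntegral 𝒪[L] φ := by
    refine ⟨X ^ 2 + Polynomial.C A' * X + Polynomial.C C', by monicity!, ?_⟩
    simpa using hφ'
  have hφST : S ⟨φ, hφint⟩ = 0 ∧ T ⟨φ, hφint⟩ = 1 := hinj' (by rw [← hST]; simp)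
  have := congrArg TrivSqZeroExt.snd (DFunLike.congr_fun hf ⟨φ, hφint⟩)
  simp [f, hφST.2] at this

namespace RamData

variable {σ : L ≃ₐ[K] L} {e : Eisenstein K} {η : L} [ValuativeExtension K L]

/-- If the level is below `δ`, then the compositum with `L` is generated by the root of an
Eisenstein polynomial over `L`; so an unramified compositum forces level at least `δ`. -/
theorem levelRel_of_formallyUnramified (h : RamData σ e η) [CharZero K] [CharP 𝓀[K] 2] {δ : ℕ}
    (hδ : valuation K e.disc = valuation K (e.a₂ : K) ^ δ) (hδ2 : 2 ≤ δ) (p : Eisenstein K)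
    (hunr : Algebra.FormallyUnramified 𝒪[L]
      (integralClosure 𝒪[L] (p.poly.map (algebraMap K L)).SplittingField)) :
    LevelRel L (e.a₂ : K) δ p.a₁ p.a₂ := by
  by_contra hlev
  obtain ⟨w, hw, hwa⟩ := h.exists_norm_sub_le hδ p.isUnif.lt_one δ le_rfl
  have hu := h.isUnif_norm_of_sub_le hδ2 p hwa
  have hε : ¬ valuation K (Algebra.trace K L w - p.a₁) ≤ valuation K (e.a₂ : K) ^ δ :=
    fun h1 => hlev ⟨w, hw.le, h1, hwa⟩
  have hε1 : valuation K (p.a₁ - Algebra.trace K L w) < 1 :=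
    Valuation.map_sub_lt _ (p.val_a₁ p.isUnif |>.trans_lt p.isUnif.lt_one) (h.trace_lt_one hw)
  have hε0 : (p.a₁ : K) - Algebra.trace K L w ≠ 0 := by
    intro h0
    apply hε
    rw [Valuation.map_sub_swap, h0, map_zero]
    exact zero_le
  obtain ⟨i, hi⟩ := e.isUnif.exists_eq_pow hε0 hε1.le
  have hi1 : 1 ≤ i := by
    by_contra h0
    have : i = 0 := by omega
    rw [this, pow_zero] at hi
    exact hε1.ne hi
  have hiδ : i < δ := by
    by_contra h0
    push Not at h0
    apply hε
    rw [Valuation.map_sub_swap, hi]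
    exact e.isUnif.val_pow_le_iff.2 h0
  -- `w` is a uniformizer of `L`
  have hc : valuation L w ^ 2 = valuation L (algebraMap K L e.a₂) := by
    rw [h.val_sq, vL_eq_iff]
    exact hu.val_eq e.isUnif
  have hwη : valuation L w = valuation L η := by
    rw [← pow_left_inj₀ zero_le zero_le two_ne_zero, hc, h.val_eta_sq]
  have hwu : IsUnif w := h.isUnif_eta.of_val_eq hwη
  have hw0 : w ≠ 0 := hwu.ne_zero
  have hcpow : ∀ n : ℕ, valuation L (algebraMap K L e.a₂) ^ n = valuation L w ^ (2 * n) := by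
    intro n
    rw [← hc, ← pow_mul]
  set ε₁ : K := p.a₁ - Algebra.trace K L w with hε₁
  set ε₂ : K := p.a₂ - Algebra.norm K w with hε₂
  have hvε₁ : valuation L (algebraMap K L ε₁) = valuation L w ^ (2 * i) := by
    rw [← hcpow, ← map_pow, ← map_pow, vL_eq_iff, map_pow, hi]
  have hvε₂ : valuation L (algebraMap K L ε₂) ≤ valuation L w ^ (2 * δ) := by
    rw [← hcpow, vL_le_pow_iff, hε₂, Valuation.map_sub_swap]
    exact hwa
  have hdiff : valuation L (σ w - w) = valuation L w ^ δ := by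
    obtain ⟨s, t, hst⟩ := h.span w
    have hu' := hu
    rw [hst] at hu'
    obtain ⟨-, ht⟩ := h.coords_of_norm_isUnif hu'
    have hd : (σ w - w) ^ 2 = algebraMap K L (t ^ 2 * e.disc) := by
      rw [hst, Eisenstein.disc]
      simp only [map_add, map_mul, map_sub, map_pow, AlgEquiv.commutes, h.conj, map_ofNat]
      linear_combination (4 * algebraMap K L t ^ 2) * h.root
    rw [← pow_left_inj₀ zero_le zero_le two_ne_zero, ← map_pow, hd, ← pow_mul, mul_comm δ 2,
      ← hcpow, ← map_pow, ← map_pow, vL_eq_iff, map_mul, map_pow, ht, one_pow, one_mul, hδ, map_pow]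
  -- for a root `θ` of `p`, the polynomial `X ^ 2 + A X + C` has the root `(θ + w) / w ^ i`
  set A : L := ((σ w - w) + algebraMap K L ε₁) / w ^ i with hAdef
  set C : L := (algebraMap K L ε₂ - algebraMap K L ε₁ * w) / w ^ (2 * i) with hCdef
  have hCv : valuation L C = valuation L w := by
    have : valuation L (algebraMap K L ε₂ - algebraMap K L ε₁ * w)
        = valuation L w ^ (2 * i + 1) := by
      rw [Valuation.map_sub_eq_of_lt_right]
      · rw [map_mul, hvε₁, pow_succ]
      · rw [map_mul, hvε₁, ← pow_succ]
        exact hvε₂.trans_lt (hwu.val_pow_lt_iff.2 (by omega))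
    rw [hCdef, map_div₀, this, map_pow, pow_succ', mul_div_assoc,
      div_self (hwu.val_pow_pos _).ne', mul_one]
  have hCu : IsUnif C := hwu.of_val_eq hCv
  have hA : valuation L A ≤ valuation L C := by
    rw [hCv, hAdef, map_div₀, map_pow, div_le_iff₀ (hwu.val_pow_pos i), ← pow_succ']
    refine val_add_le ?_ ?_
    · rw [hdiff]
      exact hwu.val_pow_le_iff.2 (by omega)
    · rw [hvε₁]
      exact hwu.val_pow_le_iff.2 (by omega)
  have hmap : p.poly.map (algebraMap K L)
      = X ^ 2 + Polynomial.C (algebraMap K L p.a₁) * X + Polynomial.C (algebraMap K L p.a₂) := by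
    simp [Eisenstein.poly]
  obtain ⟨θ, hθ, hspan⟩ := (isSplittingField_quadratic_iff (algebraMap K L p.a₁)
    (algebraMap K L p.a₂) (E := (p.poly.map (algebraMap K L)).SplittingField)).1 (by
      rw [← hmap]
      exact Polynomial.IsSplittingField.splittingField _)
  have htr := h.trace w
  have hno := h.norm w
  have h1 : algebraMap K L p.a₁ = algebraMap K L ε₁ + (w + σ w) := by
    rw [hε₁, map_sub, htr]; ring
  have h2 : algebraMap K L p.a₂ = algebraMap K L ε₂ + w * σ w := by
    rw [hε₂, map_sub, hno]; ring
  have hwE : algebraMap L (p.poly.map (algebraMap K L)).SplittingField w ≠ 0 := by simpa using hw0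
  refine not_formallyUnramified_of_root hCu hA
    (φ := (θ + algebraMap L _ w) / algebraMap L _ w ^ i) ?_ (fun z => ?_) hunr
  · rw [hAdef, hCdef]
    rw [h1, h2] at hθ
    simp only [map_add, map_sub, map_mul, map_div₀, map_pow] at hθ ⊢
    rw [mul_comm 2 i, pow_mul]
    field_simp
    linear_combination hθ
  · obtain ⟨s, t, rfl⟩ := hspan z
    refine ⟨s - t * w, t * w ^ i, ?_⟩
    simp only [map_sub, map_mul, map_pow]
    field_simp
    ring

end RamData

end Unramified

/-! ### The discriminant of `L / K` -/

section Discriminant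

set_option linter.unusedSectionVars false

variable {K : Type*} [Field K] [ValuativeRel K] [TopologicalSpace K] [IsNonarchimedeanLocalField K]
variable {L : Type*} [Field L] [ValuativeRel L] [TopologicalSpace L]
  [IsNonarchimedeanLocalField L] [Algebra K L]

namespace RamData

variable {σ : L ≃ₐ[K] L} {e : Eisenstein K} {η : L} [ValuativeExtension K L]

theorem discr_mk (h : RamData σ e η) {n : ℕ} (hn : n = 2) (b : Fin n → L) (s t : Fin n → K)
    (hb : ∀ i, b i = algebraMap K L (s i) + algebraMap K L (t i) * η) :
    Algebra.discr K b = (s ⟨0, by omega⟩ * t ⟨1, by omega⟩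
      - s ⟨1, by omega⟩ * t ⟨0, by omega⟩) ^ 2 * e.disc := by
  subst hn
  have hmul : ∀ i j, Algebra.trace K L (b i * b j)
      = 2 * (s i * s j - t i * t j * e.a₂) - e.a₁ * (s i * t j + t i * s j - t i * t j * e.a₁) := by
    intro i j
    rw [← h.trace_mk, hb i, hb j]
    congr 1
    simp only [map_sub, map_mul, map_add]
    linear_combination algebraMap K L (t i) * algebraMap K L (t j) * h.root
  rw [Algebra.discr_def, Matrix.det_fin_two]
  simp only [Algebra.traceMatrix_apply, Algebra.traceForm_apply, hmul, Eisenstein.disc, Fin.mk_zero,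
    Fin.mk_one]
  ring

theorem val_disc_of_relDiscr (h : RamData σ e η) (hquad : Module.finrank K L = 2) {δ : ℕ}
    (hδ : relDiscr K L = 𝓂[K] ^ δ) :
    valuation K e.disc = valuation K (e.a₂ : K) ^ δ := by
  have hc := e.isUnif
  apply le_antisymm
  · have hd : valuation K e.disc ≤ 1 := by
      rw [Eisenstein.disc]
      refine val_sub_le ?_ ?_
      · rw [map_pow]; exact pow_le_one' e.a₁.2 2
      · rw [map_mul]; exact mul_le_one' (4 : 𝒪[K]).2 e.a₂.2
    have hmem : (⟨e.disc, hd⟩ : 𝒪[K]) ∈ relDiscr K L := by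
      refine Ideal.subset_span ⟨fun i => if i.val = 0 then 1 else ⟨η, h.isUnif_eta.lt_one.le⟩, ?_⟩
      rw [h.discr_mk hquad _ (fun i => if i.val = 0 then 1 else 0)
        (fun i => if i.val = 0 then 0 else 1)]
      · simp
      · intro i
        by_cases hi : i.val = 0 <;> simp [hi]
    rw [hδ, hc.mem_maximal_pow] at hmem
    exact hmem
  · have hmem : (⟨(e.a₂ : K) ^ δ, by
        have := pow_le_one' hc.lt_one.le δ
        rwa [← map_pow] at this⟩ : 𝒪[K]) ∈ relDiscr K L := by
      rw [hδ, hc.mem_maximal_pow, map_pow]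
    rw [← map_pow]
    refine Submodule.span_induction (p := fun (x : 𝒪[K]) _ =>
      valuation K (x : K) ≤ valuation K e.disc) ?_ (by simp) ?_ ?_ hmem
    · rintro x ⟨b, hb⟩
      choose s t hst using fun i => h.span (b i : L)
      rw [hb, h.discr_mk hquad _ s t hst, map_mul, map_pow]
      have hi : ∀ i, valuation K (s i) ≤ 1 ∧ valuation K (t i) ≤ 1 := fun i =>
        (h.le_one_iff_mk _ _).1 (hst i ▸ (b i).2)
      refine mul_le_of_le_one_left zero_le (pow_le_one' (val_sub_le ?_ ?_) 2)
      all_goals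
        rw [map_mul]
        exact mul_le_one' (hi _).1 (hi _).2
    · intro x y _ _ hx hy
      exact val_add_le hx hy
    · intro a x _ hx
      change valuation K ((a : K) * x) ≤ _
      rw [map_mul]
      exact (mul_le_of_le_one_left zero_le a.2).trans hx

end RamData

end Discriminant

/-! ### Continuity -/

section Continuity

set_option linter.unusedSectionVars false

variable {E : Type*} [Field E] [ValuativeRel E] [TopologicalSpace E] [IsNonarchimedeanLocalField E]

theorem exists_isUnif : ∃ c : E, IsUnif c := by
  obtain ⟨ϖ, hϖ⟩ := IsDiscreteValuationRing.exists_irreducible 𝒪[E]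
  refine ⟨ϖ, isUnif_of_mem ?_ ?_⟩
  · rw [hϖ.maximalIdeal_eq]
    exact Ideal.mem_span_singleton_self _
  · rw [hϖ.maximalIdeal_eq, Ideal.span_singleton_pow, Ideal.mem_span_singleton]
    intro hd
    have := (pow_dvd_pow_iff hϖ.ne_zero hϖ.not_isUnit (n := 2) (m := 1)).1 (by rwa [pow_one])
    omega

theorem hasBasis_nhds_zero_pow {c : E} (hc0 : c ≠ 0) (hc1 : valuation E c < 1) :
    (nhds (0 : E)).HasBasis (fun _ : ℕ => True)
      (fun n => {x | valuation E x < valuation E c ^ n}) := by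
  obtain ⟨ϖ, hϖ⟩ := exists_isUnif (E := E)
  refine (IsValuativeTopology.hasBasis_nhds_zero' E).to_hasBasis (fun γ hγ => ?_)
    (fun n _ => ⟨valuation E c ^ n, ?_, subset_rfl⟩)
  · obtain ⟨x, rfl⟩ := ValuativeRel.valuation_surjective γ
    have hx : x ≠ 0 := (Valuation.ne_zero_iff _).1 hγ
    rcases le_total (valuation E x) 1 with h1 | h1
    · obtain ⟨n, hn⟩ := hϖ.exists_eq_pow hx h1
      refine ⟨n, trivial, fun y hy => ?_⟩
      have h2 := pow_le_pow_left₀ zero_le (hϖ.le_of_lt_one c hc1) n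
      rw [← hn] at h2
      exact lt_of_lt_of_le hy h2
    · exact ⟨0, trivial, fun y hy => lt_of_lt_of_le (by simpa using hy) h1⟩
  · exact pow_ne_zero _ ((Valuation.ne_zero_iff _).2 hc0)

theorem isOpen_val_lt {r : ValueGroupWithZero E} (hr : r ≠ 0) (a : E) :
    IsOpen {x : E | valuation E (x - a) < r} := by
  have h : IsOpen ((valuation E).ltAddSubgroup (Units.mk0 r hr) : Set E) :=
    AddSubgroup.isOpen_of_mem_nhds _ (g := 0)
      ((IsValuativeTopology.hasBasis_nhds_zero' E).mem_iff.2 ⟨r, hr, fun x hx => hx⟩)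
  exact h.preimage (continuous_id.sub continuous_const)

theorem isOpen_val_le {c : E} (hc : IsUnif c) (n : ℕ) (a : E) :
    IsOpen {x : E | valuation E (x - a) ≤ valuation E c ^ n} := by
  rw [isOpen_iff_mem_nhds]
  intro x hx
  filter_upwards [(isOpen_val_lt (hc.val_pow_pos n).ne' x).mem_nhds (by
    simpa using hc.val_pow_pos n)] with y hy
  have := val_add_le (le_of_lt hy) hx
  rwa [sub_add_sub_cancel] at this

end Continuity

section ContinuityExt

set_option linter.unusedSectionVars false

variable {K : Type*} [Field K] [ValuativeRel K] [TopologicalSpace K] [IsNonarchimedeanLocalField K]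
variable {L : Type*} [Field L] [ValuativeRel L] [TopologicalSpace L]
  [IsNonarchimedeanLocalField L] [Algebra K L] [ValuativeExtension K L]

theorem isInducing_algebraMap : Topology.IsInducing (algebraMap K L) := by
  obtain ⟨c, hc⟩ := exists_isUnif (E := K)
  rw [IsTopologicalAddGroup.isInducing_iff_nhds_zero]
  have hL := hasBasis_nhds_zero_pow (E := L) (c := algebraMap K L c) (by simpa using hc.ne_zero)
    ((vL_lt_one_iff c).2 hc.lt_one)
  refine (hasBasis_nhds_zero_pow hc.ne_zero hc.lt_one).eq_of_same_basis ?_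
  convert hL.comap (algebraMap K L) using 2 with n
  ext x
  simp only [Set.mem_ofPred_eq, Set.mem_preimage]
  rw [← map_pow, ← map_pow, ← map_pow, vL_lt_iff]

namespace RamData

variable {σ : L ≃ₐ[K] L} {e : Eisenstein K} {η : L}

theorem continuous_conj (h : RamData σ e η) : Continuous σ := by
  refine continuous_of_continuousAt_zero σ ?_
  rw [ContinuousAt, map_zero, (IsValuativeTopology.hasBasis_nhds_zero' L).tendsto_iff
    (IsValuativeTopology.hasBasis_nhds_zero' L)]
  exact fun γ hγ => ⟨γ, hγ, fun x hx => by simpa [h.val_conj] using hx⟩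

theorem continuous_norm (h : RamData σ e η) : Continuous (Algebra.norm K : L → K) := by
  rw [(isInducing_algebraMap (K := K) (L := L)).continuous_iff]
  simp only [Function.comp_def, h.norm]
  exact continuous_id.mul h.continuous_conj

theorem continuous_trace (h : RamData σ e η) : Continuous (Algebra.trace K L) := by
  rw [(isInducing_algebraMap (K := K) (L := L)).continuous_iff]
  simp only [Function.comp_def, h.trace]
  exact continuous_id.add h.continuous_conj

theorem continuous_negDet (h : RamData σ e η) : Continuous (negDet : K × L × K → K) := by
  have := h.continuous_norm
  unfold negDet
  fun_prop

theorem continuous_midCoeff (h : RamData σ e η) : Continuous (midCoeff σ : HermPair K L → K) := by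
  have := h.continuous_trace
  have := h.continuous_conj
  unfold midCoeff
  fun_prop

theorem continuous_formDisc (h : RamData σ e η) : Continuous (formDisc σ : HermPair K L → K) := by
  have := h.continuous_midCoeff
  have := h.continuous_negDet
  unfold formDisc
  fun_prop

theorem continuous_pairAct (h : RamData σ e η) (g : Matrix (Fin 2) (Fin 2) L)
    (k : Matrix (Fin 2) (Fin 2) K) : Continuous (pairAct σ g k : HermPair K L → HermPair K L) := by
  have := h.continuous_norm
  have := h.continuous_trace
  have := h.continuous_conj
  have := (isInducing_algebraMap (K := K) (L := L)).continuous
  unfold pairAct hermAct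
  refine continuous_pi fun r => ?_
  simp only [Prod.fst_add, Prod.snd_add, Algebra.smul_def]
  fun_prop

end RamData

end ContinuityExt

/-! ### Haar measure on `V` -/

theorem val_mul_le_one {E : Type*} [Field E] [ValuativeRel E] {x y : E} (hx : valuation E x ≤ 1)
    (hy : valuation E y ≤ 1) : valuation E (x * y) ≤ 1 := by
  rw [map_mul]
  exact mul_le_one' hx hy

theorem val_mul_lt_one {E : Type*} [Field E] [ValuativeRel E] {x y : E} (hx : valuation E x ≤ 1)
    (hy : valuation E y < 1) : valuation E (x * y) < 1 := by
  rw [map_mul, mul_comm]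
  exact mul_lt_one_of_lt_of_le hy hx

section Volume

set_option linter.unusedSectionVars false

variable {K : Type*} [Field K] [ValuativeRel K] [TopologicalSpace K] [IsNonarchimedeanLocalField K]
variable {L : Type*} [Field L] [ValuativeRel L] [TopologicalSpace L]
  [IsNonarchimedeanLocalField L] [Algebra K L]

theorem mem_integralPoints {x : HermPair K L} : x ∈ integralPoints K L ↔
    ∀ i, valuation K (x i).1 ≤ 1 ∧ valuation L (x i).2.1 ≤ 1 ∧ valuation K (x i).2.2 ≤ 1 :=
  Set.mem_univ_pi

theorem vol_integralPoints : vol K L (integralPoints K L) = 1 := by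
  let _ : MeasurableSpace (HermPair K L) := borel _
  have : BorelSpace (HermPair K L) := ⟨rfl⟩
  exact Measure.addHaarMeasure_self (K₀ := integralCompacts K L)

theorem vol_preimage_add (A : Set (HermPair K L)) (t : HermPair K L) :
    vol K L ((fun x => x + t) ⁻¹' A) = vol K L A := by
  let _ : MeasurableSpace (HermPair K L) := borel _
  have : BorelSpace (HermPair K L) := ⟨rfl⟩
  exact measure_preimage_add_right (Measure.addHaarMeasure (integralCompacts K L)) t A

theorem vol_iUnion_of_isOpen {ι : Type*} [Fintype ι] {A : ι → Set (HermPair K L)}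
    (hA : ∀ i, IsOpen (A i)) (hd : Pairwise (Function.onFun Disjoint A)) :
    vol K L (⋃ i, A i) = ∑ i, vol K L (A i) := by
  let _ : MeasurableSpace (HermPair K L) := borel _
  have : BorelSpace (HermPair K L) := ⟨rfl⟩
  exact (measure_iUnion hd fun i => (hA i).measurableSet).trans (tsum_fintype _)

/-- A continuous automorphism of `V` preserving `V_𝒪` preserves volumes. -/
theorem vol_preimage_equiv (f : HermPair K L ≃ₜ+ HermPair K L)
    (hf : f ⁻¹' (integralPoints K L) = integralPoints K L) {A : Set (HermPair K L)}
    (hA : IsOpen A) : vol K L (f ⁻¹' A) = vol K L A := by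
  let _ : MeasurableSpace (HermPair K L) := borel _
  have : BorelSpace (HermPair K L) := ⟨rfl⟩
  set μ := Measure.addHaarMeasure (integralCompacts K L) with hμ
  have hmap : ∀ {B : Set (HermPair K L)}, IsOpen B → μ.map f B = vol K L (f ⁻¹' B) := fun hB =>
    Measure.map_apply f.continuous.measurable hB.measurableSet
  have : (μ.map f).IsAddHaarMeasure := f.isAddHaarMeasure_map μ
  have hopen : IsOpen (integralPoints K L) := isOpen_set_pi Set.finite_univ fun _ _ =>
    (isOpen_integers K).prod ((isOpen_integers L).prod (isOpen_integers K))
  have h1 := Measure.measure_isAddHaarMeasure_eq_smul_of_isOpen (μ.map f) μ hopen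
  have h2 := Measure.measure_isAddHaarMeasure_eq_smul_of_isOpen (μ.map f) μ hA
  rw [hmap hopen, hf, vol_integralPoints] at h1
  have h3 : μ (integralPoints K L) = 1 := vol_integralPoints
  rw [h3, ENNReal.smul_def, smul_eq_mul, mul_one] at h1
  rw [hmap hA, ENNReal.smul_def, ← h1, one_smul] at h2
  exact h2

/-- If each point of `X` is carried into `S` by exactly one of the volume preserving maps `f i`,
then the volume of `X` is the number of these maps times that of `S`. -/
theorem vol_eq_card_mul {ι : Type*} [Finite ι] (f : ι → HermPair K L → HermPair K L)
    {X S : Set (HermPair K L)} (hS : IsOpen S) (hf : ∀ i, Continuous (f i))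
    (hvol : ∀ i, vol K L (f i ⁻¹' S) = vol K L S) (hex : ∀ x ∈ X, ∃ i, f i x ∈ S)
    (hun : ∀ x i j, f i x ∈ S → f j x ∈ S → i = j) (hX : ∀ x i, f i x ∈ S → x ∈ X) :
    vol K L X = Nat.card ι * vol K L S := by
  have := Fintype.ofFinite ι
  have hXe : X = ⋃ i, f i ⁻¹' S := by
    ext x
    rw [Set.mem_iUnion]
    exact ⟨hex x, fun ⟨i, hi⟩ => hX x i hi⟩
  rw [hXe, vol_iUnion_of_isOpen (fun i => hS.preimage (hf i))]
  · simp [hvol, Nat.card_eq_fintype_card]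
  · intro i j hij
    rw [Function.onFun, Set.disjoint_left]
    exact fun x hi hj => hij (hun x i j hi hj)

theorem vol_eq_card_mul_add {ι : Type*} [Finite ι] (t : ι → HermPair K L)
    {X S : Set (HermPair K L)} (hS : IsOpen S) (hex : ∀ x ∈ X, ∃ i, x + t i ∈ S)
    (hun : ∀ x i j, x + t i ∈ S → x + t j ∈ S → i = j) (hX : ∀ x i, x + t i ∈ S → x ∈ X) :
    vol K L X = Nat.card ι * vol K L S :=
  vol_eq_card_mul (fun i x => x + t i) hS (fun _ => continuous_id.add continuous_const)
    (fun i => vol_preimage_add S (t i)) hex hun hX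

theorem integral_smul_add [ValuativeExtension K L] {a b : K} (ha : valuation K a ≤ 1)
    (hb : valuation K b ≤ 1) {y z : K × L × K}
    (hy : valuation K y.1 ≤ 1 ∧ valuation L y.2.1 ≤ 1 ∧ valuation K y.2.2 ≤ 1)
    (hz : valuation K z.1 ≤ 1 ∧ valuation L z.2.1 ≤ 1 ∧ valuation K z.2.2 ≤ 1) :
    valuation K (a • y + b • z).1 ≤ 1 ∧ valuation L (a • y + b • z).2.1 ≤ 1 ∧
      valuation K (a • y + b • z).2.2 ≤ 1 := by
  refine ⟨val_add_le (val_mul_le_one ha hy.1) (val_mul_le_one hb hz.1), ?_,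
    val_add_le (val_mul_le_one ha hy.2.2) (val_mul_le_one hb hz.2.2)⟩
  simp only [Prod.snd_add, Prod.fst_add, Algebra.smul_def]
  exact val_add_le (val_mul_le_one ((vL_le_one_iff _).2 ha) hy.2.1)
    (val_mul_le_one ((vL_le_one_iff _).2 hb) hz.2.1)

namespace RamData

variable {σ : L ≃ₐ[K] L} {e : Eisenstein K} {η : L} [ValuativeExtension K L]

theorem hermAct_integral (h : RamData σ e η) {g : Matrix (Fin 2) (Fin 2) L}
    (hg : ∀ i j, valuation L (g i j) ≤ 1) {y : K × L × K}
    (hy : valuation K y.1 ≤ 1 ∧ valuation L y.2.1 ≤ 1 ∧ valuation K y.2.2 ≤ 1) :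
    valuation K (hermAct σ g y).1 ≤ 1 ∧ valuation L (hermAct σ g y).2.1 ≤ 1 ∧
      valuation K (hermAct σ g y).2.2 ≤ 1 := by
  have hs : ∀ {w : L}, valuation L w ≤ 1 → valuation L (σ w) ≤ 1 := fun hw => by
    rwa [h.val_conj]
  have hK : ∀ {a : K}, valuation K a ≤ 1 → valuation L (algebraMap K L a) ≤ 1 := fun ha =>
    (vL_le_one_iff _).2 ha
  have hN : ∀ {w : L}, valuation L w ≤ 1 → valuation K (Algebra.norm K w) ≤ 1 := fun hw =>
    (h.le_one_iff_norm _).1 hw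
  obtain ⟨h1, h2, h3⟩ := hy
  have hgs : ∀ i j k l, valuation L (g i j * σ (g k l)) ≤ 1 := fun i j k l =>
    val_mul_le_one (hg _ _) (hs (hg _ _))
  have hdiag : ∀ i, valuation K (Algebra.norm K (g i 0) * y.1 +
      Algebra.trace K L (g i 0 * σ (g i 1) * y.2.1) + Algebra.norm K (g i 1) * y.2.2) ≤ 1 :=
    fun i => val_add_le (val_add_le (val_mul_le_one (hN (hg _ _)) h1)
      (h.trace_le_one (val_mul_le_one (hgs _ _ _ _) h2))) (val_mul_le_one (hN (hg _ _)) h3)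
  exact ⟨hdiag 0, val_add_le (val_add_le (val_add_le (val_mul_le_one (hK h1) (hgs _ _ _ _))
    (val_mul_le_one (hgs _ _ _ _) h2)) (val_mul_le_one (hgs _ _ _ _) (hs h2)))
    (val_mul_le_one (hK h3) (hgs _ _ _ _)), hdiag 1⟩

theorem pairAct_mem_integralPoints (h : RamData σ e η) {g : Matrix (Fin 2) (Fin 2) L}
    {k : Matrix (Fin 2) (Fin 2) K} (hg : IntMat g) (hk : IntMat k) {x : HermPair K L}
    (hx : x ∈ integralPoints K L) : pairAct σ g k x ∈ integralPoints K L := by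
  rw [mem_integralPoints] at hx ⊢
  intro r
  exact h.hermAct_integral hg.int (integral_smul_add (hk.int _ _) (hk.int _ _) (hx 0) (hx 1))

theorem vol_preimage_pairAct (h : RamData σ e η) {g : Matrix (Fin 2) (Fin 2) L}
    {k : Matrix (Fin 2) (Fin 2) K} (hg : IntMat g) (hk : IntMat k) {A : Set (HermPair K L)}
    (hA : IsOpen A) : vol K L (pairAct σ g k ⁻¹' A) = vol K L A := by
  have hl : ∀ x : HermPair K L, pairAct σ g⁻¹ k⁻¹ (pairAct σ g k x) = x := fun x => by
    rw [h.pairAct_pairAct, hg.inv_mul, hk.inv_mul, h.pairAct_one]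
  have hr : ∀ x : HermPair K L, pairAct σ g k (pairAct σ g⁻¹ k⁻¹ x) = x := fun x => by
    rw [h.pairAct_pairAct, hg.mul_inv, hk.mul_inv, h.pairAct_one]
  refine vol_preimage_equiv
    { toFun := pairAct σ g k
      invFun := pairAct σ g⁻¹ k⁻¹
      left_inv := hl
      right_inv := hr
      map_add' := h.pairAct_add g k
      continuous_toFun := h.continuous_pairAct g k
      continuous_invFun := h.continuous_pairAct _ _ } ?_ hA
  ext x
  refine ⟨fun hx => ?_, h.pairAct_mem_integralPoints hg hk⟩
  have := h.pairAct_mem_integralPoints hg.inv hk.inv hx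
  exact hl x ▸ this

end RamData

end Volume

/-! ### Residues -/

section Residues

set_option linter.unusedSectionVars false

variable {E : Type*} [Field E] [ValuativeRel E] [TopologicalSpace E] [IsNonarchimedeanLocalField E]

theorem card_quotient_pow (n : ℕ) : Nat.card (𝒪[E] ⧸ 𝓂[E] ^ n) = resCard E ^ n := by
  have := cardQuot_pow_of_prime (S := 𝒪[E]) (P := 𝓂[E])
    (IsDiscreteValuationRing.not_a_field 𝒪[E]) (i := n)
  simp only [Submodule.cardQuot_apply] at this
  exact this

theorem one_lt_resCard : 1 < resCard E := Finite.one_lt_card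

/-- Representatives for the classes of integers modulo the `n`-th power of the maximal ideal. -/
theorem exists_representatives {c : E} (hc : IsUnif c) (n : ℕ) :
    ∃ R : Fin (resCard E ^ n) → E, (∀ i, valuation E (R i) ≤ 1) ∧
      (∀ x, valuation E x ≤ 1 → ∃ i, valuation E (x + R i) ≤ valuation E c ^ n) ∧
      ∀ i j, valuation E (R i - R j) ≤ valuation E c ^ n → i = j := by
  have hcard := card_quotient_pow (E := E) n
  have hpos : 0 < resCard E ^ n := pow_pos (zero_lt_one.trans one_lt_resCard) n
  have : Finite (𝒪[E] ⧸ 𝓂[E] ^ n) := Nat.finite_of_card_ne_zero (hcard ▸ hpos.ne')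
  let φ := Finite.equivFinOfCardEq hcard
  have hsurj := Ideal.Quotient.mk_surjective (I := 𝓂[E] ^ n)
  choose r hr using fun i => hsurj (φ.symm i)
  refine ⟨fun i => r i, fun i => (r i).2, fun x hx => ?_, fun i j hij => ?_⟩
  · refine ⟨φ (Ideal.Quotient.mk _ (-⟨x, hx⟩)), ?_⟩
    have h1 := hr (φ (Ideal.Quotient.mk _ (-⟨x, hx⟩)))
    rw [Equiv.symm_apply_apply, Ideal.Quotient.eq, hc.mem_maximal_pow, sub_neg_eq_add] at h1
    rw [add_comm]
    exact h1
  · rw [← φ.symm.injective.eq_iff, ← hr, ← hr, Ideal.Quotient.eq, hc.mem_maximal_pow]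
    exact hij

open Classical in
/-- The residue of an element of `E`, which is `0` by convention if the element is not integral. -/
noncomputable def red (x : E) : 𝓀[E] :=
  if h : valuation E x ≤ 1 then IsLocalRing.residue 𝒪[E] ⟨x, h⟩ else 0

theorem red_eq {x : E} (h : valuation E x ≤ 1) : red x = IsLocalRing.residue 𝒪[E] ⟨x, h⟩ :=
  dif_pos h

theorem red_add {x y : E} (hx : valuation E x ≤ 1) (hy : valuation E y ≤ 1) :
    red (x + y) = red x + red y := by
  rw [red_eq hx, red_eq hy, red_eq (val_add_le hx hy), ← map_add]
  rfl

theorem red_sub {x y : E} (hx : valuation E x ≤ 1) (hy : valuation E y ≤ 1) :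
    red (x - y) = red x - red y := by
  rw [red_eq hx, red_eq hy, red_eq (val_sub_le hx hy), ← map_sub]
  rfl

theorem red_mul {x y : E} (hx : valuation E x ≤ 1) (hy : valuation E y ≤ 1) :
    red (x * y) = red x * red y := by
  rw [red_eq hx, red_eq hy, red_eq (val_mul_le_one hx hy), ← map_mul]
  rfl

theorem red_eq_zero_iff {x : E} (hx : valuation E x ≤ 1) : red x = 0 ↔ valuation E x < 1 := by
  rw [red_eq hx, IsLocalRing.residue_eq_zero_iff, mem_maximal_iff]

theorem red_one : red (1 : E) = 1 := by
  rw [red_eq (by simp)]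
  exact map_one _

theorem red_eq_iff {x y : E} (hx : valuation E x ≤ 1) (hy : valuation E y ≤ 1) :
    red x = red y ↔ valuation E (x - y) < 1 := by
  rw [← red_eq_zero_iff (val_sub_le hx hy), red_sub hx hy, sub_eq_zero]

theorem exists_red_eq (r : 𝓀[E]) : ∃ x : E, valuation E x ≤ 1 ∧ red x = r := by
  obtain ⟨x, rfl⟩ := IsLocalRing.residue_surjective r
  exact ⟨x, x.2, red_eq x.2⟩

theorem red_det {g : Matrix (Fin 2) (Fin 2) E} (hg : ∀ i j, valuation E (g i j) ≤ 1) :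
    red g.det = (g.map red).det := by
  rw [Matrix.det_fin_two, Matrix.det_fin_two, red_sub (val_mul_le_one (hg _ _) (hg _ _))
    (val_mul_le_one (hg _ _) (hg _ _)), red_mul (hg _ _) (hg _ _), red_mul (hg _ _) (hg _ _)]
  rfl

theorem intMat_iff_red {g : Matrix (Fin 2) (Fin 2) E} (hg : ∀ i j, valuation E (g i j) ≤ 1) :
    IntMat g ↔ (g.map red).det ≠ 0 := by
  have hd : valuation E g.det ≤ 1 := by
    rw [Matrix.det_fin_two]
    exact val_sub_le (val_mul_le_one (hg _ _) (hg _ _)) (val_mul_le_one (hg _ _) (hg _ _))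
  rw [← red_det hg, Ne, red_eq_zero_iff hd, not_lt]
  exact ⟨fun h => h.det.ge, fun h => ⟨hg, le_antisymm hd h⟩⟩

end Residues

/-! ### The action over the residue field -/

section ResidueAction

variable {k : Type*} [Field k]

/-- The action of a pair of matrices on pairs of symmetric matrices over a field of
characteristic two, in coordinates. -/
def symPairAct (g m : Matrix (Fin 2) (Fin 2) k) (y : Fin 2 → k × k × k) : Fin 2 → k × k × k :=
  fun r =>
    let z := m r 0 • y 0 + m r 1 • y 1
    (g 0 0 ^ 2 * z.1 + g 0 1 ^ 2 * z.2.2,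
      g 0 0 * g 1 0 * z.1 + (g 0 0 * g 1 1 + g 0 1 * g 1 0) * z.2.1 + g 0 1 * g 1 1 * z.2.2,
      g 1 0 ^ 2 * z.1 + g 1 1 ^ 2 * z.2.2)

/-- The residue of the pairs in `baseSet`. -/
def symBase (k : Type*) [Field k] : Fin 2 → k × k × k := ![(0, 1, 0), (1, 0, 0)]

/-- Representatives in `GL₂(k)` for the cosets of the group of lower triangular matrices. -/
def cosetMatrix : Option k → Matrix (Fin 2) (Fin 2) k
  | none => !![0, 1; 1, 0]
  | some r => !![1, 0; r, 1]

theorem det_cosetMatrix_ne_zero (r : Option k) : (cosetMatrix r).det ≠ 0 := by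
  cases r <;> simp [cosetMatrix, Matrix.det_fin_two]

theorem symPairAct_symPairAct [CharP k 2] (g m g' m' : Matrix (Fin 2) (Fin 2) k)
    (y : Fin 2 → k × k × k) :
    symPairAct g' m' (symPairAct g m y) = symPairAct (g' * g) (m' * m) y := by
  have h2 : (2 : k) = 0 := CharTwo.two_eq_zero
  funext r
  simp only [symPairAct, Matrix.mul_apply, Fin.sum_univ_two, Prod.fst_add, Prod.snd_add,
    Prod.smul_fst, Prod.smul_snd, smul_eq_mul]
  ext
  · simp only
    linear_combination h2 * (-(g' 0 0 * g 0 0 * g' 0 1 * g 1 0) *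
      ((m' r 0 * m 0 0 + m' r 1 * m 1 0) * (y 0).1 + (m' r 0 * m 0 1 + m' r 1 * m 1 1) * (y 1).1)
      - (g' 0 0 * g 0 1 * g' 0 1 * g 1 1) * ((m' r 0 * m 0 0 + m' r 1 * m 1 0) * (y 0).2.2
        + (m' r 0 * m 0 1 + m' r 1 * m 1 1) * (y 1).2.2))
  · simp only
    linear_combination h2 * (-(g' 0 0 * g' 1 0 * g 0 0 * g 0 1 + g' 0 1 * g' 1 1 * g 1 0 * g 1 1)) *
      ((m' r 0 * m 0 0 + m' r 1 * m 1 0) * (y 0).2.1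
        + (m' r 0 * m 0 1 + m' r 1 * m 1 1) * (y 1).2.1)
  · simp only
    linear_combination h2 * (-(g' 1 0 * g 0 0 * g' 1 1 * g 1 0) *
      ((m' r 0 * m 0 0 + m' r 1 * m 1 0) * (y 0).1 + (m' r 0 * m 0 1 + m' r 1 * m 1 1) * (y 1).1)
      - (g' 1 0 * g 0 1 * g' 1 1 * g 1 1) * ((m' r 0 * m 0 0 + m' r 1 * m 1 0) * (y 0).2.2
        + (m' r 0 * m 0 1 + m' r 1 * m 1 1) * (y 1).2.2))

theorem symPairAct_base_eq_iff [CharP k 2] {g : Matrix (Fin 2) (Fin 2) k} (hg : g.det ≠ 0)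
    (m : Matrix (Fin 2) (Fin 2) k) : symPairAct g m (symBase k) = symBase k ↔
      g 0 0 ≠ 0 ∧ g 1 0 = 0 ∧ m = !![g.det⁻¹, 0; 0, (g 0 0 ^ 2)⁻¹] := by
  have h2 : (2 : k) = 0 := CharTwo.two_eq_zero
  have hd : g 0 0 * g 1 1 + g 0 1 * g 1 0 = g.det := by
    rw [Matrix.det_fin_two]
    linear_combination (g 0 1 * g 1 0) * h2
  have he : symPairAct g m (symBase k) = fun r => (g 0 0 ^ 2 * m r 1,
      g 0 0 * g 1 0 * m r 1 + g.det * m r 0, g 1 0 ^ 2 * m r 1) := by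
    funext r
    simp [symPairAct, symBase, hd]
  rw [he]
  constructor
  · intro h
    have h0 := congrFun h 0
    have h1 := congrFun h 1
    simp only [symBase, Matrix.cons_val_zero, Matrix.cons_val_one, Prod.mk.injEq] at h0 h1
    obtain ⟨h00, h01, -⟩ := h0
    obtain ⟨h10, h11, h12⟩ := h1
    have hg0 : g 0 0 ≠ 0 := by
      intro h
      simp [h] at h10
    have hm1 : m 1 1 ≠ 0 := by
      intro h
      simp [h] at h10
    have hg1 : g 1 0 = 0 := by simpa [hm1] using h12
    have hm0 : m 0 1 = 0 := by simpa [hg0] using h00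
    refine ⟨hg0, hg1, ?_⟩
    ext i j
    fin_cases i <;> fin_cases j
    · simpa [hg1] using eq_inv_of_mul_eq_one_right (by simpa [hg1] using h01)
    · exact hm0
    · simpa [hg1, hg] using h11
    · exact eq_inv_of_mul_eq_one_right h10
  · rintro ⟨h0, h1, rfl⟩
    funext r
    fin_cases r <;> simp [symBase, h0, h1, hg]

theorem det_cosetMatrix_mul_ne_zero (r : Option k) {g : Matrix (Fin 2) (Fin 2) k}
    (hg : g.det ≠ 0) : (cosetMatrix r * g).det ≠ 0 := by
  rw [Matrix.det_mul]
  exact mul_ne_zero (det_cosetMatrix_ne_zero r) hg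

theorem exists_symPairAct_eq [CharP k 2] {g m : Matrix (Fin 2) (Fin 2) k} (hg : g.det ≠ 0)
    (hm : m.det ≠ 0) : ∃ i : Option k × GL (Fin 2) k,
      symPairAct (cosetMatrix i.1) i.2.1 (symPairAct g m (symBase k)) = symBase k := by
  have h2 : (2 : k) = 0 := CharTwo.two_eq_zero
  obtain ⟨r, h0, h1⟩ : ∃ r : Option k, (cosetMatrix r * g) 0 0 ≠ 0 ∧
      (cosetMatrix r * g) 1 0 = 0 := by
    by_cases hg0 : g 0 0 = 0
    · refine ⟨none, ?_, ?_⟩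
      · have : g 1 0 ≠ 0 := by
          intro hg1
          simp [Matrix.det_fin_two, hg0, hg1] at hg
        simpa [cosetMatrix, Matrix.mul_apply, Fin.sum_univ_two] using this
      · simpa [cosetMatrix, Matrix.mul_apply, Fin.sum_univ_two] using hg0
    · refine ⟨some (g 1 0 / g 0 0), ?_, ?_⟩
      · simpa [cosetMatrix, Matrix.mul_apply, Fin.sum_univ_two] using hg0
      · simp only [cosetMatrix, Matrix.mul_apply, Fin.sum_univ_two, Matrix.of_apply,
          Matrix.cons_val_zero, Matrix.cons_val_one, Matrix.cons_val', one_mul]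
        rw [div_mul_cancel₀ _ hg0, CharTwo.add_self_eq_zero]
  set M : Matrix (Fin 2) (Fin 2) k :=
    !![(cosetMatrix r * g).det⁻¹, 0; 0, ((cosetMatrix r * g) 0 0 ^ 2)⁻¹] with hM
  have hn := det_cosetMatrix_mul_ne_zero r hg
  have hMm : (M * m⁻¹).det ≠ 0 := by
    rw [Matrix.det_mul, Matrix.det_nonsing_inv, Ring.inverse_eq_inv']
    refine mul_ne_zero ?_ (inv_ne_zero hm)
    rw [hM, Matrix.det_fin_two_of]
    rw [mul_zero, sub_zero]
    exact mul_ne_zero (inv_ne_zero hn) (inv_ne_zero (pow_ne_zero 2 h0))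
  refine ⟨(r, Matrix.GeneralLinearGroup.mkOfDetNeZero (M * m⁻¹) hMm), ?_⟩
  rw [symPairAct_symPairAct, symPairAct_base_eq_iff hn]
  refine ⟨h0, h1, ?_⟩
  change M * m⁻¹ * m = M
  rw [Matrix.mul_assoc, Matrix.nonsing_inv_mul _ (isUnit_iff_ne_zero.2 hm), Matrix.mul_one]

theorem eq_of_symPairAct_eq [CharP k 2] {g m : Matrix (Fin 2) (Fin 2) k} (hg : g.det ≠ 0)
    (hm : m.det ≠ 0) {i j : Option k × GL (Fin 2) k}
    (hi : symPairAct (cosetMatrix i.1) i.2.1 (symPairAct g m (symBase k)) = symBase k)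
    (hj : symPairAct (cosetMatrix j.1) j.2.1 (symPairAct g m (symBase k)) = symBase k) :
    i = j := by
  obtain ⟨r, a⟩ := i
  obtain ⟨s, b⟩ := j
  rw [symPairAct_symPairAct, symPairAct_base_eq_iff (det_cosetMatrix_mul_ne_zero _ hg)] at hi hj
  obtain ⟨hi0, hi1, hi2⟩ := hi
  obtain ⟨hj0, hj1, hj2⟩ := hj
  have hrs : r = s := by
    cases r with
    | none =>
      cases s with
      | none => rfl
      | some s =>
        simp [cosetMatrix, Matrix.mul_apply, Fin.sum_univ_two] at hi1 hj0
        exact absurd hi1 hj0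
    | some r =>
      cases s with
      | none =>
        simp [cosetMatrix, Matrix.mul_apply, Fin.sum_univ_two] at hj1 hi0
        exact absurd hj1 hi0
      | some s =>
        simp only [cosetMatrix, Matrix.mul_apply, Fin.sum_univ_two, Matrix.of_apply,
          Matrix.cons_val_zero, Matrix.cons_val_one, Matrix.cons_val', one_mul, zero_mul,
          add_zero] at hi0 hi1 hj1
        congr 1
        apply mul_right_cancel₀ hi0
        linear_combination hi1 - hj1
  subst hrs
  have hab : a = b := by
    apply Units.ext
    have := (hi2.trans hj2.symm)
    have h3 := congrArg (· * m⁻¹) this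
    simpa only [Matrix.mul_assoc, Matrix.mul_nonsing_inv _ (isUnit_iff_ne_zero.2 hm),
      Matrix.mul_one] using h3
  rw [hab]

theorem card_cosets [Finite k] : Nat.card (Option k × GL (Fin 2) k) = (Nat.card k + 1) *
    ((Nat.card k ^ 2 - 1) * (Nat.card k ^ 2 - Nat.card k)) := by
  have := Fintype.ofFinite k
  rw [Nat.card_prod, Finite.card_option, Matrix.card_GL_field]
  simp [Fin.prod_univ_two, Nat.card_eq_fintype_card]

end ResidueAction

/-! ### Decomposition of an orbit according to residues -/

section OrbitVolume

set_option linter.unusedSectionVars false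

variable {K : Type*} [Field K] [ValuativeRel K] [TopologicalSpace K] [IsNonarchimedeanLocalField K]
variable {L : Type*} [Field L] [ValuativeRel L] [TopologicalSpace L]
  [IsNonarchimedeanLocalField L] [Algebra K L]

/-- The pair of symmetric matrices over the residue field of `L` obtained by reducing an integral
pair of Hermitian matrices. -/
noncomputable def redPair (x : HermPair K L) : Fin 2 → 𝓀[L] × 𝓀[L] × 𝓀[L] :=
  fun r => (red (algebraMap K L (x r).1), red (x r).2.1, red (algebraMap K L (x r).2.2))

theorem charP_residue_two [CharP 𝓀[K] 2] [ValuativeExtension K L] : CharP 𝓀[L] 2 := by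
  have h1 : valuation L (2 : L) < 1 := by
    have := (vL_lt_one_iff (L := L) (2 : K)).2 val_two_lt_one
    rwa [map_ofNat] at this
  apply CharTwo.of_one_ne_zero_of_two_eq_zero one_ne_zero
  rw [← (red_eq_zero_iff h1.le).2 h1, ← one_add_one_eq_two, ← one_add_one_eq_two,
    red_add (by simp) (by simp), red_one]

namespace RamData

variable {σ : L ≃ₐ[K] L} {e : Eisenstein K} {η : L} [ValuativeExtension K L]

theorem red_conj (h : RamData σ e η) {w : L} (hw : valuation L w ≤ 1) : red (σ w) = red w := by
  rw [red_eq_iff (by rwa [h.val_conj]) hw]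
  obtain ⟨s, t, rfl⟩ := h.span w
  have ht := (vL_le_one_iff (L := L) t).2 ((h.le_one_iff_mk s t).1 hw).2
  have he : σ (algebraMap K L s + algebraMap K L t * η) - (algebraMap K L s + algebraMap K L t * η)
      = algebraMap K L t * (σ η - η) := by
    simp only [map_add, map_mul, AlgEquiv.commutes]
    ring
  rw [he]
  refine val_mul_lt_one ht ((Valuation.map_sub _ _ _).trans_lt ?_)
  rw [h.val_conj, max_self]
  exact h.isUnif_eta.lt_one

theorem red_norm (h : RamData σ e η) {w : L} (hw : valuation L w ≤ 1) :
    red (algebraMap K L (Algebra.norm K w)) = red w ^ 2 := by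
  rw [h.norm, red_mul hw (by rwa [h.val_conj]), h.red_conj hw, pow_two]

theorem red_trace (h : RamData σ e η) [CharP 𝓀[K] 2] {w : L} (hw : valuation L w ≤ 1) :
    red (algebraMap K L (Algebra.trace K L w)) = 0 := by
  have := charP_residue_two (K := K) (L := L)
  rw [h.trace, red_add hw (by rwa [h.val_conj]), h.red_conj hw, CharTwo.add_self_eq_zero]

theorem exists_algebraMap_red_eq (h : RamData σ e η) (r : 𝓀[L]) :
    ∃ s : K, valuation K s ≤ 1 ∧ red (algebraMap K L s) = r := by
  obtain ⟨w, hw, rfl⟩ := exists_red_eq r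
  obtain ⟨s, t, rfl⟩ := h.span w
  obtain ⟨hs, ht⟩ := (h.le_one_iff_mk s t).1 hw
  refine ⟨s, hs, (red_eq_iff ((vL_le_one_iff s).2 hs) hw).2 ?_⟩
  rw [sub_add_cancel_left, Valuation.map_neg]
  exact val_mul_lt_one ((vL_le_one_iff t).2 ht) h.isUnif_eta.lt_one

/-- The residue fields of `K` and `L` have the same cardinality. -/
theorem card_residueField (h : RamData σ e η) : Nat.card 𝓀[L] = resCard K := by
  have hc := e.isUnif
  obtain ⟨R, hR, hex, hun⟩ := exists_representatives hc 1
  have hRL := fun i => (vL_le_one_iff (L := L) (R i)).2 (hR i)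
  have hb : Function.Bijective fun i => red (algebraMap K L (R i)) := by
    constructor
    · intro i j hij
      rw [red_eq_iff (hRL i) (hRL j), ← map_sub, vL_lt_one_iff] at hij
      exact hun i j (by rw [pow_one]; exact hc.le_of_lt_one _ hij)
    · intro r
      obtain ⟨s, hs, rfl⟩ := h.exists_algebraMap_red_eq r
      obtain ⟨i, hi⟩ := hex (-s) (by rwa [Valuation.map_neg])
      refine ⟨i, (red_eq_iff (hRL i) ((vL_le_one_iff s).2 hs)).2 ?_⟩
      rw [← map_sub, vL_lt_one_iff]
      rw [pow_one, neg_add_eq_sub] at hi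
      exact hi.trans_lt hc.lt_one
  rw [← Nat.card_congr (Equiv.ofBijective _ hb), Nat.card_fin, pow_one]

theorem intMat_iff_red_algebraMap (_ : RamData σ e η) {m : Matrix (Fin 2) (Fin 2) K}
    (hm : ∀ i j, valuation K (m i j) ≤ 1) :
    IntMat m ↔ (m.map fun a => red (algebraMap K L a)).det ≠ 0 := by
  have hd : algebraMap K L m.det = (m.map (algebraMap K L)).det := (algebraMap K L).map_det m
  have hi : ∀ i j, valuation L (m.map (algebraMap K L) i j) ≤ 1 := fun i j =>
    (vL_le_one_iff _).2 (hm i j)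
  have hone := vL_eq_iff (L := L) m.det 1
  rw [map_one, map_one, map_one, hd] at hone
  have := intMat_iff_red hi
  rw [Matrix.map_map] at this
  refine Iff.trans ⟨fun hh => ⟨hi, ?_⟩, fun hh => ⟨hm, ?_⟩⟩ this
  · exact hone.1 hh.det
  · exact hone.2 hh.det

theorem mem_baseSet_iff (_ : RamData σ e η) {x : HermPair K L} :
    x ∈ baseSet K L ↔ x ∈ integralPoints K L ∧ redPair x = symBase 𝓀[L] := by
  have hiff : ∀ {a : K}, valuation K a ≤ 1 → (red (algebraMap K L a) = 0 ↔ valuation K a < 1) :=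
    fun ha => by rw [red_eq_zero_iff ((vL_le_one_iff _).2 ha), vL_lt_one_iff]
  have h1 : ∀ {w : L}, valuation L w ≤ 1 → (red w = 1 ↔ valuation L (w - 1) < 1) :=
    fun hw => by rw [← red_one, red_eq_iff hw (by simp)]
  have h1' : ∀ {a : K}, valuation K a ≤ 1 →
      (red (algebraMap K L a) = 1 ↔ valuation K (a - 1) < 1) :=
    fun {a} ha => by
      rw [h1 ((vL_le_one_iff _).2 ha), ← vL_lt_one_iff (K := K) (L := L) (a - 1),
        map_sub (algebraMap K L), map_one]
  constructor
  · rintro ⟨⟨a, b, c⟩, d, e, f⟩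
    have hb := (val_eq_one_of_sub b).le
    have hd := (val_eq_one_of_sub d).le
    refine ⟨mem_integralPoints.2 fun i => ?_, ?_⟩
    · fin_cases i
      · exact ⟨a.le, hb, c.le⟩
      · exact ⟨hd, e.le, f.le⟩
    · funext r
      fin_cases r
      · exact Prod.ext ((hiff a.le).2 a) (Prod.ext ((h1 hb).2 b) ((hiff c.le).2 c))
      · exact Prod.ext ((h1' hd).2 d) (Prod.ext ((red_eq_zero_iff e.le).2 e) ((hiff f.le).2 f))
  · rintro ⟨hx, hr⟩
    rw [mem_integralPoints] at hx
    obtain ⟨⟨a, b, c⟩, d, e, f⟩ := And.intro (hx 0) (hx 1)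
    have hr0 := congrFun hr 0
    have hr1 := congrFun hr 1
    simp only [redPair, symBase, Matrix.cons_val_zero, Matrix.cons_val_one, Prod.mk.injEq]
      at hr0 hr1
    exact ⟨⟨(hiff a).1 hr0.1, (h1 b).1 hr0.2.1, (hiff c).1 hr0.2.2⟩, (h1' d).1 hr1.1,
      (red_eq_zero_iff e).1 hr1.2.1, (hiff f).1 hr1.2.2⟩

theorem redPair_pairAct (h : RamData σ e η) [CharP 𝓀[K] 2] {g : Matrix (Fin 2) (Fin 2) L}
    {m : Matrix (Fin 2) (Fin 2) K} (hg : ∀ i j, valuation L (g i j) ≤ 1)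
    (hm : ∀ i j, valuation K (m i j) ≤ 1) {x : HermPair K L} (hx : x ∈ integralPoints K L) :
    redPair (pairAct σ g m x) =
      symPairAct (g.map red) (m.map fun a => red (algebraMap K L a)) (redPair x) := by
  rw [mem_integralPoints] at hx
  have hK : ∀ {a : K}, valuation K a ≤ 1 → valuation L (algebraMap K L a) ≤ 1 := fun ha =>
    (vL_le_one_iff _).2 ha
  have hs : ∀ {w : L}, valuation L w ≤ 1 → valuation L (σ w) ≤ 1 := fun hw => by
    rwa [h.val_conj]
  have hN : ∀ {w : L}, valuation L w ≤ 1 → valuation K (Algebra.norm K w) ≤ 1 := fun hw =>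
    (h.le_one_iff_norm _).1 hw
  -- the residue of an entry of the combination of `x 0` and `x 1`
  have hlin : ∀ (r : Fin 2) (y : Fin 2 → L), (∀ i, valuation L (y i) ≤ 1) →
      red (algebraMap K L (m r 0) * y 0 + algebraMap K L (m r 1) * y 1) =
        red (algebraMap K L (m r 0)) * red (y 0) + red (algebraMap K L (m r 1)) * red (y 1) := by
    intro r y hy
    rw [red_add (val_mul_le_one (hK (hm _ _)) (hy _)) (val_mul_le_one (hK (hm _ _)) (hy _)),
      red_mul (hK (hm _ _)) (hy _), red_mul (hK (hm _ _)) (hy _)]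
  have hact : ∀ (r : Fin 2) (y : K × L × K), valuation K y.1 ≤ 1 → valuation L y.2.1 ≤ 1 →
      valuation K y.2.2 ≤ 1 → red (algebraMap K L (hermAct σ g y).1) = red (g 0 0) ^ 2 *
        red (algebraMap K L y.1) + red (g 0 1) ^ 2 * red (algebraMap K L y.2.2) ∧
      red (hermAct σ g y).2.1 = red (g 0 0) * red (g 1 0) * red (algebraMap K L y.1)
        + (red (g 0 0) * red (g 1 1) + red (g 0 1) * red (g 1 0)) * red y.2.1
        + red (g 0 1) * red (g 1 1) * red (algebraMap K L y.2.2) ∧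
      red (algebraMap K L (hermAct σ g y).2.2) = red (g 1 0) ^ 2 *
        red (algebraMap K L y.1) + red (g 1 1) ^ 2 * red (algebraMap K L y.2.2) := by
    intro r y h1 h2 h3
    have t1 := val_mul_le_one (val_mul_le_one (hg 0 0) (hs (hg 0 1))) h2
    have t2 := val_mul_le_one (val_mul_le_one (hg 1 0) (hs (hg 1 1))) h2
    have s1 := fun i j => val_mul_le_one (hg 0 i) (hs (hg 1 j))
    refine ⟨?_, ?_, ?_⟩
    · simp only [hermAct, map_add, map_mul]
      rw [red_add (val_add_le (val_mul_le_one (hK (hN (hg _ _))) (hK h1)) (hK (h.trace_le_one t1)))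
        (val_mul_le_one (hK (hN (hg _ _))) (hK h3)),
        red_add (val_mul_le_one (hK (hN (hg _ _))) (hK h1)) (hK (h.trace_le_one t1)),
        red_mul (hK (hN (hg _ _))) (hK h1), red_mul (hK (hN (hg _ _))) (hK h3),
        h.red_norm (hg _ _), h.red_norm (hg _ _), h.red_trace t1, add_zero]
    · simp only [hermAct]
      rw [red_add (val_add_le (val_add_le (val_mul_le_one (hK h1) (s1 _ _))
          (val_mul_le_one (s1 _ _) h2)) (val_mul_le_one (s1 _ _) (hs h2)))
          (val_mul_le_one (hK h3) (s1 _ _)),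
        red_add (val_add_le (val_mul_le_one (hK h1) (s1 _ _))
          (val_mul_le_one (s1 _ _) h2)) (val_mul_le_one (s1 _ _) (hs h2)),
        red_add (val_mul_le_one (hK h1) (s1 _ _)) (val_mul_le_one (s1 _ _) h2),
        red_mul (hK h1) (s1 _ _), red_mul (s1 _ _) h2, red_mul (s1 _ _) (hs h2),
        red_mul (hK h3) (s1 _ _), h.red_conj h2]
      simp only [red_mul (hg _ _) (hs (hg _ _)), h.red_conj (hg _ _)]
      ring
    · simp only [hermAct, map_add, map_mul]
      rw [red_add (val_add_le (val_mul_le_one (hK (hN (hg _ _))) (hK h1)) (hK (h.trace_le_one t2)))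
        (val_mul_le_one (hK (hN (hg _ _))) (hK h3)),
        red_add (val_mul_le_one (hK (hN (hg _ _))) (hK h1)) (hK (h.trace_le_one t2)),
        red_mul (hK (hN (hg _ _))) (hK h1), red_mul (hK (hN (hg _ _))) (hK h3),
        h.red_norm (hg _ _), h.red_norm (hg _ _), h.red_trace t2, add_zero]
  funext r
  have hz := integral_smul_add (hm r 0) (hm r 1) (hx 0) (hx 1)
  obtain ⟨e1, e2, e3⟩ := hact r _ hz.1 hz.2.1 hz.2.2
  have l1 := hlin r (fun i => algebraMap K L (x i).1) fun i => hK (hx i).1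
  have l2 := hlin r (fun i => (x i).2.1) fun i => (hx i).2.1
  have l3 := hlin r (fun i => algebraMap K L (x i).2.2) fun i => hK (hx i).2.2
  simp only [← map_mul, ← map_add] at l1 l3
  simp only [← Algebra.smul_def] at l2
  refine Prod.ext (e1.trans ?_) (Prod.ext (e2.trans ?_) (e3.trans ?_))
  all_goals
    simp only [symPairAct, redPair, Matrix.map_apply, Prod.fst_add, Prod.snd_add, Prod.smul_fst,
      Prod.smul_snd, smul_eq_mul, l1, l2, l3]

/-- The volume of an orbit through `baseSet` is a multiple of that of its part in `baseSet`: the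
residues of its points form one orbit of `GL₂ × GL₂` over the residue field, which is parametrized
by the product of the projective line with `GL₂`. -/
theorem vol_orbit (h : RamData σ e η) [CharP 𝓀[K] 2] {x : HermPair K L} (hx : x ∈ baseSet K L)
    (hopen : IsOpen (orbit σ x ∩ baseSet K L)) :
    vol K L (orbit σ x) = ((resCard K + 1) * ((resCard K ^ 2 - 1) *
      (resCard K ^ 2 - resCard K)) : ℕ) * vol K L (orbit σ x ∩ baseSet K L) := by
  have := charP_residue_two (K := K) (L := L)
  have hxb := h.mem_baseSet_iff.1 hx
  choose lift hlift1 hlift2 using exists_red_eq (E := L)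
  choose liftK hliftK1 hliftK2 using h.exists_algebraMap_red_eq
  set G : Option 𝓀[L] → Matrix (Fin 2) (Fin 2) L := fun r => (cosetMatrix r).map lift with hG
  set M : GL (Fin 2) 𝓀[L] → Matrix (Fin 2) (Fin 2) K := fun a => a.1.map liftK with hM
  have hGi : ∀ r i j, valuation L (G r i j) ≤ 1 := fun r i j => hlift1 _
  have hMi : ∀ a i j, valuation K (M a i j) ≤ 1 := fun a i j => hliftK1 _
  have hGr : ∀ r, (G r).map red = cosetMatrix r := fun r => by
    ext i j
    exact hlift2 _
  have hMr : ∀ a, (M a).map (fun s => red (algebraMap K L s)) = a.1 := fun a => by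
    ext i j
    exact hliftK2 _
  have hGI : ∀ r, IntMat (G r) := fun r => by
    rw [intMat_iff_red (hGi r), hGr]
    exact det_cosetMatrix_ne_zero r
  have hMI : ∀ a, IntMat (M a) := fun a => by
    rw [h.intMat_iff_red_algebraMap (hMi a), hMr]
    exact ((Matrix.isUnit_iff_isUnit_det _).1 a.isUnit).ne_zero
  have hint : ∀ y ∈ orbit σ x, y ∈ integralPoints K L := by
    intro y hy
    obtain ⟨g, m, hg, hm, rfl⟩ := h.mem_orbit_iff.1 hy
    exact h.pairAct_mem_integralPoints hg hm hxb.1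
  have hiff : ∀ y ∈ orbit σ x, ∀ r a, pairAct σ (G r) (M a) y ∈ orbit σ x ∩ baseSet K L ↔
      symPairAct (cosetMatrix r) a.1 (redPair y) = symBase 𝓀[L] := by
    intro y hy r a
    rw [Set.mem_inter_iff, h.mem_baseSet_iff, h.redPair_pairAct (hGi r) (hMi a) (hint y hy), hGr,
      hMr]
    have h1 := h.mem_orbit_trans hy (h.mem_orbit_iff.2 ⟨G r, M a, hGI r, hMI a, rfl⟩)
    exact ⟨fun hh => hh.2.2, fun hh => ⟨h1, hint _ h1, hh⟩⟩
  have hred : ∀ y ∈ orbit σ x, ∃ g m : Matrix (Fin 2) (Fin 2) 𝓀[L], g.det ≠ 0 ∧ m.det ≠ 0 ∧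
      redPair y = symPairAct g m (symBase 𝓀[L]) := by
    intro y hy
    obtain ⟨g, m, hg, hm, rfl⟩ := h.mem_orbit_iff.1 hy
    exact ⟨_, _, (intMat_iff_red hg.int).1 hg, (h.intMat_iff_red_algebraMap hm.int).1 hm, by
      rw [h.redPair_pairAct hg.int hm.int hxb.1, hxb.2]⟩
  have hback : ∀ y r a, pairAct σ (G r) (M a) y ∈ orbit σ x ∩ baseSet K L → y ∈ orbit σ x := by
    intro y r a hy
    refine h.mem_orbit_trans hy.1 (h.mem_orbit_symm ?_)
    exact h.mem_orbit_iff.2 ⟨G r, M a, hGI r, hMI a, rfl⟩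
  have hcard : Nat.card (Option 𝓀[L] × GL (Fin 2) 𝓀[L]) =
      (resCard K + 1) * ((resCard K ^ 2 - 1) * (resCard K ^ 2 - resCard K)) := by
    rw [card_cosets, h.card_residueField]
  rw [← hcard]
  refine vol_eq_card_mul (fun (i : Option 𝓀[L] × GL (Fin 2) 𝓀[L]) y =>
      pairAct σ (G i.1) (M i.2) y) hopen
    (fun i => h.continuous_pairAct _ _) ?_ ?_ ?_ ?_
  · intro i
    exact h.vol_preimage_pairAct (hGI i.1) (hMI i.2) hopen
  · intro y hy
    obtain ⟨g, m, hg, hm, hgm⟩ := hred y hy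
    obtain ⟨i, hi⟩ := exists_symPairAct_eq hg hm
    refine ⟨i, (hiff y hy i.1 i.2).2 ?_⟩
    rw [hgm]
    exact hi
  · intro y i j hi hj
    have hy := hback y i.1 i.2 hi
    obtain ⟨g, m, hg, hm, hgm⟩ := hred y hy
    have hi' := (hiff y hy i.1 i.2).1 hi
    have hj' := (hiff y hy j.1 j.2).1 hj
    rw [hgm] at hi' hj'
    exact eq_of_symPairAct_eq hg hm hi' hj'
  · intro y i hi
    exact hback y i.1 i.2 hi

end RamData

end OrbitVolume

/-! ### Orbits and regions of `baseSet` -/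

section Region

set_option linter.unusedSectionVars false

variable {K : Type*} [Field K] [ValuativeRel K] [TopologicalSpace K] [IsNonarchimedeanLocalField K]
variable {L : Type*} [Field L] [ValuativeRel L] [TopologicalSpace L]
  [IsNonarchimedeanLocalField L] [Algebra K L]

/-- The points `x` of `baseSet` such that `F_x` is an Eisenstein form and, after normalization of
`F_x` to `z ^ 2 + a₁ z + a₂`, the relation `G a₁ a₂` holds. -/
def region (σ : L ≃ₐ[K] L) (G : K → K → Prop) : Set (HermPair K L) :=
  {x | x ∈ baseSet K L ∧ IsUnif (negDet (x 1)) ∧ G (midCoeff σ x) (negDet (x 0) * negDet (x 1))}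

theorem isOpen_baseSet : IsOpen (baseSet K L) := by
  have hK := fun a : K => isOpen_val_lt (E := K) one_ne_zero a
  have hL := fun a : L => isOpen_val_lt (E := L) one_ne_zero a
  have hK0 := hK 0
  have hL0 := hL 0
  simp only [sub_zero] at hK0 hL0
  have h1 : ∀ i, Continuous fun x : HermPair K L => (x i).1 := fun i => by fun_prop
  have h2 : ∀ i, Continuous fun x : HermPair K L => (x i).2.1 := fun i => by fun_prop
  have h3 : ∀ i, Continuous fun x : HermPair K L => (x i).2.2 := fun i => by fun_prop
  exact ((hK0.preimage (h1 0)).and ((hL 1).preimage (h2 0) |>.and (hK0.preimage (h3 0)))).and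
    (((hK 1).preimage (h1 1)).and ((hL0.preimage (h2 1)).and (hK0.preimage (h3 1))))

theorem isOpen_isUnif : IsOpen {x : K | IsUnif x} := by
  rw [isOpen_iff_mem_nhds]
  intro x hx
  have hx : IsUnif x := hx
  filter_upwards [(isOpen_val_lt hx.val_pos.ne' x).mem_nhds (by simpa using hx.val_pos)] with y hy
  apply hx.of_val_eq
  have := Valuation.map_add_eq_of_lt_left (valuation K) (x := x) (y := y - x) hy
  rwa [add_sub_cancel] at this

theorem isOpen_sqClassEq [CharP 𝓀[K] 2] [CharZero K] {d : K} (hd : d ≠ 0) :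
    IsOpen {x : K | SqClassEq d x} := by
  rw [isOpen_iff_mem_nhds]
  rintro x hx
  have h4 : valuation K (4 : K) ≠ 0 := by simp
  have hx0 : x ≠ 0 := by
    obtain ⟨s, hs, rfl⟩ := hx
    exact mul_ne_zero (pow_ne_zero 2 hs) hd
  have hvx : valuation K x ≠ 0 := (Valuation.ne_zero_iff _).2 hx0
  filter_upwards [(isOpen_val_lt (mul_ne_zero h4 hvx) x).mem_nhds (by
    simpa [zero_lt_iff] using hx0)] with y hy
  obtain ⟨s, hs, hsy⟩ := exists_sq_of_sub_lt (x := y / x) (by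
    rw [div_sub_one hx0, map_div₀, div_lt_iff₀ (zero_lt_iff.2 hvx)]
    exact hy)
  exact hx.trans ⟨s, hs, by rw [← hsy]; field_simp⟩

theorem CosetRel.congr {c : K} {i : ℕ} {G : K → K → Prop} (hG : CosetRel c i G) {a a' b b' : K}
    (hb : valuation K b < 1) (hb' : valuation K b' < 1) (h : G a b)
    (ha : valuation K (a' - a) ≤ valuation K c ^ i)
    (hbb : valuation K (b' - b) ≤ valuation K c ^ i) : G a' b' := by
  obtain ⟨a'', -, h''⟩ := hG.exists_mem b' hb'
  refine hG.stable _ _ _ h'' ?_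
  have h1 := hG.sub_le _ _ _ _ hb hb' h h'' i le_rfl (by rwa [Valuation.map_sub_swap])
  have := val_add_le ha h1
  rwa [sub_add_sub_cancel] at this

theorem vol_diff_add {A B : Set (HermPair K L)} (hAB : B ⊆ A) (hB : IsOpen B) :
    vol K L (A \ B) + vol K L B = vol K L A := by
  let _ : MeasurableSpace (HermPair K L) := borel _
  have : BorelSpace (HermPair K L) := ⟨rfl⟩
  have := measure_sdiff_add_inter (μ := Measure.addHaarMeasure (integralCompacts K L)) A
    hB.measurableSet
  rwa [Set.inter_eq_right.2 hAB] at this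

theorem vol_union {A B : Set (HermPair K L)} (hd : Disjoint A B) (hB : IsOpen B) :
    vol K L (A ∪ B) = vol K L A + vol K L B := by
  let _ : MeasurableSpace (HermPair K L) := borel _
  have : BorelSpace (HermPair K L) := ⟨rfl⟩
  exact measure_union hd hB.measurableSet

namespace RamData

variable {σ : L ≃ₐ[K] L} {e : Eisenstein K} {η : L} [ValuativeExtension K L]

theorem isOpen_region (h : RamData σ e η) {c : K} (hc : IsUnif c) {i : ℕ} {G : K → K → Prop}
    (hG : CosetRel c i G) : IsOpen (region σ G) := by
  rw [isOpen_iff_mem_nhds]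
  rintro x ⟨hxb, hxu, hxG⟩
  have h1 := ((isOpen_val_le hc i (midCoeff σ x)).preimage h.continuous_midCoeff).mem_nhds
    (x := x) (by simp)
  have hcont : Continuous fun y : HermPair K L => negDet (y 0) * negDet (y 1) := by
    have := h.continuous_negDet
    fun_prop
  have h2 := ((isOpen_val_le hc i (negDet (x 0) * negDet (x 1))).preimage hcont).mem_nhds
    (x := x) (by simp)
  have hcont1 : Continuous fun y : HermPair K L => negDet (y 1) := by
    have := h.continuous_negDet
    fun_prop
  have h3 := (isOpen_isUnif.preimage hcont1).mem_nhds hxu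
  have hlt : ∀ y ∈ baseSet K L, valuation K (negDet (y 0) * negDet (y 1)) < 1 := fun y hy =>
    val_mul_lt_one (h.negDet_base_zero hy).le (h.negDet_base_one hy)
  filter_upwards [isOpen_baseSet.mem_nhds hxb, h1, h2, h3] with y hy hy1 hy2 hy3
  exact ⟨hy, hy3, hG.congr (hlt x hxb) (hlt y hy) hxG hy1 hy2⟩

/-- The Eisenstein polynomial attached to a point of `baseSet`. -/
theorem exists_eisenstein (h : RamData σ e η) {x : HermPair K L} (hx : x ∈ baseSet K L)
    (hu : IsUnif (negDet (x 1))) : ∃ p : Eisenstein K, (p.a₁ : K) = midCoeff σ x ∧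
      (p.a₂ : K) = negDet (x 0) * negDet (x 1) ∧ p.disc = formDisc σ x := by
  have hu' : IsUnif (negDet (x 0) * negDet (x 1)) := hu.of_val_eq (by
    rw [map_mul, h.negDet_base_zero hx, one_mul])
  refine ⟨⟨⟨_, (h.midCoeff_base hx).le⟩, ⟨_, hu'.lt_one.le⟩, (mem_maximal_iff _).2
    (h.midCoeff_base hx), (mem_maximal_iff _).2 hu'.lt_one, fun hmem => ?_⟩, rfl, rfl, rfl⟩
  rw [hu'.mem_maximal_pow] at hmem
  have := (hu'.val_pow_lt_iff (m := 2) (n := 1)).2 (by norm_num)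
  rw [pow_one] at this
  exact not_le.2 this hmem

theorem stdRep_mem_baseSet (_ : RamData σ e η) (p : Eisenstein K) : stdRep L p ∈ baseSet K L := by
  have h1 := (mem_maximal_iff _).1 p.a₁_mem
  have h2 := (mem_maximal_iff _).1 p.a₂_mem
  refine ⟨⟨by simp [stdRep], by simp [stdRep], h1⟩, by simp [stdRep],
    (vL_lt_one_iff (L := L) (p.a₁ : K)).2 h1, ?_⟩
  refine (Valuation.map_sub _ _ _).trans_lt (max_lt ?_ h2)
  rw [pow_two]
  exact val_mul_lt_one h1.le h1

/-- In `baseSet`, the orbit of `w_p` is recognized by the form `F_x`: it is an Eisenstein form whose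
discriminant is that of `p` up to squares. -/
theorem mem_orbit_stdRep_iff (h : RamData σ e η) [CharZero K] {x : HermPair K L}
    (hx : x ∈ baseSet K L) (p : Eisenstein K) :
    x ∈ orbit σ (stdRep L p) ↔ IsUnif (negDet (x 1)) ∧ SqClassEq p.disc (formDisc σ x) := by
  have hinv : ∀ {y z : HermPair K L}, y ∈ orbit σ z → SqClassEq (formDisc σ z) (formDisc σ y) := by
    intro y z hy
    obtain ⟨g, m, hg, hm, rfl⟩ := h.mem_orbit_iff.1 hy
    refine ⟨Algebra.norm K g.det * m.det, mul_ne_zero ?_ hm.det_ne_zero,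
      h.formDisc_pairAct g m z⟩
    intro h0
    have := h.norm g.det
    rw [h0, map_zero, eq_comm, mul_eq_zero, map_eq_zero] at this
    exact hg.det_ne_zero (this.elim id id)
  constructor
  · intro hxp
    refine ⟨h.isUnif_negDet_of_mem_orbit ?_ ?_ hx hxp ?_, ?_⟩
    · exact h.negDet_base_zero (h.stdRep_mem_baseSet p)
    · exact h.midCoeff_base (h.stdRep_mem_baseSet p)
    · rw [h.negDet_stdRep_one]
      exact p.isUnif
    · exact h.formDisc_stdRep p ▸ hinv hxp
  · rintro ⟨hu, hd⟩
    obtain ⟨p', hp'⟩ := h.exists_stdRep_mem_orbit hx hu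
    have h1 := hinv hp'
    rw [h.formDisc_stdRep] at h1
    rw [← h.orbit_stdRep_eq (hd.trans h1)]
    exact h.mem_orbit_symm hp'

theorem isOpen_orbit_inter (h : RamData σ e η) [CharZero K] [CharP 𝓀[K] 2] (p : Eisenstein K) :
    IsOpen (orbit σ (stdRep L p) ∩ baseSet K L) := by
  have hd : p.disc ≠ 0 := fun h0 => p.disc_ne_sq 0 (by rw [h0]; ring)
  have hcont1 : Continuous fun y : HermPair K L => negDet (y 1) := by
    have := h.continuous_negDet
    fun_prop
  have := (isOpen_baseSet (K := K) (L := L)).inter ((isOpen_isUnif.preimage hcont1).inter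
    ((isOpen_sqClassEq hd).preimage h.continuous_formDisc))
  convert this using 1
  ext x
  exact ⟨fun hx => ⟨hx.2, (h.mem_orbit_stdRep_iff hx.2 p).1 hx.1⟩,
    fun hx => ⟨(h.mem_orbit_stdRep_iff hx.1 p).2 hx.2, hx.1⟩⟩

/-- The total volume of the orbits attached to a complete set of classes of Eisenstein polynomials,
in terms of the relation cut out by the coefficients of these polynomials. -/
theorem sum_vol_orbit (h : RamData σ e η) [CharZero K] [CharP 𝓀[K] 2] {ι : Type*} [Fintype ι]
    (G : K → K → Prop)
    (hcongr : ∀ p p' : Eisenstein K, SqClassEq p.disc p'.disc → G p.a₁ p.a₂ → G p'.a₁ p'.a₂)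
    (p : ι → Eisenstein K) (hp : ∀ j, G (p j).a₁ (p j).a₂)
    (hex : ∀ p' : Eisenstein K, G p'.a₁ p'.a₂ → ∃ j, SqClassEq (p j).disc p'.disc)
    (hun : ∀ i j, SqClassEq (p i).disc (p j).disc → i = j) :
    ∑ j, vol K L (orbit σ (stdRep L (p j))) = ((resCard K + 1) * ((resCard K ^ 2 - 1) *
      (resCard K ^ 2 - resCard K)) : ℕ) * vol K L (region σ G) := by
  have hreg : region σ G = ⋃ j, orbit σ (stdRep L (p j)) ∩ baseSet K L := by
    ext x
    rw [Set.mem_iUnion]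
    constructor
    · rintro ⟨hx, hu, hG⟩
      obtain ⟨p', h1, h2, h3⟩ := h.exists_eisenstein hx hu
      rw [← h1, ← h2] at hG
      obtain ⟨j, hj⟩ := hex p' hG
      exact ⟨j, (h.mem_orbit_stdRep_iff hx _).2 ⟨hu, h3 ▸ hj⟩, hx⟩
    · rintro ⟨j, hj, hx⟩
      obtain ⟨hu, hd⟩ := (h.mem_orbit_stdRep_iff hx _).1 hj
      obtain ⟨p', h1, h2, h3⟩ := h.exists_eisenstein hx hu
      have := hcongr _ p' (h3 ▸ hd) (hp j)
      rw [h1, h2] at this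
      exact ⟨hx, hu, this⟩
  rw [hreg, vol_iUnion_of_isOpen fun j => h.isOpen_orbit_inter (p j), Finset.mul_sum]
  · refine Finset.sum_congr rfl fun j _ => ?_
    exact h.vol_orbit (h.stdRep_mem_baseSet (p j)) (h.isOpen_orbit_inter (p j))
  · intro i j hij
    rw [Function.onFun, Set.disjoint_left]
    intro x hi hj
    apply hij
    have h1 := ((h.mem_orbit_stdRep_iff hi.2 _).1 hi.1).2
    have h2 := ((h.mem_orbit_stdRep_iff hj.2 _).1 hj.1).2
    exact hun i j (h1.trans h2.symm)

end RamData

end Region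

/-! ### Volumes of regions -/

section Count

set_option linter.unusedSectionVars false

variable {K : Type*} [Field K] [ValuativeRel K] [TopologicalSpace K] [IsNonarchimedeanLocalField K]
variable {L : Type*} [Field L] [ValuativeRel L] [TopologicalSpace L]
  [IsNonarchimedeanLocalField L] [Algebra K L]

/-- Representatives of the maximal ideal modulo its `(n + 1)`-th power. -/
theorem exists_representatives_maximal {c : K} (hc : IsUnif c) (n : ℕ) :
    ∃ R : Fin (resCard K ^ n) → K, (∀ i, valuation K (R i) < 1) ∧
      (∀ x, valuation K x < 1 → ∃ i, valuation K (R i - x) ≤ valuation K c ^ (n + 1)) ∧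
      ∀ i j, valuation K (R i - R j) ≤ valuation K c ^ (n + 1) → i = j := by
  obtain ⟨R, hR, hex, hun⟩ := exists_representatives hc n
  refine ⟨fun i => c * R i, fun i => ?_, fun x hx => ?_, fun i j hij => hun i j ?_⟩
  · change valuation K (c * R i) < 1
    rw [mul_comm]
    exact val_mul_lt_one (hR i) hc.lt_one
  · have hxc : valuation K (-(x / c)) ≤ 1 := by
      rw [Valuation.map_neg, map_div₀]
      exact (div_le_one₀ hc.val_pos).2 (hc.le_of_lt_one x hx)
    obtain ⟨i, hi⟩ := hex _ hxc
    refine ⟨i, ?_⟩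
    have : c * R i - x = c * (-(x / c) + R i) := by
      have := hc.ne_zero
      field_simp
      ring
    rw [this, map_mul, pow_succ, mul_comm]
    exact mul_le_mul' hi le_rfl
  · rw [← mul_sub, map_mul, pow_succ, mul_comm] at hij
    exact le_of_mul_le_mul_right hij hc.val_pos

namespace CosetRel

variable {c : K} {i : ℕ} {G : K → K → Prop}

/-- Along the line `(a - d t, (n - b t) u)` with `d` a unit and `u` in the maximal ideal, the
relation `G` holds for some `t` in the maximal ideal: Newton's method. -/
theorem exists_on_line (hG : CosetRel c i G) (hc : IsUnif c) {a b d n u : K}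
    (ha : valuation K a < 1) (hb : valuation K b ≤ 1) (hd : valuation K d = 1)
    (hn : valuation K n ≤ 1) (hu : valuation K u < 1) :
    ∃ t, valuation K t < 1 ∧ G (a - d * t) ((n - b * t) * u) := by
  have hd0 : d ≠ 0 := by
    rintro rfl
    simp at hd
  have hB : ∀ {t}, valuation K t < 1 → valuation K ((n - b * t) * u) < 1 := fun ht =>
    val_mul_lt_one (val_sub_le hn (val_mul_lt_one hb ht).le) hu
  have key : ∀ j ≤ i, ∃ t a', valuation K t < 1 ∧ G a' ((n - b * t) * u) ∧
      valuation K (a - d * t - a') < 1 ∧ valuation K (a - d * t - a') ≤ valuation K c ^ j := by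
    intro j
    induction j with
    | zero =>
      intro _
      obtain ⟨a', ha', hG'⟩ := hG.exists_mem ((n - b * 0) * u) (hB (by simp))
      have h1 : valuation K (a - d * 0 - a') < 1 := by
        rw [mul_zero, sub_zero]
        exact (Valuation.map_sub _ _ _).trans_lt (max_lt ha ha')
      exact ⟨0, a', by simp, hG', h1, by simpa using h1.le⟩
    | succ j ih =>
      intro hj
      obtain ⟨t, a', ht, hG', h1, h2⟩ := ih (by omega)
      set ε := a - d * t - a' with hε
      have hεd : valuation K (ε / d) = valuation K ε := by rw [map_div₀, hd, div_one]
      have ht' : valuation K (t + ε / d) < 1 := Valuation.map_add_lt _ ht (hεd ▸ h1)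
      have hA : a - d * (t + ε / d) = a' := by
        rw [mul_add, mul_div_cancel₀ _ hd0, hε]
        ring
      obtain ⟨a'', -, hG''⟩ := hG.exists_mem _ (hB ht')
      have h3 : valuation K (a' - a'') ≤ valuation K c ^ (j + 1) := by
        refine hG.sub_le _ _ _ _ (hB ht) (hB ht') hG' hG'' _ hj ?_
        have e1 : (n - b * t) * u - (n - b * (t + ε / d)) * u = b * (ε / d * u) := by ring
        rw [e1, map_mul, map_mul, hεd, pow_succ]
        exact mul_le_of_le_one_of_le hb (mul_le_mul' h2 (hc.le_of_lt_one u hu))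
      refine ⟨t + ε / d, a'', ht', hG'', ?_, ?_⟩
      · rw [hA]
        exact h3.trans_lt (pow_lt_one₀ zero_le hc.lt_one (by omega))
      · rwa [hA]
  obtain ⟨t, a', ht, hG', -, h2⟩ := key i le_rfl
  exact ⟨t, ht, hG.stable _ _ _ hG' h2⟩

theorem unique_on_line (hG : CosetRel c i G) (hc : IsUnif c) {a b d n u t t' : K}
    (hb : valuation K b ≤ 1) (hd : valuation K d = 1) (hn : valuation K n ≤ 1)
    (hu : valuation K u < 1) (ht : valuation K t < 1) (ht' : valuation K t' < 1)
    (h : G (a - d * t) ((n - b * t) * u)) (h' : G (a - d * t') ((n - b * t') * u)) :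
    valuation K (t - t') ≤ valuation K c ^ i := by
  have hB : ∀ {t}, valuation K t < 1 → valuation K ((n - b * t) * u) < 1 := fun ht =>
    val_mul_lt_one (val_sub_le hn (val_mul_lt_one hb ht).le) hu
  have key : ∀ j ≤ i, valuation K (t - t') ≤ valuation K c ^ j := by
    intro j
    induction j with
    | zero =>
      intro _
      rw [pow_zero]
      exact val_sub_le ht.le ht'.le
    | succ j ih =>
      intro hj
      have h1 := hG.sub_le _ _ _ _ (hB ht) (hB ht') h h' (j + 1) hj (by
        have e1 : (n - b * t) * u - (n - b * t') * u = -(b * ((t - t') * u)) := by ring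
        rw [e1, Valuation.map_neg, map_mul, map_mul, pow_succ]
        exact mul_le_of_le_one_of_le hb (mul_le_mul' (ih (by omega)) (hc.le_of_lt_one u hu)))
      have e2 : a - d * t - (a - d * t') = -(d * (t - t')) := by ring
      rwa [e2, Valuation.map_neg, map_mul, hd, one_mul] at h1
  exact key i le_rfl

end CosetRel

theorem redPair_add [ValuativeExtension K L] {x y : HermPair K L} (hx : x ∈ integralPoints K L)
    (hy : y ∈ integralPoints K L) : redPair (x + y) = redPair x + redPair y := by
  rw [mem_integralPoints] at hx hy
  funext r
  have hK : ∀ {a : K}, valuation K a ≤ 1 → valuation L (algebraMap K L a) ≤ 1 := fun ha =>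
    (vL_le_one_iff _).2 ha
  refine Prod.ext ?_ (Prod.ext ?_ ?_)
  · change red (algebraMap K L ((x r).1 + (y r).1)) = _
    rw [map_add, red_add (hK (hx r).1) (hK (hy r).1)]
    rfl
  · exact red_add (hx r).2.1 (hy r).2.1
  · change red (algebraMap K L ((x r).2.2 + (y r).2.2)) = _
    rw [map_add, red_add (hK (hx r).2.2) (hK (hy r).2.2)]
    rfl

namespace RamData

variable {σ : L ≃ₐ[K] L} {e : Eisenstein K} {η : L} [ValuativeExtension K L]

theorem vol_baseSet (h : RamData σ e η) :
    (resCard K ^ 6 : ℕ) * vol K L (baseSet K L) = 1 := by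
  choose lift hlift1 hlift2 using h.exists_algebraMap_red_eq
  let t : (Fin 2 → 𝓀[L] × 𝓀[L] × 𝓀[L]) → HermPair K L := fun i r =>
    (lift (i r).1, algebraMap K L (lift (i r).2.1), lift (i r).2.2)
  have hti : ∀ i, t i ∈ integralPoints K L := fun i => mem_integralPoints.2 fun r =>
    ⟨hlift1 _, (vL_le_one_iff _).2 (hlift1 _), hlift1 _⟩
  have htr : ∀ i, redPair (t i) = i := fun i => by
    funext r
    exact Prod.ext (hlift2 _) (Prod.ext (hlift2 _) (hlift2 _))
  have hadd : ∀ {x y : HermPair K L}, x ∈ integralPoints K L → y ∈ integralPoints K L →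
      x + y ∈ integralPoints K L := fun hx hy => mem_integralPoints.2 fun r => by
    rw [mem_integralPoints] at hx hy
    exact ⟨val_add_le (hx r).1 (hy r).1, val_add_le (hx r).2.1 (hy r).2.1,
      val_add_le (hx r).2.2 (hy r).2.2⟩
  have hback : ∀ x i, x + t i ∈ integralPoints K L → x ∈ integralPoints K L := by
    intro x i hx
    rw [mem_integralPoints] at hx ⊢
    have ht := mem_integralPoints.1 (hti i)
    intro r
    have h1 := val_sub_le (hx r).1 (ht r).1
    have h2 := val_sub_le (hx r).2.1 (ht r).2.1
    have h3 := val_sub_le (hx r).2.2 (ht r).2.2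
    simpa using And.intro h1 (And.intro h2 h3)
  rw [← vol_integralPoints (K := K) (L := L)]
  have := vol_eq_card_mul_add (X := integralPoints K L) t isOpen_baseSet ?_ ?_ ?_
  · rw [this, Nat.card_fun, Nat.card_prod, Nat.card_prod, h.card_residueField, Nat.card_fin]
    congr 2
    ring
  · intro x hx
    refine ⟨symBase _ - redPair x, h.mem_baseSet_iff.2 ⟨hadd hx (hti _), ?_⟩⟩
    rw [redPair_add hx (hti _), htr, add_sub_cancel]
  · intro x i j hi hj
    rw [h.mem_baseSet_iff] at hi hj
    have hx := hback x i hi.1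
    have := hi.2.trans hj.2.symm
    rwa [redPair_add hx (hti _), redPair_add hx (hti _), htr, htr, add_right_inj] at this
  · intro x i hi
    exact hback x i (h.mem_baseSet_iff.1 hi).1

/-- The points of `baseSet` for which `F_x` is an Eisenstein form make up the proportion
`1 - q⁻¹`. -/
theorem vol_region_true (h : RamData σ e η) :
    (resCard K : ENNReal) * vol K L (region σ fun _ _ => True)
      + vol K L (baseSet K L) = resCard K * vol K L (baseSet K L) := by
  have hc := e.isUnif
  set c : K := (e.a₂ : K)
  obtain ⟨R, hR, hex, hun⟩ := exists_representatives_maximal hc 1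
  set S : Set (HermPair K L) :=
    {x | x ∈ baseSet K L ∧ valuation K (negDet (x 1)) ≤ valuation K c ^ 2} with hS
  have hcont : Continuous fun y : HermPair K L => negDet (y 1) := by
    have := h.continuous_negDet
    fun_prop
  have hSo : IsOpen S := by
    have h1 := (isOpen_val_le hc 2 0).preimage hcont
    simp only [sub_zero] at h1
    exact isOpen_baseSet.inter h1
  let t : Fin (resCard K ^ 1) → HermPair K L := fun i => ![0, (0, 0, R i)]
  have ht0 : ∀ x i, (x + t i) 0 = x 0 := fun x i => add_zero _
  have ht1 : ∀ x i, (x + t i) 1 = ((x 1).1, (x 1).2.1, (x 1).2.2 + R i) := fun x i =>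
    Prod.ext (add_zero _) (Prod.ext (add_zero _) rfl)
  have hmem : ∀ x i, x + t i ∈ baseSet K L ↔ x ∈ baseSet K L := by
    intro x i
    have h1 : valuation K ((x 1).2.2 + R i) < 1 ↔ valuation K (x 1).2.2 < 1 :=
      ⟨fun h => by
        have := (Valuation.map_sub _ _ _).trans_lt (max_lt h (hR i))
        rwa [add_sub_cancel_right] at this, fun h => Valuation.map_add_lt _ h (hR i)⟩
    simp only [baseSet, Set.mem_ofPred_eq, ht0, ht1, h1]
  have hneg : ∀ x i, negDet ((x + t i) 1) = negDet (x 1) - (x 1).1 * R i := by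
    intro x i
    rw [ht1, negDet, negDet]
    ring
  have hcard : vol K L (baseSet K L) = resCard K * vol K L S := by
    rw [vol_eq_card_mul_add (X := baseSet K L) t hSo, Nat.card_fin, pow_one]
    · intro x hx
      have hd := val_eq_one_of_sub hx.2.1
      have hd0 : (x 1).1 ≠ 0 := by
        intro h0
        simp [h0] at hd
      obtain ⟨i, hi⟩ := hex (negDet (x 1) / (x 1).1) (by
        rw [map_div₀, hd, div_one]
        exact h.negDet_base_one hx)
      refine ⟨i, (hmem x i).2 hx, ?_⟩
      have e1 : negDet (x 1) - (x 1).1 * R i = -((x 1).1 * (R i - negDet (x 1) / (x 1).1)) := by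
        field_simp
        ring
      rw [hneg, e1, Valuation.map_neg, map_mul, hd, one_mul]
      exact hi
    · intro x i j hi hj
      have hd := val_eq_one_of_sub ((hmem x i).1 hi.1).2.1
      have h1 := val_sub_le hj.2 hi.2
      have e1 : negDet (x 1) - (x 1).1 * R j - (negDet (x 1) - (x 1).1 * R i)
          = (x 1).1 * (R i - R j) := by ring
      rw [hneg, hneg, e1, map_mul, hd, one_mul] at h1
      exact hun i j h1
    · intro x i hi
      exact (hmem x i).1 hi.1
  have hdiff : region σ (fun _ _ => True) = baseSet K L \ S := by
    ext x
    constructor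
    · rintro ⟨hx, hu, -⟩
      refine ⟨hx, fun hxS => ?_⟩
      have := hxS.2
      rw [hc.val_eq hu] at this
      have h2 := (hu.val_pow_lt_iff (m := 2) (n := 1)).2 (by norm_num)
      rw [pow_one] at h2
      exact not_le.2 h2 this
    · rintro ⟨hx, hxS⟩
      have hlt := h.negDet_base_one hx
      refine ⟨hx, ?_, trivial⟩
      refine isUnif_of_mem (c := ⟨negDet (x 1), hlt.le⟩) ((mem_maximal_iff _).2 hlt) ?_
      rw [hc.mem_maximal_pow]
      exact fun hle => hxS ⟨hx, hle⟩
  have hadd := vol_diff_add (A := baseSet K L) (B := S) (fun x hx => hx.1) hSo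
  rw [hdiff]
  conv_rhs => rw [← hadd, mul_add, ← hcard]

/-- A relation of the kind of `CosetRel` modulo the `(i + 1)`-st power of the maximal ideal cuts
out the proportion `q⁻ⁱ`. -/
theorem vol_region_of_cosetRel (h : RamData σ e η) {c : K} (hc : IsUnif c) {i : ℕ}
    {G : K → K → Prop} (hG : CosetRel c (i + 1) G) :
    (resCard K ^ i : ℕ) * vol K L (region σ G) = vol K L (region σ fun _ _ => True) := by
  obtain ⟨R, hR, hex, hun⟩ := exists_representatives_maximal hc i
  let t : Fin (resCard K ^ i) → HermPair K L := fun i => ![(0, 0, R i), 0]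
  have ht0 : ∀ x i, (x + t i) 0 = ((x 0).1, (x 0).2.1, (x 0).2.2 + R i) := fun x i =>
    Prod.ext (add_zero _) (Prod.ext (add_zero _) rfl)
  have ht1 : ∀ x i, (x + t i) 1 = x 1 := fun x i => add_zero _
  have hmem : ∀ x i, x + t i ∈ baseSet K L ↔ x ∈ baseSet K L := by
    intro x i
    have h1 : valuation K ((x 0).2.2 + R i) < 1 ↔ valuation K (x 0).2.2 < 1 :=
      ⟨fun h => by
        have := (Valuation.map_sub _ _ _).trans_lt (max_lt h (hR i))
        rwa [add_sub_cancel_right] at this, fun h => Valuation.map_add_lt _ h (hR i)⟩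
    simp only [baseSet, Set.mem_ofPred_eq, ht0, ht1, h1]
  have hneg : ∀ x i, negDet ((x + t i) 0) = negDet (x 0) - (x 0).1 * R i := by
    intro x i
    rw [ht0, negDet, negDet]
    ring
  have hneg1 : ∀ x i, negDet ((x + t i) 1) = negDet (x 1) := by
    intro x i
    rw [ht1]
  have hmid : ∀ x i, midCoeff σ (x + t i) = midCoeff σ x - (x 1).1 * R i := by
    intro x i
    rw [midCoeff, ht0, ht1, midCoeff]
    ring
  have hiff : ∀ x i, x + t i ∈ region σ G ↔ x ∈ baseSet K L ∧ IsUnif (negDet (x 1)) ∧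
      G (midCoeff σ x - (x 1).1 * R i) ((negDet (x 0) - (x 0).1 * R i) * negDet (x 1)) := by
    intro x i
    rw [← hmem x i, ← hneg1 x i, ← hneg, ← hmid]
    rfl
  rw [vol_eq_card_mul_add (X := region σ fun _ _ => True) t (h.isOpen_region hc hG), Nat.card_fin]
  · rintro x ⟨hx, hu, -⟩
    have hd := val_eq_one_of_sub hx.2.1
    have hu1 := h.negDet_base_one hx
    have hn := (h.negDet_base_zero hx).le
    have hb := hx.1.1.le
    obtain ⟨s, hs, hGs⟩ := hG.exists_on_line hc (h.midCoeff_base hx) hb hd hn hu1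
    obtain ⟨i, hi⟩ := hex s hs
    refine ⟨i, (hiff x i).2 ⟨hx, hu, hG.congr ?_ ?_ hGs ?_ ?_⟩⟩
    · exact val_mul_lt_one (val_sub_le hn (val_mul_lt_one hb hs).le) hu1
    · exact val_mul_lt_one (val_sub_le hn (val_mul_lt_one hb (hR i)).le) hu1
    · have e1 : midCoeff σ x - (x 1).1 * R i - (midCoeff σ x - (x 1).1 * s)
          = -((x 1).1 * (R i - s)) := by ring
      rw [e1, Valuation.map_neg, map_mul, hd, one_mul]
      exact hi
    · have e1 : (negDet (x 0) - (x 0).1 * R i) * negDet (x 1)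
          - (negDet (x 0) - (x 0).1 * s) * negDet (x 1)
          = -((x 0).1 * negDet (x 1) * (R i - s)) := by ring
      rw [e1, Valuation.map_neg, map_mul]
      exact mul_le_of_le_one_of_le (val_mul_lt_one hb hu1).le hi
  · intro x i j hi hj
    obtain ⟨hx, hu, hi⟩ := (hiff x i).1 hi
    obtain ⟨-, -, hj⟩ := (hiff x j).1 hj
    exact hun i j (hG.unique_on_line hc hx.1.1.le (val_eq_one_of_sub hx.2.1)
      (h.negDet_base_zero hx).le (h.negDet_base_one hx) (hR i) (hR j) hi hj)
  · intro x i hi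
    obtain ⟨hx, hu, -⟩ := (hiff x i).1 hi
    exact ⟨hx, hu, trivial⟩

/-- The volume of a region, in real numbers. -/
theorem vol_region_eq (h : RamData σ e η) {c : K} (hc : IsUnif c) {i : ℕ} (hi : 1 ≤ i)
    {G : K → K → Prop} (hG : CosetRel c i G) :
    vol K L (region σ G) = ENNReal.ofReal ((resCard K : ℝ)⁻¹ ^ (i + 5) *
      (1 - (resCard K : ℝ)⁻¹)) := by
  obtain ⟨i, rfl⟩ := Nat.exists_eq_add_of_le' hi
  have h1 := h.vol_baseSet
  have h2 := h.vol_region_true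
  have h3 := h.vol_region_of_cosetRel hc hG
  have hq : (0 : ℝ) < resCard K := by exact_mod_cast zero_lt_one.trans one_lt_resCard
  have hq0 : ((resCard K ^ 6 : ℕ) : ENNReal) ≠ 0 := by
    exact_mod_cast (pow_pos (zero_lt_one.trans (one_lt_resCard (E := K))) 6).ne'
  have hqi0 : ((resCard K ^ i : ℕ) : ENNReal) ≠ 0 := by
    exact_mod_cast (pow_pos (zero_lt_one.trans (one_lt_resCard (E := K))) i).ne'
  have hb : vol K L (baseSet K L) ≠ ⊤ := by
    intro htop
    rw [htop, ENNReal.mul_top hq0] at h1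
    exact ENNReal.top_ne_one h1
  have ht : vol K L (region σ fun _ _ => True) ≠ ⊤ := by
    intro htop
    rw [htop, ENNReal.mul_top (by exact_mod_cast hq.ne'), top_add, eq_comm] at h2
    exact ENNReal.mul_ne_top (ENNReal.natCast_ne_top _) hb h2
  have hG : vol K L (region σ G) ≠ ⊤ := by
    intro htop
    rw [htop, ENNReal.mul_top hqi0] at h3
    exact ht h3.symm
  rw [← ENNReal.ofReal_toReal hG]
  congr 1
  have h1' := congrArg ENNReal.toReal h1
  have h2' := congrArg ENNReal.toReal h2
  have h3' := congrArg ENNReal.toReal h3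
  rw [ENNReal.toReal_add (ENNReal.mul_ne_top (ENNReal.natCast_ne_top _) ht) hb] at h2'
  simp only [ENNReal.toReal_mul, ENNReal.toReal_natCast, ENNReal.toReal_one, Nat.cast_pow,
    ENNReal.toReal_pow]
    at h1' h2' h3'
  have hbr : (vol K L (baseSet K L)).toReal = ((resCard K : ℝ) ^ 6)⁻¹ :=
    eq_inv_of_mul_eq_one_right h1'
  rw [hbr, ← h3'] at h2'
  have hX : (vol K L (region σ G)).toReal =
      ((resCard K : ℝ) - 1) / ((resCard K : ℝ) ^ 7 * (resCard K : ℝ) ^ i) := by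
    rw [eq_div_iff (by positivity)]
    field_simp at h2'
    linear_combination h2'
  rw [hX, inv_pow]
  field_simp
  ring

end RamData

end Count

/-! ### Families of quadratic extensions -/

section Families

set_option linter.unusedSectionVars false

universe u

variable {K : Type u} [Field K] [ValuativeRel K] [TopologicalSpace K] [IsNonarchimedeanLocalField K]
variable {L : Type*} [Field L] [ValuativeRel L] [TopologicalSpace L]
  [IsNonarchimedeanLocalField L] [Algebra K L]

theorem ell_congr [CharZero K] {p p' : Eisenstein K} (hd : SqClassEq p.disc p'.disc) :
    p.ell = p'.ell := by
  have key : ∀ {p p' : Eisenstein K}, SqClassEq p.disc p'.disc → p.ell ≤ p'.ell := by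
    intro p p' hd
    have h1 := (p.le_ell_iff p.isUnif p.ell).1 le_rfl
    exact (p'.le_ell_iff p.isUnif p.ell).2 ⟨h1.1, a₁_le_congr p.isUnif hd h1.1 h1.2⟩
  exact le_antisymm (key hd) (key hd.symm)

theorem inX_iff [CharZero K] {p : Eisenstein K} {F : Type u} [Field F] [Algebra K F]
    (hp : p.Generates F) (ℓ : ℕ) : InX K ℓ F ↔ p.ell = ℓ :=
  ⟨fun ⟨_, hp', hl⟩ => (ell_congr (Eisenstein.sqClassEq_of_generates hp hp')).trans hl,
    fun hl => ⟨p, hp, hl⟩⟩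

theorem ell_eq_iff {c : K} (hc : IsUnif c) (p : Eisenstein K) {ℓ : ℕ} (hℓ : ℓ ≤ twoOrd K) :
    p.ell = ℓ ↔ valuation K (p.a₁ : K) ≤ valuation K c ^ ℓ ∧
      ¬ valuation K (p.a₁ : K) ≤ valuation K c ^ (ℓ + 1) := by
  have h1 := p.le_ell_iff hc ℓ
  have h2 := p.le_ell_iff hc (ℓ + 1)
  constructor
  · rintro rfl
    refine ⟨(h1.1 le_rfl).2, fun hle => ?_⟩
    have := h2.2 ⟨by omega, hle⟩
    omega
  · rintro ⟨h3, h4⟩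
    have := h1.2 ⟨by omega, h3⟩
    have : ¬ ℓ + 1 ≤ p.ell := fun hle => h4 (h2.1 hle).2
    omega

theorem ell_eq_twoOrd_succ_iff {c : K} (hc : IsUnif c) (p : Eisenstein K) :
    p.ell = twoOrd K + 1 ↔ valuation K (p.a₁ : K) ≤ valuation K c ^ (twoOrd K + 1) := by
  have h1 := p.le_ell_iff hc (twoOrd K + 1)
  have h2 := p.ell_le
  constructor
  · intro h
    exact (h1.1 h.ge).2
  · intro h
    have := h1.2 ⟨le_rfl, h⟩
    omega

theorem one_sub_inv_resCard_nonneg (K : Type*) [Field K] [ValuativeRel K] [TopologicalSpace K]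
    [IsNonarchimedeanLocalField K] : 0 ≤ 1 - (resCard K : ℝ)⁻¹ := by
  have : (1 : ℝ) ≤ resCard K := by exact_mod_cast (one_lt_resCard (E := K)).le
  exact sub_nonneg.2 (inv_le_one_of_one_le₀ this)

namespace RamData

variable {σ : L ≃ₐ[K] L} {e : Eisenstein K} {η : L}

/-- The level may be computed from any Eisenstein polynomial generating the extension. -/
theorem hasLevel_iff [ValuativeExtension K L] (h : RamData σ e η) [CharZero K] {p : Eisenstein K}
    {F : Type*} [Field F] [Algebra K F] (hp : p.Generates F) (i : ℕ) :
    HasLevel K L F i ↔ LevelRel L (e.a₂ : K) i p.a₁ p.a₂ ∧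
      ¬ LevelRel L (e.a₂ : K) (i + 1) p.a₁ p.a₂ := by
  constructor
  · rintro ⟨p', hp', hl⟩
    have hd := Eisenstein.sqClassEq_of_generates hp' hp
    rw [isGreatest_level_iff e.isUnif] at hl
    exact ⟨h.levelRel_congr hd hl.1, fun hh => hl.2 (h.levelRel_congr hd.symm hh)⟩
  · intro hl
    exact ⟨p, hp, (isGreatest_level_iff e.isUnif p i).2 hl⟩

/-- A representing family of fields, in terms of the square classes of the discriminants. -/
theorem isRepSystem_spec (h : RamData σ e η) [CharZero K]
    {P : ∀ (F : Type u) [Field F] [Algebra K F], Prop} {N : ℕ} {p : Fin N → Eisenstein K}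
    (hp : IsRepSystem σ P p) {Q : Eisenstein K → Prop}
    (hPQ : ∀ (q : Eisenstein K) (F : Type u) [Field F] [Algebra K F], q.Generates F → (P F ↔ Q q)) :
    (∀ j, Q (p j)) ∧ (∀ q, Q q → ∃ j, SqClassEq (p j).disc q.disc) ∧
      ∀ i j, SqClassEq (p i).disc (p j).disc → i = j := by
  have hg := h.generates_fieldOf
  refine ⟨fun j => (hPQ _ _ (hg (p j))).1 (hp.1 j), fun q hq => ?_, fun i j hij => ?_⟩
  · obtain ⟨j, ⟨f⟩, -⟩ := hp.2 _ ((hPQ _ _ (hg q)).2 hq)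
    exact ⟨j, Eisenstein.sqClassEq_of_generates ((hg (p j)).congr f) (hg q)⟩
  · obtain ⟨m, -, hm⟩ := hp.2 _ (hp.1 j)
    have hj := hm j ⟨AlgEquiv.refl⟩
    have hi := hm i (Eisenstein.nonempty_algEquiv
      (Eisenstein.generates_of_sqClassEq (hg (p i)) hij) (hg (p j)))
    rw [hi, hj]

variable [ValuativeExtension K L]

theorem card_mul_vol_region (h : RamData σ e η) {c : K} (hc : IsUnif c) {i : ℕ} (hi : 1 ≤ i)
    {G : K → K → Prop} (hG : CosetRel c i G) :
    ((resCard K + 1) * ((resCard K ^ 2 - 1) * (resCard K ^ 2 - resCard K)) : ℕ) *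
      vol K L (region σ G) = ENNReal.ofReal ((resCard K : ℝ)⁻¹ ^ i * (1 - (resCard K : ℝ)⁻¹) *
        (1 - (resCard K : ℝ)⁻¹ ^ 2) ^ 2) := by
  have hq1 : 1 ≤ resCard K := one_lt_resCard.le
  have hq : (0 : ℝ) < resCard K := by exact_mod_cast hq1
  rw [h.vol_region_eq hc hi hG, ← ENNReal.ofReal_natCast, ← ENNReal.ofReal_mul (by positivity)]
  congr 1
  have e1 : 1 ≤ resCard K ^ 2 := Nat.one_le_pow _ _ hq1
  have e2 : resCard K ≤ resCard K ^ 2 := Nat.le_self_pow two_ne_zero _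
  push_cast [e1, e2]
  rw [inv_pow, inv_pow]
  field_simp
  ring

theorem vol_region_diff (h : RamData σ e η) {G G' : K → K → Prop} (hG' : IsOpen (region σ G'))
    (himp : ∀ p : Eisenstein K, G' p.a₁ p.a₂ → G p.a₁ p.a₂) :
    vol K L (region σ fun a b => G a b ∧ ¬ G' a b) + vol K L (region σ G')
      = vol K L (region σ G) := by
  rw [← vol_diff_add (A := region σ G) (B := region σ G') ?_ hG']
  · congr 2
    ext x
    exact ⟨fun ⟨h1, h2, h3, h4⟩ => ⟨⟨h1, h2, h3⟩, fun h5 => h4 h5.2.2⟩,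
      fun ⟨⟨h1, h2, h3⟩, h4⟩ => ⟨h1, h2, h3, fun h5 => h4 ⟨h1, h2, h5⟩⟩⟩
  · rintro x ⟨hx, hu, hx'⟩
    obtain ⟨p, h1, h2, -⟩ := h.exists_eisenstein hx hu
    rw [← h1, ← h2] at hx'
    have := himp p hx'
    rw [h1, h2] at this
    exact ⟨hx, hu, this⟩

theorem vol_region_or (h : RamData σ e η) {G G' : K → K → Prop} (hG' : IsOpen (region σ G'))
    (hdis : ∀ p : Eisenstein K, G p.a₁ p.a₂ → ¬ G' p.a₁ p.a₂) :
    vol K L (region σ fun a b => G a b ∨ G' a b) = vol K L (region σ G) + vol K L (region σ G') ∧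
      region σ (fun a b => G a b ∨ G' a b) = region σ G ∪ region σ G' := by
  have hU : region σ (fun a b => G a b ∨ G' a b) = region σ G ∪ region σ G' := by
    ext x
    constructor
    · rintro ⟨h1, h2, h3 | h3⟩
      · exact Or.inl ⟨h1, h2, h3⟩
      · exact Or.inr ⟨h1, h2, h3⟩
    · rintro (⟨h1, h2, h3⟩ | ⟨h1, h2, h3⟩)
      · exact ⟨h1, h2, Or.inl h3⟩
      · exact ⟨h1, h2, Or.inr h3⟩
  refine ⟨?_, hU⟩
  rw [hU]
  refine vol_union ?_ hG'
  rw [Set.disjoint_left]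
  rintro x ⟨hx, hu, h3⟩ ⟨-, -, h4⟩
  obtain ⟨p, h1, h2, -⟩ := h.exists_eisenstein hx hu
  rw [← h1, ← h2] at h3 h4
  exact hdis p h3 h4

theorem generates_self (h : RamData σ e η) : e.Generates L :=
  (e.generates_iff L).2 ⟨η, h.root, h.span⟩

/-- The total volume of the orbits, if the family of classes is cut out by a relation modulo a power
of the maximal ideal. -/
theorem sum_vol_orbit_cosetRel (h : RamData σ e η) [CharZero K] [CharP 𝓀[K] 2] {ι : Type*}
    [Fintype ι] {c : K} (hc : IsUnif c) {i : ℕ} (hi : 1 ≤ i) {G : K → K → Prop}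
    (hG : CosetRel c i G)
    (hcongr : ∀ p p' : Eisenstein K, SqClassEq p.disc p'.disc → G p.a₁ p.a₂ → G p'.a₁ p'.a₂)
    (p : ι → Eisenstein K) (hp : ∀ j, G (p j).a₁ (p j).a₂)
    (hex : ∀ p' : Eisenstein K, G p'.a₁ p'.a₂ → ∃ j, SqClassEq (p j).disc p'.disc)
    (hun : ∀ i j, SqClassEq (p i).disc (p j).disc → i = j) :
    ∑ j, vol K L (orbit σ (stdRep L (p j))) = ENNReal.ofReal ((resCard K : ℝ)⁻¹ ^ i *
      (1 - (resCard K : ℝ)⁻¹) * (1 - (resCard K : ℝ)⁻¹ ^ 2) ^ 2) := by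
  rw [h.sum_vol_orbit G hcongr p hp hex hun, h.card_mul_vol_region hc hi hG]

/-- The total volume of the orbits, if the family of classes is cut out by a relation modulo a power
of the maximal ideal and the negation of another such relation. -/
theorem sum_vol_orbit_sub (h : RamData σ e η) [CharZero K] [CharP 𝓀[K] 2] {ι : Type*}
    [Fintype ι] {c : K} (hc : IsUnif c) {i : ℕ} (hi : 1 ≤ i) {G G' : K → K → Prop}
    (hG : CosetRel c i G) (hG' : CosetRel c (i + 1) G')
    (himp : ∀ p : Eisenstein K, G' p.a₁ p.a₂ → G p.a₁ p.a₂)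
    (hcongr : ∀ p p' : Eisenstein K, SqClassEq p.disc p'.disc → G p.a₁ p.a₂ → G p'.a₁ p'.a₂)
    (hcongr' : ∀ p p' : Eisenstein K, SqClassEq p.disc p'.disc → G' p.a₁ p.a₂ → G' p'.a₁ p'.a₂)
    (p : ι → Eisenstein K) (hp : ∀ j, G (p j).a₁ (p j).a₂ ∧ ¬ G' (p j).a₁ (p j).a₂)
    (hex : ∀ p' : Eisenstein K, G p'.a₁ p'.a₂ ∧ ¬ G' p'.a₁ p'.a₂ →
      ∃ j, SqClassEq (p j).disc p'.disc)
    (hun : ∀ i j, SqClassEq (p i).disc (p j).disc → i = j) :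
    ∑ j, vol K L (orbit σ (stdRep L (p j))) = ENNReal.ofReal ((resCard K : ℝ)⁻¹ ^ i *
      (1 - (resCard K : ℝ)⁻¹) ^ 2 * (1 - (resCard K : ℝ)⁻¹ ^ 2) ^ 2) := by
  rw [h.sum_vol_orbit (fun a b => G a b ∧ ¬ G' a b) (fun p p' hd hh =>
    ⟨hcongr p p' hd hh.1, fun hh' => hh.2 (hcongr' p' p hd.symm hh')⟩) p hp hex hun]
  have h1 := congrArg (fun v : ENNReal => (((resCard K + 1) * ((resCard K ^ 2 - 1) *
    (resCard K ^ 2 - resCard K)) : ℕ) : ENNReal) * v)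
    (h.vol_region_diff (h.isOpen_region hc hG') himp)
  simp only [mul_add] at h1
  rw [h.card_mul_vol_region hc hi hG, h.card_mul_vol_region hc (by omega) hG'] at h1
  rw [ENNReal.eq_sub_of_add_eq ENNReal.ofReal_ne_top h1, ← ENNReal.ofReal_sub _ ?_]
  · congr 1
    ring
  · exact mul_nonneg (mul_nonneg (by positivity) (one_sub_inv_resCard_nonneg K)) (by positivity)

/-- The same, with the negations of two mutually exclusive relations. -/
theorem sum_vol_orbit_sub_sub (h : RamData σ e η) [CharZero K] [CharP 𝓀[K] 2] {ι : Type*}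
    [Fintype ι] {c : K} (hc : IsUnif c) {i : ℕ} (hi : 1 ≤ i) {G G' G'' : K → K → Prop}
    (hG : CosetRel c i G) (hG' : CosetRel c (i + 1) G') (hG'' : CosetRel c (i + 1) G'')
    (himp : ∀ p : Eisenstein K, G' p.a₁ p.a₂ ∨ G'' p.a₁ p.a₂ → G p.a₁ p.a₂)
    (hdis : ∀ p : Eisenstein K, G' p.a₁ p.a₂ → ¬ G'' p.a₁ p.a₂)
    (hcongr : ∀ p p' : Eisenstein K, SqClassEq p.disc p'.disc → G p.a₁ p.a₂ → G p'.a₁ p'.a₂)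
    (hcongr' : ∀ p p' : Eisenstein K, SqClassEq p.disc p'.disc → G' p.a₁ p.a₂ → G' p'.a₁ p'.a₂)
    (hcongr'' : ∀ p p' : Eisenstein K, SqClassEq p.disc p'.disc →
      G'' p.a₁ p.a₂ → G'' p'.a₁ p'.a₂)
    (p : ι → Eisenstein K)
    (hp : ∀ j, G (p j).a₁ (p j).a₂ ∧ ¬ (G' (p j).a₁ (p j).a₂ ∨ G'' (p j).a₁ (p j).a₂))
    (hex : ∀ p' : Eisenstein K, G p'.a₁ p'.a₂ ∧ ¬ (G' p'.a₁ p'.a₂ ∨ G'' p'.a₁ p'.a₂) →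
      ∃ j, SqClassEq (p j).disc p'.disc)
    (hun : ∀ i j, SqClassEq (p i).disc (p j).disc → i = j) :
    ∑ j, vol K L (orbit σ (stdRep L (p j))) = ENNReal.ofReal ((resCard K : ℝ)⁻¹ ^ i *
      (1 - (resCard K : ℝ)⁻¹) * (1 - 2 * (resCard K : ℝ)⁻¹) *
        (1 - (resCard K : ℝ)⁻¹ ^ 2) ^ 2) := by
  rw [h.sum_vol_orbit (fun a b => G a b ∧ ¬ (G' a b ∨ G'' a b)) (fun p p' hd hh =>
    ⟨hcongr p p' hd hh.1, fun hh' => hh.2 (hh'.imp (hcongr' p' p hd.symm)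
      (hcongr'' p' p hd.symm))⟩) p hp hex hun]
  obtain ⟨h2, h3⟩ := h.vol_region_or (h.isOpen_region hc hG'') hdis
  have hopen : IsOpen (region σ fun a b => G' a b ∨ G'' a b) := by
    rw [h3]
    exact (h.isOpen_region hc hG').union (h.isOpen_region hc hG'')
  have h1 := congrArg (fun v : ENNReal => (((resCard K + 1) * ((resCard K ^ 2 - 1) *
    (resCard K ^ 2 - resCard K)) : ℕ) : ENNReal) * v) (h.vol_region_diff hopen himp)
  simp only [mul_add, h2] at h1
  have hpos : 0 ≤ (resCard K : ℝ)⁻¹ ^ (i + 1) * (1 - (resCard K : ℝ)⁻¹) *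
      (1 - (resCard K : ℝ)⁻¹ ^ 2) ^ 2 :=
    mul_nonneg (mul_nonneg (by positivity) (one_sub_inv_resCard_nonneg K)) (by positivity)
  rw [h.card_mul_vol_region hc hi hG, h.card_mul_vol_region hc (by omega) hG',
    h.card_mul_vol_region hc (by omega) hG'', ← ENNReal.ofReal_add hpos hpos] at h1
  rw [ENNReal.eq_sub_of_add_eq ENNReal.ofReal_ne_top h1,
    ← ENNReal.ofReal_sub _ (add_nonneg hpos hpos)]
  congr 1
  ring

end RamData

end Families

theorem mainTheorem3
    -- the dyadic local field `K`
    {K : Type*} [Field K] [ValuativeRel K] [TopologicalSpace K] [IsNonarchimedeanLocalField K]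
    [CharZero K] [CharP 𝓀[K] 2]
    -- the quadratic extension `L` of `K`, with the valuation extending that of `K`
    {L : Type*} [Field L] [ValuativeRel L] [TopologicalSpace L] [IsNonarchimedeanLocalField L]
    [Algebra K L] [ValuativeExtension K L] (hquad : Module.finrank K L = 2)
    (σ : L ≃ₐ[K] L) (hσ : σ ≠ AlgEquiv.refl)
    -- `L / K` is ramified: it is generated by the roots `η₁, η₂` of an Eisenstein polynomial `e`
    (e : Eisenstein K) (η₁ η₂ : L)
    (he : e.poly.map (algebraMap K L) = (X - C η₁) * (X - C η₂))
    -- the exponent of the relative discriminant of `L / K`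
    (δ : ℕ) (hδ : relDiscr K L = 𝓂[K] ^ δ) :
    -- (1)
    (∀ ℓ₁ : ℕ, 1 ≤ ℓ₁ → ℓ₁ ≤ twoOrd K → ℓ₁ ≠ e.ell →
      ∀ (N : ℕ) (p : Fin N → Eisenstein K), IsRepSystem σ (InX K ℓ₁) p →
        ∑ j, vol K L (orbit σ (stdRep L (p j))) =
          ENNReal.ofReal ((resCard K : ℝ)⁻¹ ^ ℓ₁ *
            (1 - (resCard K : ℝ)⁻¹) ^ 2 * (1 - (resCard K : ℝ)⁻¹ ^ 2) ^ 2)) ∧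
    -- (2)
    (e.ell ≤ twoOrd K → ∀ ℓ₁ : ℕ, ℓ₁ = twoOrd K + 1 →
      ∀ (N : ℕ) (p : Fin N → Eisenstein K), IsRepSystem σ (InX K ℓ₁) p →
        ∑ j, vol K L (orbit σ (stdRep L (p j))) =
          ENNReal.ofReal ((resCard K : ℝ)⁻¹ ^ ℓ₁ *
            (1 - (resCard K : ℝ)⁻¹) * (1 - (resCard K : ℝ)⁻¹ ^ 2) ^ 2)) ∧
    -- (3)
    (e.ell ≤ twoOrd K →
      ∀ (N : ℕ) (p : Fin N → Eisenstein K), IsRepSystem σ (InXLevel K L e.ell e.ell) p →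
        ∑ j, vol K L (orbit σ (stdRep L (p j))) =
          ENNReal.ofReal ((resCard K : ℝ)⁻¹ ^ e.ell *
            (1 - (resCard K : ℝ)⁻¹) * (1 - 2 * (resCard K : ℝ)⁻¹) *
            (1 - (resCard K : ℝ)⁻¹ ^ 2) ^ 2)) ∧
    -- (4)
    (∀ i : ℕ, e.ell ≤ i → i < δ → (e.ell < i ∨ e.ell = twoOrd K + 1) →
      ∀ (N : ℕ) (p : Fin N → Eisenstein K), IsRepSystem σ (InXLevel K L e.ell i) p →
        ∑ j, vol K L (orbit σ (stdRep L (p j))) =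
          ENNReal.ofReal ((resCard K : ℝ)⁻¹ ^ i *
            (1 - (resCard K : ℝ)⁻¹) ^ 2 * (1 - (resCard K : ℝ)⁻¹ ^ 2) ^ 2)) ∧
    -- (5)
    (∀ p : Eisenstein K, IsRmRmUr K L (fieldOf σ (stdRep L p)) →
      vol K L (orbit σ (stdRep L p)) + vol K L (orbit σ (wEta K η₂)) =
        ENNReal.ofReal ((resCard K : ℝ)⁻¹ ^ δ *
          (1 - (resCard K : ℝ)⁻¹) * (1 - (resCard K : ℝ)⁻¹ ^ 2) ^ 2)) := by
  obtain ⟨h, hη₂, -⟩ := ramData_of_roots hquad hσ e he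
  have hc := e.isUnif
  have hD := h.val_disc_of_relDiscr hquad hδ
  have hell := e.one_le_ell
  have helle := (e.le_ell_iff hc e.ell).1 le_rfl
  have hδ2 : ∀ n ≤ e.ell, n ≤ twoOrd K → 2 * n ≤ δ := fun n hn hn' => by
    rw [← hc.val_pow_le_iff, ← hD]
    exact hc.disc_le e ((e.le_ell_iff hc n).1 hn).2 hn'
  have h2δ : 2 ≤ δ := hδ2 1 hell one_le_twoOrd
  have hA := fun n => cosetRel_le hc (n := n)
  have hAc : ∀ n ≤ twoOrd K + 1, ∀ p p' : Eisenstein K, SqClassEq p.disc p'.disc →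
      valuation K (p.a₁ : K) ≤ valuation K (e.a₂ : K) ^ n →
      valuation K (p'.a₁ : K) ≤ valuation K (e.a₂ : K) ^ n := fun n hn p p' hd =>
    a₁_le_congr hc hd hn
  have hLc : ∀ n, ∀ p p' : Eisenstein K, SqClassEq p.disc p'.disc →
      LevelRel L (e.a₂ : K) n p.a₁ p.a₂ → LevelRel L (e.a₂ : K) n p'.a₁ p'.a₂ :=
    fun n p p' hd => h.levelRel_congr hd
  have hAimp : ∀ n, ∀ p : Eisenstein K, valuation K (p.a₁ : K) ≤ valuation K (e.a₂ : K) ^ (n + 1) →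
      valuation K (p.a₁ : K) ≤ valuation K (e.a₂ : K) ^ n := fun n p hp =>
    hp.trans (hc.val_pow_le_iff.2 n.le_succ)
  refine ⟨?_, ?_, ?_, ?_, ?_⟩
  · intro ℓ₁ hℓ hℓ' _ N p hp
    obtain ⟨h1, h2, h3⟩ := h.isRepSystem_spec hp
      (Q := fun q => valuation K (q.a₁ : K) ≤ valuation K (e.a₂ : K) ^ ℓ₁ ∧
        ¬ valuation K (q.a₁ : K) ≤ valuation K (e.a₂ : K) ^ (ℓ₁ + 1))
      fun q F _ _ hq => (inX_iff hq ℓ₁).trans (ell_eq_iff hc q hℓ')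
    exact h.sum_vol_orbit_sub hc hℓ (hA ℓ₁) (hA (ℓ₁ + 1)) (hAimp ℓ₁) (hAc ℓ₁ (by omega))
      (hAc (ℓ₁ + 1) (by omega)) p h1 h2 h3
  · rintro - ℓ₁ rfl N p hp
    obtain ⟨h1, h2, h3⟩ := h.isRepSystem_spec hp
      (Q := fun q => valuation K (q.a₁ : K) ≤ valuation K (e.a₂ : K) ^ (twoOrd K + 1))
      fun q F _ _ hq => (inX_iff hq _).trans (ell_eq_twoOrd_succ_iff hc q)
    exact h.sum_vol_orbit_cosetRel hc (by omega) (hA _) (hAc _ le_rfl) p h1 h2 h3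
  · intro hm N p hp
    have hle : e.ell + 1 ≤ δ := by
      have := hδ2 e.ell le_rfl hm
      omega
    -- level at least `ℓ + 1` forces `ℓ(p) = ℓ`
    have hlev : ∀ q : Eisenstein K, LevelRel L (e.a₂ : K) (e.ell + 1) q.a₁ q.a₂ →
        q.ell = e.ell := fun q hq =>
      h.ell_eq_of_levelRel (by omega) (Or.inl (by omega)) hq
    obtain ⟨h1, h2, h3⟩ := h.isRepSystem_spec hp
      (Q := fun q => valuation K (q.a₁ : K) ≤ valuation K (e.a₂ : K) ^ e.ell ∧
        ¬ (valuation K (q.a₁ : K) ≤ valuation K (e.a₂ : K) ^ (e.ell + 1) ∨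
          LevelRel L (e.a₂ : K) (e.ell + 1) q.a₁ q.a₂))
      fun q F _ _ hq => by
        rw [InXLevel, inX_iff hq, h.hasLevel_iff hq, ell_eq_iff hc q hm, not_or]
        exact ⟨fun hh => ⟨hh.1.1, hh.1.2, hh.2.2⟩, fun hh => ⟨⟨hh.1, hh.2.1⟩,
          h.levelRel_of_le hD (by omega) le_rfl hh.1 q.isUnif.lt_one, hh.2.2⟩⟩
    refine h.sum_vol_orbit_sub_sub hc hell (hA _) (hA _) (h.cosetRel_level hD (by omega) hle)
      (fun q hq => hq.elim (hAimp _ q) fun hq => ((ell_eq_iff hc q hm).1 (hlev q hq)).1)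
      (fun q hq hq' => ((ell_eq_iff hc q hm).1 (hlev q hq')).2 hq) (hAc _ (by omega))
      (hAc _ (by omega)) (hLc _) p h1 h2 h3
  · intro i hi hiδ hi' N p hp
    obtain ⟨h1, h2, h3⟩ := h.isRepSystem_spec hp
      (Q := fun q => LevelRel L (e.a₂ : K) i q.a₁ q.a₂ ∧
        ¬ LevelRel L (e.a₂ : K) (i + 1) q.a₁ q.a₂)
      fun q F _ _ hq => by
        rw [InXLevel, inX_iff hq, h.hasLevel_iff hq]
        exact ⟨fun hh => hh.2, fun hh => ⟨h.ell_eq_of_levelRel hi hi' hh.1, hh⟩⟩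
    exact h.sum_vol_orbit_sub hc (hell.trans hi)
      (h.cosetRel_level hD (hell.trans hi) hiδ.le) (h.cosetRel_level hD (by omega) hiδ)
      (fun q hq => hq.mono hc i.le_succ) (hLc i) (hLc (i + 1)) p h1 h2 h3
  · rintro p ⟨hiso, p', hp', hunr⟩
    have hg := h.generates_fieldOf
    have hlev := h.levelRel_congr (Eisenstein.sqClassEq_of_generates hp' (hg p))
      (h.levelRel_of_formallyUnramified hD h2δ p' hunr)
    have hne : ¬ SqClassEq e.disc p.disc := fun hd => not_isEmpty_iff.2
      (Eisenstein.nonempty_algEquiv (hg p) (Eisenstein.generates_of_sqClassEq h.generates_self hd))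
      hiso
    -- `p` and `e` represent the extensions of level at least `δ`
    have := h.sum_vol_orbit_cosetRel hc (by omega : 1 ≤ δ)
      (h.cosetRel_level hD (by omega) le_rfl) (hLc δ) ![p, e] ?_ ?_ ?_
    · rw [h.orbit_wEta hη₂]
      simpa using this
    · intro j
      fin_cases j
      · exact hlev
      · exact h.levelRel_self δ
    · intro q hq
      by_cases hqe : SqClassEq e.disc q.disc
      · exact ⟨1, hqe⟩
      · exact ⟨0, h.sqClassEq_of_levelRel hD h2δ hlev hq hne hqe⟩
    · intro i j hij
      fin_cases i <;> fin_cases j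
      · rfl
      · exact absurd hij.symm hne
      · exact absurd hij hne
      · rfl
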